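/- \textbf{Setting.} Let $m\ge 3$, and let $s,l\ge 0$ be integers with $s+l\ge 1$. Let $L$ be a connected smooth $m$-manifold (Hausdorff, second countable) with a Riemannian metric $g$, which is the smooth part of a \emph{CS/AC manifold with $s$ conically singular (CS) ends and $l$ asymptotically conical (AC) ends}. This means the following. There are $s+l$ open subsets $S_i\subset L$ (the ends), with pairwise disjoint closures and with compact complement $L\setminus\bigcup_i S_i$; compact connected Riemannian manifolds $(\Sigma_i,g_i')$ of dimension $m-1$ without boundary (the links); and diffeomorphisms of manifolds with boundary $\phi_i:\Sigma_i\times(0,\epsilon_i]\to\overline{S_i}$ with $\phi_i(\Sigma_i\times(0,\epsilon_i))=S_i$ (for the $s$ CS ends), respectively $\phi_i:\Sigma_i\times[R_i,\infty)\to\overline{S_i}$ with $\phi_i(\Sigma_i\times(R_i,\infty))=S_i$ (for the $l$ AC ends), where $\epsilon_i,R_i>0$. There are rates $\nu_i>0$ (CS) and $\nu_i<0$ (AC) such that, with $\tilde g_i:=dr^2+r^2g_i'$ and its Levi-Civita connection $\tilde\nabla$, for every $k\ge 0$, $$|\tilde\nabla^k(\phi_i^*g-\tilde g_i)|_{\tilde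 g_i}=O(r^{\nu_i-k})$$ as $r\to 0$ on the CS ends and as $r\to\infty$ on the AC ends. The \emph{singularities} are the points added at $r=0$ on the CS ends; vanishing near the singularities means vanishing for all small $r$ on every CS end. For $\mu\in\mathbb R^s$ and $\lambda\in\mathbb R^l$ let $C^\infty_{(\mu,\lambda)}$ denote the space of smooth functions (or smooth 1-forms) $\sigma$ on $L$ such that, for all $k\ge0$, $|\nabla^k\sigma|_g=O(r^{\mu_i-k})$ as $r\to0$ on the $i$-th CS end and $|\nabla^k\sigma|_g=O(r^{\lambda_i-k})$ as $r\to\infty$ on the $i$-th AC end; here $\nabla$ is the Levi-Civita connection of $g$. Write $(\mu-1,\lambda-1)$ for the weight with all entries lowered by $1$, and $\mu>0$, $\lambda<0$, $\lambda>0$ for entrywise inequalities. Let $H^1(L;\mathbb R)$ be the space of smooth closed 1-forms modulo $d(C^\infty(L))$. Let $H^1_c(L;\mathbb R)$ and $H^1_{c,\bullet}(L;\mathbb R)$ be the first cohomology groups of the complexes of smooth forms with compact support, respectively of smooth forms that vanish in a neighbourhood of the singularities, and let $\widetilde H^1_c$ and $\widetilde H^1_{c,\bullet}$ be their images in $H^1(L;\mathbb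 R)$. A 1-form $\alpha$ is \emph{translation-invariant} on the AC end $S_i$ if $\phi_i^*\alpha$ on $\Sigma_i\times(R_i,\infty)$ is the pull-back of a 1-form on $\Sigma_i$. \textbf{Statement.} (0) The following objects exist: a finite-dimensional space $\widetilde H_{0,\infty}$ of compactly supported smooth closed 1-forms such that $\alpha\mapsto[\alpha]$ maps $\widetilde H_{0,\infty}$ isomorphically onto $\widetilde H^1_c$; a finite-dimensional space $\widetilde H_{0,\bullet}$ of smooth closed 1-forms that vanish near the singularities and are translation-invariant on the AC ends such that $\alpha\mapsto[\alpha]$ maps $\widetilde H_{0,\bullet}$ isomorphically onto $\widetilde H^1_{c,\bullet}$; and smooth functions $f_1,\dots,f_{s+l}$ on $L$ with $f_i\equiv1$ on $S_i$, $f_i\equiv 0$ on $S_j$ for $j\ne i$, and $\sum_i f_i\equiv1$. (1) For every choice of $\widetilde H_{0,\infty}$ and $f_1,\dots,f_{s+l}$ as in (0), the span $E_{0,\infty}$ of $f_1,\dots,f_{s+l}$ has dimension $s+l$ and, for all $\mu>0$ and $\lambda<0$, $$\{\text{closed 1-forms in } C^\infty_{(\mu-1,\lambda-1)}\}=\widetilde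 H_{0,\infty}\oplus d(E_{0,\infty})\oplus d\big(C^\infty_{(\mu,\lambda)}\big).$$ (2) For every choice of $\widetilde H_{0,\bullet}$ as in (0), and of smooth functions $f_i$, one for each CS end $S_i$, with $f_i\equiv1$ on $S_i$ and $f_i\equiv0$ on all other ends, the span $E_0$ of these functions has dimension $s$ and, for all $\mu>0$ and $\lambda>0$, the sum $E_0+C^\infty_{(\mu,\lambda)}$ is direct and $$\{\text{closed 1-forms in } C^\infty_{(\mu-1,\lambda-1)}\}=\widetilde H_{0,\bullet}\oplus d\big(E_0\oplus C^\infty_{(\mu,\lambda)}\big).$$ -/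

import Mathlib

open Set Filter Topology Bundle
open scoped Manifold ContDiff Pointwise

noncomputable section

namespace CSAC

/-! ### Covariant derivatives in coordinates -/

section Coordinates

variable {E : Type*} [NormedAddCommGroup E] [NormedSpace ℝ E]

/-- The Christoffel map `Γ_y(u, v)` of a metric `G` on (an open subset of) a vector space: the
vector `z` such that, for all `w`,
`2 G_y(z, w) = ∂_u G_y(v, w) + ∂_v G_y(u, w) - ∂_w G_y(u, v)`. -/
def christoffel (G : E → E →L[ℝ] E →L[ℝ] ℝ) (y u v : E) : E :=
  (G y).inverse ((1 / 2 : ℝ) •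
    (fderiv ℝ G y u v + fderiv ℝ G y v u - ((fderiv ℝ G y).flip u).flip v))

/-- The covariant derivative, for the Levi-Civita connection of `G`, of a covariant `n`-tensor
field `T` on (an open subset of) a vector space:
`(∇T)(v₀, v₁, …, vₙ) = ∂_{v₀} (T(v₁, …, vₙ)) - ∑ᵢ T(v₁, …, Γ(v₀, vᵢ), …, vₙ)`. -/
def covDeriv (G : E → E →L[ℝ] E →L[ℝ] ℝ) {n : ℕ} (T : E → (Fin n → E) → ℝ) :
    E → (Fin (n + 1) → E) → ℝ := fun y v =>
  fderiv ℝ (fun z => T z (Fin.tail v)) y (v 0) -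
    ∑ i : Fin n, T y (Function.update (Fin.tail v) i (christoffel G y (v 0) (Fin.tail v i)))

/-- The iterated covariant derivative `∇^k T` of a covariant `n`-tensor field. -/
def iterCovDeriv (G : E → E →L[ℝ] E →L[ℝ] ℝ) {n : ℕ} (T : E → (Fin n → E) → ℝ) :
    (k : ℕ) → E → (Fin (n + k) → E) → ℝ
  | 0 => T
  | k + 1 => covDeriv G (iterCovDeriv G T k)

end Coordinates

/-! ### Tensor fields on a manifold -/

section Tensors

variable {E H : Type*} [NormedAddCommGroup E] [NormedSpace ℝ E] [TopologicalSpace H]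
  (I : ModelWithCorners ℝ E H)
  {M : Type*} [TopologicalSpace M] [ChartedSpace H M]

/-- The bilinear form `(u, v) ↦ B(A u, A v)`. -/
def pullBilin {V W : Type*} [NormedAddCommGroup V] [NormedSpace ℝ V] [NormedAddCommGroup W]
    [NormedSpace ℝ W] (B : W →L[ℝ] W →L[ℝ] ℝ) (A : V →L[ℝ] W) : V →L[ℝ] V →L[ℝ] ℝ :=
  B.bilinearComp A A

/-- The coordinate expression, in the preferred chart at `p`, of a covariant tensor field. -/
def chartTensor (p : M) {n : ℕ} (T : (x : M) → (Fin n → TangentSpace I x) → ℝ) :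
    E → (Fin n → E) → ℝ := fun y v =>
  T ((extChartAt I p).symm y) (fun i => mfderiv 𝓘(ℝ, E) I (extChartAt I p).symm y (v i))

/-- The coordinate expression, in the preferred chart at `p`, of a field of bilinear forms. -/
def chartMetric (p : M) (G : (x : M) → TangentSpace I x →L[ℝ] TangentSpace I x →L[ℝ] ℝ) :
    E → E →L[ℝ] E →L[ℝ] ℝ := fun y =>
  pullBilin (V := E) (W := E) (G ((extChartAt I p).symm y))
    (mfderiv 𝓘(ℝ, E) I (extChartAt I p).symm y)

/-- The bound `|∇^k T|_G ≤ c` at the point `p`, where `∇` is the Levi-Civita connection of `G`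
and the norm of a multilinear form `S` is its operator norm, that is the least `c ≥ 0` with
`|S(v₁, …, vₙ)| ≤ c |v₁|_G ⋯ |vₙ|_G`. (It is equivalent, with constants that depend only on the
dimension and on the order of the tensor, to the Hilbert-Schmidt norm induced by `G`.) -/
def CovDerivBound (G : (x : M) → TangentSpace I x →L[ℝ] TangentSpace I x →L[ℝ] ℝ) {n : ℕ}
    (T : (x : M) → (Fin n → TangentSpace I x) → ℝ) (k : ℕ) (p : M) (c : ℝ) : Prop :=
  ∀ v : Fin (n + k) → E,
    |iterCovDeriv (chartMetric I p G) (chartTensor I p T) k (extChartAt I p p) v| ≤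
      c * ∏ i, √(chartMetric I p G (extChartAt I p p) (v i) (v i))

variable (M) in
/-- Not necessarily smooth 1-forms. -/
def OneField : Type _ := (x : M) → TangentSpace I x →L[ℝ] ℝ

instance : AddCommGroup (OneField I M) :=
  inferInstanceAs (AddCommGroup ((x : M) → TangentSpace I x →L[ℝ] ℝ))

instance : Module ℝ (OneField I M) :=
  inferInstanceAs (Module ℝ ((x : M) → TangentSpace I x →L[ℝ] ℝ))

theorem OneField.zero_apply (x : M) : (0 : OneField I M) x = 0 := rfl

theorem OneField.add_apply (α β : OneField I M) (x : M) : (α + β) x = α x + β x := rfl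

theorem OneField.smul_apply (c : ℝ) (α : OneField I M) (x : M) : (c • α) x = c • α x := rfl


variable (M) in
/-- Smooth real functions. -/
abbrev SmoothFun : Type _ := C^∞⟮I, M; 𝓘(ℝ, ℝ), ℝ⟯

/-- A function as a covariant tensor of order zero. -/
def funTensor (f : M → ℝ) : (x : M) → (Fin 0 → TangentSpace I x) → ℝ := fun x _ => f x

/-- A 1-form as a covariant tensor of order one. -/
def formTensor (α : OneField I M) : (x : M) → (Fin 1 → TangentSpace I x) → ℝ :=
  fun x v => α x (v 0)

/-- A field of bilinear forms as a covariant tensor of order two. -/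
def bilinTensor (B : (x : M) → TangentSpace I x →L[ℝ] TangentSpace I x →L[ℝ] ℝ) :
    (x : M) → (Fin 2 → TangentSpace I x) → ℝ :=
  fun x v => B x (v 0) (v 1)

variable {I} in
/-- Smoothness of a 1-form, as a section of the cotangent bundle. -/
def IsSmoothForm [IsManifold I ∞ M] (α : OneField I M) : Prop :=
  ContMDiff I (I.prod 𝓘(ℝ, E →L[ℝ] ℝ)) ∞
    (fun x : M => TotalSpace.mk' (E →L[ℝ] ℝ)
      (E := fun x : M => TangentSpace I x →L[ℝ] Trivial M ℝ x) x (α x))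

/-- The coordinate expression of a 1-form in the preferred chart at `p`. -/
def chartForm (p : M) (α : OneField I M) : E → E →L[ℝ] ℝ := fun y =>
  (α ((extChartAt I p).symm y)).comp (mfderiv 𝓘(ℝ, E) I (extChartAt I p).symm y)

variable {I} in
theorem IsSmoothForm.add [IsManifold I ∞ M] {α β : OneField I M} (hα : IsSmoothForm α)
    (hβ : IsSmoothForm β) : IsSmoothForm (α + β) := by
  exact ContMDiff.add_section hα hβ

variable {I} in
theorem isSmoothForm_zero [IsManifold I ∞ M] : IsSmoothForm (0 : OneField I M) := by
  exact contMDiff_zeroSection ℝ (fun x : M => TangentSpace I x →L[ℝ] Trivial M ℝ x)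

variable {I} in
theorem IsSmoothForm.smul [IsManifold I ∞ M] {α : OneField I M} (c : ℝ)
    (hα : IsSmoothForm α) : IsSmoothForm (c • α) := by
  exact ContMDiff.const_smul_section hα

/-- The coordinate expression of a smooth 1-form is differentiable. -/
theorem IsSmoothForm.differentiableAt_chartForm [I.Boundaryless] [IsManifold I ∞ M]
    {α : OneField I M} (hα : IsSmoothForm α) (p : M) :
    DifferentiableAt ℝ (chartForm I p α) (extChartAt I p p) := by
  have h1 := (contMDiffAt_hom_bundle (x₀ := p) _).1 (hα p) |>.2
  have h2 : ContMDiffAt 𝓘(ℝ, E) I ∞ (extChartAt I p).symm (extChartAt I p p) :=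
    (contMDiffOn_extChartAt_symm p).contMDiffAt (extChartAt_target_mem_nhds p)
  rw [← extChartAt_to_inv (I := I) p] at h1
  have h3 := (ContMDiffAt.comp (extChartAt I p p) h1 h2).mdifferentiableAt (by simp)
  have h4 := mdifferentiableAt_iff_differentiableAt.1 h3
  refine h4.congr_of_eventuallyEq ?_
  filter_upwards [extChartAt_target_mem_nhds (I := I) p] with y hy
  have hy' : (extChartAt I p).symm y ∈ (chartAt H p).source := by
    simpa using (extChartAt I p).map_target hy
  have := TangentBundle.symmL_trivializationAt (I := I) hy'
  ext v
  have hz : extChartAt I p ((extChartAt I p).symm y) = y := (extChartAt I p).right_inv hy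
  rw [hz, I.range_eq_univ, mfderivWithin_univ] at this
  simp only [chartForm, ContinuousLinearMap.inCoordinates, Function.comp_def]
  simp only [extChartAt_to_inv, this, ContinuousLinearMap.comp_apply]
  simp

variable (M) in
/-- The space of smooth closed 1-forms. The form `α` is closed if `∂_u α(v) = ∂_v α(u)` in
coordinates, at every point. -/
def closedForms [I.Boundaryless] [IsManifold I ∞ M] : Submodule ℝ (OneField I M) where
  carrier := {α | IsSmoothForm α ∧ ∀ (p : M) (u v : E),
    fderiv ℝ (chartForm I p α) (extChartAt I p p) u v =
      fderiv ℝ (chartForm I p α) (extChartAt I p p) v u}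
  zero_mem' := by
    refine ⟨isSmoothForm_zero, ?_⟩
    intro p u v
    have : chartForm I p (0 : OneField I M) = 0 := by
      funext y; ext w; rfl
    simp [this]
  add_mem' := by
    rintro α β ⟨hα, hα'⟩ ⟨hβ, hβ'⟩
    refine ⟨hα.add hβ, fun p u v => ?_⟩
    have : chartForm I p (α + β) = chartForm I p α + chartForm I p β := by
      funext y; ext w; rfl
    rw [this, fderiv_add (hα.differentiableAt_chartForm I p) (hβ.differentiableAt_chartForm I p)]
    exact congrArg₂ (· + ·) (hα' p u v) (hβ' p u v)
  smul_mem' := by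
    rintro c α ⟨hα, hα'⟩
    refine ⟨hα.smul c, fun p u v => ?_⟩
    have : chartForm I p (c • α) = c • chartForm I p α := by
      funext y; ext w; rfl
    rw [this, fderiv_const_smul (hα.differentiableAt_chartForm I p)]
    exact congrArg (c • ·) (hα' p u v)

variable (M) in
/-- The exterior derivative on smooth functions. -/
def d : SmoothFun I M →ₗ[ℝ] OneField I M where
  toFun f := mvfderiv I f
  map_add' f g := by
    funext x
    exact mvfderiv_add (f.contMDiff.mdifferentiableAt (by simp))
      (g.contMDiff.mdifferentiableAt (by simp))
  map_smul' c f := by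
    funext x
    have h := mvfderiv_smul (I := I) (x := x) (a := fun _ : M => c) (g := f)
      mdifferentiableAt_const (f.contMDiff.mdifferentiableAt (by simp))
    simpa [mvfderiv_const] using! h

end Tensors

/-! ### Cohomology in degree one, possibly with supports -/

section Cohomology

variable {E H : Type*} [NormedAddCommGroup E] [NormedSpace ℝ E] [TopologicalSpace H]
  (I : ModelWithCorners ℝ E H) [I.Boundaryless]
  (M : Type*) [TopologicalSpace M] [ChartedSpace H M] [IsManifold I ∞ M]

/-- The exact 1-forms, inside the closed ones. -/
def exactForms : Submodule ℝ (closedForms I M) :=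
  (LinearMap.range (d I M)).comap (closedForms I M).subtype

/-- The first cohomology group `H¹(M; ℝ)`. -/
abbrev H1 : Type _ := closedForms I M ⧸ exactForms I M

/-- The closed 1-forms that vanish eventually along the filter `F`. For `F = cocompact M` these
are the closed 1-forms with compact support. -/
def closedFormsV (F : Filter M) : Submodule ℝ (closedForms I M) where
  carrier := {α | ∀ᶠ x in F, (α : OneField I M) x = 0}
  zero_mem' := by simp [OneField.zero_apply]
  add_mem' := by
    intro α β hα hβ
    filter_upwards [hα, hβ] with x h1 h2
    simp [OneField.add_apply, h1, h2]
  smul_mem' := by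
    intro c α hα
    filter_upwards [hα] with x h1
    simp [OneField.smul_apply, h1]

/-- The smooth functions that vanish eventually along the filter `F`. -/
def smoothFunV (F : Filter M) : Submodule ℝ (SmoothFun I M) where
  carrier := {f | ∀ᶠ x in F, f x = 0}
  zero_mem' := by simp
  add_mem' := by
    intro α β hα hβ
    filter_upwards [hα, hβ] with x h1 h2
    simp [h1, h2]
  smul_mem' := by
    intro c α hα
    filter_upwards [hα] with x h1
    simp [h1]

/-- The differentials of smooth functions vanishing along `F`, inside `closedFormsV I M F`. -/
def exactFormsV (F : Filter M) : Submodule ℝ (closedFormsV I M F) :=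
  ((smoothFunV I M F).map (d I M)).comap
    ((closedForms I M).subtype ∘ₗ (closedFormsV I M F).subtype)

/-- The first cohomology group of the forms that vanish along `F`. For `F = cocompact M` this is
the compactly supported cohomology group `H¹_c(M; ℝ)`. -/
abbrev H1V (F : Filter M) : Type _ := closedFormsV I M F ⧸ exactFormsV I M F

/-- The map `γ` from cohomology with supports to `H¹(M; ℝ)` induced by the inclusion of forms. -/
def gammaMap (F : Filter M) : H1V I M F →ₗ[ℝ] H1 I M :=
  Submodule.mapQ _ _ (closedFormsV I M F).subtype (by
    rintro α ⟨f, -, hf⟩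
    exact ⟨f, hf⟩)

end Cohomology

/-! ### CS/AC manifolds -/

/-- The standard `m`-dimensional model space. -/
abbrev Model (m : ℕ) : Type := EuclideanSpace ℝ (Fin m)

/-- The model of `Σ × ℝ`, for `Σ` of dimension `k`. -/
abbrev coneModel (k : ℕ) : ModelWithCorners ℝ (Model k × ℝ) (ModelProd (Model k) ℝ) :=
  (𝓡 k).prod 𝓘(ℝ, ℝ)

section Cone

variable {k : ℕ} {Λ : Type*} [TopologicalSpace Λ] [ChartedSpace (Model k) Λ]

/-- The conical metric `dr² + r² g'` on `Λ × (0, ∞) ⊆ Λ × ℝ`, where `(θ, r)` is the generic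
point. -/
def coneMetric (g' : (θ : Λ) → TangentSpace (𝓡 k) θ →L[ℝ] TangentSpace (𝓡 k) θ →L[ℝ] ℝ)
    (q : Λ × ℝ) :
    TangentSpace (coneModel k) q →L[ℝ] TangentSpace (coneModel k) q →L[ℝ] ℝ :=
  pullBilin (V := Model k × ℝ) (W := ℝ) (ContinuousLinearMap.mul ℝ ℝ)
      (mfderiv (coneModel k) 𝓘(ℝ, ℝ) Prod.snd q) +
    q.2 ^ 2 • pullBilin (V := Model k × ℝ) (W := Model k) (g' q.1)
      (mfderiv (coneModel k) (𝓡 k) Prod.fst q)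

/-- The pull-back `φ^* g` of a field of bilinear forms under a map `φ : Λ × ℝ → L`. -/
def pullMetric {m : ℕ} {L : Type*} [TopologicalSpace L] [ChartedSpace (Model m) L]
    (φ : Λ × ℝ → L) (g : (x : L) → TangentSpace (𝓡 m) x →L[ℝ] TangentSpace (𝓡 m) x →L[ℝ] ℝ)
    (q : Λ × ℝ) :
    TangentSpace (coneModel k) q →L[ℝ] TangentSpace (coneModel k) q →L[ℝ] ℝ :=
  pullBilin (V := Model k × ℝ) (W := Model m) (g (φ q)) (mfderiv (coneModel k) (𝓡 m) φ q)

end Cone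

section Ranges

variable {s l : ℕ}

/-- How the radial variable tends to the singularity (`r → 0`, on a CS end) or to infinity
(`r → ∞`, on an AC end). CS ends are indexed by `Fin s` and AC ends by `Fin l`. -/
def endFilter : Fin s ⊕ Fin l → Filter ℝ := Sum.elim (fun _ => 𝓝[>] 0) (fun _ => atTop)

/-- The range of the radial variable on an open end: `(0, a)` for CS ends and `(a, ∞)` for AC
ends. -/
def openRange (a : ℝ) : Fin s ⊕ Fin l → Set ℝ := Sum.elim (fun _ => Ioo 0 a) (fun _ => Ioi a)

/-- The range of the radial variable on a closed end: `(0, a]` for CS ends and `[a, ∞)` for AC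
ends. -/
def closedRange (a : ℝ) : Fin s ⊕ Fin l → Set ℝ := Sum.elim (fun _ => Ioc 0 a) (fun _ => Ici a)

end Ranges

/-- The structure of a CS/AC manifold, with `s` CS ends and `l` AC ends and with links `Λ i`, on
an `m`-dimensional manifold `L` (the complement of the singularities). -/
structure CSACManifold (m s l : ℕ)
    (L : Type*) [TopologicalSpace L] [ChartedSpace (Model m) L] [IsManifold (𝓡 m) ∞ L]
    (Λ : Fin s ⊕ Fin l → Type*) [∀ i, TopologicalSpace (Λ i)]
    [∀ i, ChartedSpace (Model (m - 1)) (Λ i)] [∀ i, IsManifold (𝓡 (m - 1)) ∞ (Λ i)] where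
  /-- The Riemannian metric on `L`. -/
  g : ContMDiffRiemannianMetric (𝓡 m) ∞ (Model m) (fun x : L => TangentSpace (𝓡 m) x)
  /-- The Riemannian metrics on the links. -/
  g' : ∀ i, ContMDiffRiemannianMetric (𝓡 (m - 1)) ∞ (Model (m - 1))
    (fun θ : Λ i => TangentSpace (𝓡 (m - 1)) θ)
  /-- The radius `ε` (for a CS end) or `R` (for an AC end) at which the end starts. -/
  a : Fin s ⊕ Fin l → ℝ
  a_pos : ∀ i, 0 < a i
  /-- The parametrization `φᵢ` of the closed end by `Λ i × (0, ε]` or `Λ i × [R, ∞)`. Being a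
  diffeomorphism of manifolds with boundary, it extends to an open neighbourhood. -/
  φ : ∀ i, OpenPartialHomeomorph (Λ i × ℝ) L
  source_pos : ∀ i, (φ i).source ⊆ univ ×ˢ Ioi 0
  range_source : ∀ i, univ ×ˢ closedRange (a i) i ⊆ (φ i).source
  contMDiffOn_φ : ∀ i, ContMDiffOn (coneModel (m - 1)) (𝓡 m) ∞ (φ i) (φ i).source
  contMDiffOn_symm : ∀ i, ContMDiffOn (𝓡 m) (coneModel (m - 1)) ∞ (φ i).symm (φ i).target
  /-- The closure of the end `Sᵢ` is the closed end. -/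
  closure_eq : ∀ i, closure (φ i '' (univ ×ˢ openRange (a i) i)) =
    φ i '' (univ ×ˢ closedRange (a i) i)
  /-- Different ends are disjoint, with disjoint closures. -/
  disjoint : Pairwise fun i j => Disjoint (φ i '' (univ ×ˢ closedRange (a i) i))
    (φ j '' (univ ×ˢ closedRange (a j) j))
  /-- The complement of the ends is compact. -/
  isCompact_core : IsCompact (⋃ i, φ i '' (univ ×ˢ openRange (a i) i))ᶜ
  /-- The convergence rates. -/
  ν : Fin s ⊕ Fin l → ℝ
  ν_pos : ∀ i, 0 < ν (Sum.inl i)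
  ν_neg : ∀ i, ν (Sum.inr i) < 0
  /-- `|∇̃^k (φᵢ^* g - g̃ᵢ)| = O(r^(νᵢ - k))` along the end, for the conical metric `g̃ᵢ`. -/
  asymptotic : ∀ i (k : ℕ), ∃ C : ℝ, ∀ᶠ r in endFilter i, ∀ θ : Λ i,
    CovDerivBound (coneModel (m - 1)) (coneMetric (g' i).inner)
      (bilinTensor (coneModel (m - 1))
        fun q => pullMetric (φ i) g.inner q - coneMetric (g' i).inner q)
      k (θ, r) (C * r ^ (ν i - k))

namespace CSACManifold

variable {m s l : ℕ}
  {L : Type*} [TopologicalSpace L] [ChartedSpace (Model m) L] [IsManifold (𝓡 m) ∞ L]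
  {Λ : Fin s ⊕ Fin l → Type*} [∀ i, TopologicalSpace (Λ i)]
  [∀ i, ChartedSpace (Model (m - 1)) (Λ i)] [∀ i, IsManifold (𝓡 (m - 1)) ∞ (Λ i)]
  (X : CSACManifold m s l L Λ)

/-- The end `Sᵢ`. -/
def endSet (i : Fin s ⊕ Fin l) : Set L := X.φ i '' (univ ×ˢ openRange (X.a i) i)

/-- `|∇^k T|_g = O(r^(βᵢ - k))` along each end, for every `k`. -/
def IsWeighted (β : Fin s ⊕ Fin l → ℝ) {n : ℕ}
    (T : (x : L) → (Fin n → TangentSpace (𝓡 m) x) → ℝ) : Prop :=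
  ∀ i (k : ℕ), ∃ C : ℝ, ∀ᶠ r in endFilter i, ∀ θ : Λ i,
    CovDerivBound (𝓡 m) X.g.inner T k (X.φ i (θ, r)) (C * r ^ (β i - k))

/-- The weighted space `C^∞_β(L)` of smooth functions. -/
def weightedFun (β : Fin s ⊕ Fin l → ℝ) : Set (SmoothFun (𝓡 m) L) :=
  {f | X.IsWeighted β (funTensor (𝓡 m) f)}

/-- The closed 1-forms in the weighted space `C^∞_β(Λ¹)`. -/
def weightedClosedForms (β : Fin s ⊕ Fin l → ℝ) : Set (OneField (𝓡 m) L) :=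
  {α | α ∈ closedForms (𝓡 m) L ∧ X.IsWeighted β (formTensor (𝓡 m) α)}

/-- The filter on `L` of the neighbourhoods of all the singularities. -/
def singFilter : Filter L :=
  ⨆ i : Fin s, map (X.φ (Sum.inl i)) ((⊤ : Filter (Λ (Sum.inl i))) ×ˢ 𝓝[>] (0 : ℝ))

/-- On the AC end with index `i`, the form `α` is the pull-back of a form on the link. -/
def IsTranslationInvariant (α : OneField (𝓡 m) L) (i : Fin l) : Prop :=
  ∃ η : OneField (𝓡 (m - 1)) (Λ (Sum.inr i)), ∀ θ, ∀ r ∈ Ioi (X.a (Sum.inr i)),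
    (α (X.φ (Sum.inr i) (θ, r))).comp
        (mfderiv (coneModel (m - 1)) (𝓡 m) (X.φ (Sum.inr i)) (θ, r)) =
      (η θ).comp (mfderiv (coneModel (m - 1)) (𝓡 (m - 1)) Prod.fst (θ, r))

/-- `V` is a finite-dimensional space of compactly supported closed 1-forms that is mapped
isomorphically onto the image of `H¹_c(L; ℝ) → H¹(L; ℝ)`. -/
structure IsRepCompact (V : Submodule ℝ (closedForms (𝓡 m) L)) : Prop where
  finite : FiniteDimensional ℝ V
  support : V ≤ closedFormsV (𝓡 m) L (cocompact L)
  bijOn : BijOn (exactForms (𝓡 m) L).mkQ V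
    (LinearMap.range (gammaMap (𝓡 m) L (cocompact L)))

/-- `V` is a finite-dimensional space of closed 1-forms that vanish near the singularities and are
translation-invariant on the AC ends; it is mapped isomorphically onto the image of
`H¹_{c,•}(L; ℝ) → H¹(L; ℝ)`. -/
structure IsRepSing (V : Submodule ℝ (closedForms (𝓡 m) L)) : Prop where
  finite : FiniteDimensional ℝ V
  support : V ≤ closedFormsV (𝓡 m) L X.singFilter
  invariant : ∀ α ∈ V, ∀ i, X.IsTranslationInvariant (α : OneField (𝓡 m) L) i
  bijOn : BijOn (exactForms (𝓡 m) L).mkQ V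
    (LinearMap.range (gammaMap (𝓡 m) L X.singFilter))

/-- `f ≡ 1` on the end with index `i`, and `f ≡ 0` on all other ends. -/
def IsEndFunction (i : Fin s ⊕ Fin l) (f : SmoothFun (𝓡 m) L) : Prop :=
  (∀ x ∈ X.endSet i, f x = 1) ∧ ∀ j ≠ i, ∀ x ∈ X.endSet j, f x = 0

end CSACManifold

/-- `Z = A ⊕ B`: sums of elements of `A` and `B` lie in `Z`, and every element of `Z` is such a
sum in exactly one way. -/
def IsDirectSum₂ {V : Type*} [AddCommGroup V] (Z A B : Set V) : Prop :=
  (∀ a ∈ A, ∀ b ∈ B, a + b ∈ Z) ∧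
    ∀ z ∈ Z, ∃! t : V × V, t.1 ∈ A ∧ t.2 ∈ B ∧ t.1 + t.2 = z

/-- `Z = A ⊕ B ⊕ C`. -/
def IsDirectSum₃ {V : Type*} [AddCommGroup V] (Z A B C : Set V) : Prop :=
  (∀ a ∈ A, ∀ b ∈ B, ∀ c ∈ C, a + b + c ∈ Z) ∧
    ∀ z ∈ Z, ∃! t : V × V × V, t.1 ∈ A ∧ t.2.1 ∈ B ∧ t.2.2 ∈ C ∧ t.1 + t.2.1 + t.2.2 = z

end CSAC

end

/-!
The weights enter through primitives on the ends. Let `α` be a closed 1-form on an end with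
`|α| = O(r^(β-1))`. If `r^β → 0` along the end, then a local primitive of `α` has a limit along each
ray, and differs from this limit by `O(r^β)`, by integration along the ray
(`IsEndBound.exists_tendsto`). Since tangent vectors of the link have length of order `r`, the
primitive varies by `O(r^β)` on a slice, so that the limit is locally constant
(`IsEndBound.eventually_eq_limit`). Subtracting the limits gives a primitive on the whole end which
is `O(r^β)` (`IsEndBound.exists_isPrim`). On an AC end with `β > 0`, every primitive is `O(r^β)`
(`IsEndBound.exists_abs_le`). As `∇^(k+1) f = ∇^k df`, a function is in `C^∞_β` exactly if it is
`O(r^β)` and its differential is in `C^∞_{β-1}` (`mem_weightedFun_iff`).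

For the decomposition, let `α` be a closed 1-form in `C^∞_{β-1}`. On the ends along which `r^β → 0`
it is the differential of a function, which is cut off and subtracted (`exists_d_eq_on_ends`). The
difference is supported in a compact set, respectively vanishes near the singularities, so that its
class has a representative `α'` in the given space, and `α - α' = dG` for a function `G`
(`exists_mem_d_eq_sub`). The form `dG` is again in `C^∞_{β-1}`, so `G` is asymptotic to a constant
`cᵢ` on each end along which `r^β → 0`, and `G - ∑ cᵢ fᵢ` is in `C^∞_β` (`exists_eq_sum_smul_add`).
For uniqueness, the component `α'` is determined by the cohomology class. The manifold being
connected, the functions are then determined up to a constant, and so are the numbers `cᵢ`, as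
limits on the ends (`eq_const_of_sum_smul_add`). If `r^β → 0` on all ends, the constant does not
matter because `d (∑ fᵢ) = d 1 = 0`.

This requires that a translation-invariant form is in `C^∞_{β-1}` on the AC ends if `β > 0`: its
`k`-th covariant derivative is `O(r^(-1-k))`. In the coordinates `(x, ρ) ↦ φ(x, tρ)` such a
form does not depend on `t`. In these coordinates the components of `t⁻² g` are bounded as `t → ∞`,
with all derivatives, because `g` is asymptotically conical and the conical metric is homogeneous
(`bddDeriv_scaleEnd`), and `t⁻² g` has the same Levi-Civita connection as `g`. This bounds the
covariant derivatives of the form in these coordinates, and scaling back produces the powers of `t`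
(`IsTranslationInvariant.exists_nhds_covDerivBound`).

The spaces of representatives exist because `H¹` is finite-dimensional: up to exact forms, a closed
form is determined by the jumps between its local primitives on finitely many coordinate balls that
cover the complement of the ends (`finiteDimensional_H1`), as a closed form that is exact there is
exact on the whole manifold, by radial integration along the ends (`exists_isPrim_univ_of_core`).
Subtracting the differential of the radial integral also makes a closed form translation-invariant
on the AC ends (`exists_isRepSing`).

All computations with covariant derivatives are done in coordinates, for tensor fields as functions
of a point and a family of vectors; they are independent of the chart because covariant
differentiation commutes with pull-backs under local diffeomorphisms (`iterCovDeriv_pullTensor`).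
-/

set_option linter.unusedSectionVars false

noncomputable section

namespace CSAC

/-! ### Tensor fields in coordinates -/

section TensorCalculus

variable {E F : Type*} [NormedAddCommGroup E] [NormedSpace ℝ E]
  [NormedAddCommGroup F] [NormedSpace ℝ F]

/-- A shortcut for instance resolution. -/
instance normedAddCommGroupBilin : NormedAddCommGroup (E →L[ℝ] F →L[ℝ] ℝ) :=
  ContinuousLinearMap.toNormedAddCommGroup

/-- A shortcut for instance resolution. -/
instance normedSpaceBilin : NormedSpace ℝ (E →L[ℝ] F →L[ℝ] ℝ) :=
  ContinuousLinearMap.toNormedSpace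

/-- `T` is a smooth covariant `n`-tensor field on the set `Ω`: it is multilinear at every point of
`Ω`, and its values on constant vectors are smooth functions. -/
structure IsTensorOn (Ω : Set E) {n : ℕ} (T : E → (Fin n → E) → ℝ) : Prop where
  smooth : ∀ v, ContDiffOn ℝ ∞ (fun y => T y v) Ω
  map_update_add : ∀ y ∈ Ω, ∀ v i a b,
    T y (Function.update v i (a + b)) = T y (Function.update v i a) + T y (Function.update v i b)
  map_update_smul : ∀ y ∈ Ω, ∀ v i (c : ℝ) a,
    T y (Function.update v i (c • a)) = c * T y (Function.update v i a)

namespace IsTensorOn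

variable {Ω : Set E} {n : ℕ} {T S : E → (Fin n → E) → ℝ}

/-- The value of a tensor field at a point, as a multilinear map. -/
def toMultilinear (hT : IsTensorOn Ω T) {y : E} (hy : y ∈ Ω) :
    MultilinearMap ℝ (fun _ : Fin n => E) ℝ where
  toFun := T y
  map_update_add' v i a b := by convert! hT.map_update_add y hy v i a b
  map_update_smul' v i c a := by convert! hT.map_update_smul y hy v i c a

theorem congr (hT : IsTensorOn Ω T) (h : ∀ y ∈ Ω, S y = T y) : IsTensorOn Ω S :=
  ⟨fun v => (hT.smooth v).congr fun y hy => by rw [h y hy],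
    fun y hy => by rw [h y hy]; exact hT.map_update_add y hy,
    fun y hy => by rw [h y hy]; exact hT.map_update_smul y hy⟩

/-- The value on a family of vectors, in terms of the values on the vectors of a basis. -/
theorem apply_eq_sum (hT : IsTensorOn Ω T) {ι : Type*} [Fintype ι]
    (b : Module.Basis ι ℝ E) {y : E} (hy : y ∈ Ω) (w : Fin n → E) :
    T y w = ∑ a : Fin n → ι, (∏ i, b.repr (w i) (a i)) * T y (fun i => b (a i)) := by
  classical
  have h1 : w = fun i => ∑ j, b.repr (w i) j • b j := by
    funext i; exact (b.sum_repr (w i)).symm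
  have h2 := (hT.toMultilinear hy).map_sum (fun i j => b.repr (w i) j • b j)
  rw [← h1] at h2
  refine h2.trans (Finset.sum_congr rfl fun a _ => ?_)
  exact (hT.toMultilinear hy).map_smul_univ _ _

theorem contDiffOn_comp [FiniteDimensional ℝ E] (hT : IsTensorOn Ω T) {Ω' : Set F} {ψ : F → E}
    {W : F → Fin n → E} (hψ : ContDiffOn ℝ ∞ ψ Ω') (h : MapsTo ψ Ω' Ω)
    (hW : ∀ i, ContDiffOn ℝ ∞ (fun x => W x i) Ω') :
    ContDiffOn ℝ ∞ (fun x => T (ψ x) (W x)) Ω' := by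
  let b := Module.finBasis ℝ E
  have : ∀ x ∈ Ω', T (ψ x) (W x) = ∑ a : Fin n → Fin (Module.finrank ℝ E),
      (∏ i, b.repr (W x i) (a i)) * T (ψ x) (fun i => b (a i)) :=
    fun x hx => hT.apply_eq_sum b (h hx) _
  refine ContDiffOn.congr ?_ this
  refine ContDiffOn.sum fun a _ => ContDiffOn.mul ?_ ((hT.smooth _).comp hψ h)
  refine contDiffOn_prod fun i _ => ?_
  exact ((b.coord (a i)).toContinuousLinearMap.contDiff (n := ∞)).comp_contDiffOn (hW i)

/-- The product rule, for the evaluation of a tensor field along a map on vectors that depend on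
the point. -/
theorem hasFDerivAt_comp_apply [FiniteDimensional ℝ E] (hΩ : IsOpen Ω) (hT : IsTensorOn Ω T)
    {ψ : F → E} {W : F → Fin n → E} {x : F} (hx : ψ x ∈ Ω) (hψ : DifferentiableAt ℝ ψ x)
    (hW : ∀ i, DifferentiableAt ℝ (fun x => W x i) x) (u : F) :
    fderiv ℝ (fun x => T (ψ x) (W x)) x u =
      fderiv ℝ (fun z => T z (W x)) (ψ x) (fderiv ℝ ψ x u) +
        ∑ i, T (ψ x) (Function.update (W x) i (fderiv ℝ (fun x => W x i) x u)) := by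
  -- the evaluation `f (y, w) = T y w` is smooth in both variables together
  let f : E × (Fin n → E) → ℝ := fun q => T q.1 q.2
  have hf : DifferentiableAt ℝ f (ψ x, W x) := by
    have h1 : ContDiffOn ℝ ∞ f (Ω ×ˢ univ) :=
      hT.contDiffOn_comp (ψ := Prod.fst) (W := Prod.snd) contDiffOn_fst (fun q hq => hq.1)
        (fun i => (contDiff_apply ℝ E i).comp_contDiffOn contDiffOn_snd)
    exact (h1.contDiffAt ((hΩ.prod isOpen_univ).mem_nhds ⟨hx, mem_univ _⟩)).differentiableAt
      (by simp)
  have hW' : DifferentiableAt ℝ W x := differentiableAt_pi.2 hW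
  have h1 : fderiv ℝ (fun x => T (ψ x) (W x)) x u =
      fderiv ℝ f (ψ x, W x) (fderiv ℝ ψ x u, fderiv ℝ W x u) := by
    have h := hf.hasFDerivAt.comp x (hψ.hasFDerivAt.prodMk hW'.hasFDerivAt)
    exact congrArg (· u) h.fderiv
  have h2 : fderiv ℝ (fun z => T z (W x)) (ψ x) (fderiv ℝ ψ x u) =
      fderiv ℝ f (ψ x, W x) (fderiv ℝ ψ x u, 0) := by
    have h := HasFDerivAt.comp (f := fun z => (z, W x)) (ψ x) hf.hasFDerivAt
      ((hasFDerivAt_id (𝕜 := ℝ) (ψ x)).prodMk (hasFDerivAt_const (W x) (ψ x)))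
    exact congrArg (· (fderiv ℝ ψ x u)) h.fderiv
  have h3 : ∀ (i : Fin n) (c : E),
      fderiv ℝ f (ψ x, W x) (0, Pi.single i c) = T (ψ x) (Function.update (W x) i c) := by
    intro i c
    have hl : HasDerivAt
        (fun t : ℝ => ((ψ x, W x + t • (Pi.single i c : Fin n → E)) : E × (Fin n → E)))
        (0, Pi.single i c) 0 := by
      refine (hasDerivAt_const 0 (ψ x)).prodMk ?_
      simpa using ((hasDerivAt_id (0 : ℝ)).smul_const (Pi.single i c : Fin n → E)).const_add (W x)
    have hl' : HasFDerivAt f (fderiv ℝ f (ψ x, W x))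
        (ψ x, W x + (0 : ℝ) • (Pi.single i c : Fin n → E)) := by
      simpa using hf.hasFDerivAt
    have h := hl'.comp_hasDerivAt (0 : ℝ) hl
    have h' : HasDerivAt (fun t : ℝ => T (ψ x) (W x) + t * T (ψ x) (Function.update (W x) i c))
        (T (ψ x) (Function.update (W x) i c)) 0 := by
      simpa using ((hasDerivAt_id (0 : ℝ)).mul_const
        (T (ψ x) (Function.update (W x) i c))).const_add (T (ψ x) (W x))
    refine h.unique (h'.congr_of_eventuallyEq (Eventually.of_forall fun t => ?_))
    have : W x + t • (Pi.single i c : Fin n → E) = Function.update (W x) i (W x i + t • c) := by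
      funext j
      by_cases hj : j = i
      · subst hj; simp
      · simp [hj]
    change T (ψ x) (W x + t • (Pi.single i c : Fin n → E)) = _
    rw [this, hT.map_update_add _ hx, hT.map_update_smul _ hx, Function.update_eq_self]
  have h4 : (fderiv ℝ ψ x u, fderiv ℝ W x u) = (fderiv ℝ ψ x u, (0 : Fin n → E)) +
      ∑ i, ((0 : E), (Pi.single i (fderiv ℝ W x u i) : Fin n → E)) := by
    refine Prod.ext (by simp [Prod.fst_sum]) ?_
    simp only [Prod.snd_add, Prod.snd_sum, zero_add]
    exact (Finset.univ_sum_single (fderiv ℝ W x u)).symm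
  rw [h1, h2, h4, map_add, map_sum]
  congr 1
  refine Finset.sum_congr rfl fun i _ => ?_
  rw [h3]
  congr 2
  exact congrArg (· u) (by rw [fderiv_pi hW]; rfl :
    (ContinuousLinearMap.proj i).comp (fderiv ℝ W x) = fderiv ℝ (fun x => W x i) x)

end IsTensorOn

/-! ### Christoffel maps and covariant derivatives -/

/-- `G` is a smooth field of symmetric nondegenerate bilinear forms on the set `Ω`. -/
structure IsMetricOn (Ω : Set E) (G : E → E →L[ℝ] E →L[ℝ] ℝ) : Prop where
  smooth : ContDiffOn ℝ ∞ G Ω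
  symm : ∀ y ∈ Ω, ∀ u v, G y u v = G y v u
  inv : ∀ y ∈ Ω, (G y).IsInvertible

theorem IsMetricOn.mono {Ω Ω' : Set E} {G : E → E →L[ℝ] E →L[ℝ] ℝ} (hG : IsMetricOn Ω G)
    (h : Ω' ⊆ Ω) : IsMetricOn Ω' G :=
  ⟨hG.smooth.mono h, fun y hy => hG.symm y (h hy), fun y hy => hG.inv y (h hy)⟩

theorem christoffel_add_right (G : E → E →L[ℝ] E →L[ℝ] ℝ) (y u v w : E) :
    christoffel G y u (v + w) = christoffel G y u v + christoffel G y u w := by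
  simp only [christoffel, ← map_add, ← smul_add]
  congr 2
  ext z
  simp
  ring

theorem christoffel_smul_right (G : E → E →L[ℝ] E →L[ℝ] ℝ) (y u v : E) (c : ℝ) :
    christoffel G y u (c • v) = c • christoffel G y u v := by
  simp only [christoffel, ← map_smul]
  congr 1
  ext z
  simp
  ring

theorem christoffel_add_left (G : E → E →L[ℝ] E →L[ℝ] ℝ) (y u v w : E) :
    christoffel G y (u + v) w = christoffel G y u w + christoffel G y v w := by
  simp only [christoffel, ← map_add, ← smul_add]
  congr 2
  ext z
  simp
  ring

theorem christoffel_smul_left (G : E → E →L[ℝ] E →L[ℝ] ℝ) (y u v : E) (c : ℝ) :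
    christoffel G y (c • u) v = c • christoffel G y u v := by
  simp only [christoffel, ← map_smul]
  congr 1
  ext z
  simp
  ring

theorem apply_christoffel {G : E → E →L[ℝ] E →L[ℝ] ℝ} {y : E} (h : (G y).IsInvertible)
    (u v w : E) : G y (christoffel G y u v) w =
      (1 / 2) * (fderiv ℝ G y u v w + fderiv ℝ G y v u w - fderiv ℝ G y w u v) := by
  rw [christoffel, h.self_apply_inverse]
  simp

theorem fderiv_bilin_apply {G : E → E →L[ℝ] E →L[ℝ] ℝ} {y : E} (hG : DifferentiableAt ℝ G y)
    (u v w : E) : fderiv ℝ G y u v w = fderiv ℝ (fun z => G z v w) y u := by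
  rw [((hG.hasFDerivAt.clm_apply (hasFDerivAt_const v y)).clm_apply
    (hasFDerivAt_const w y)).fderiv]
  simp

theorem IsMetricOn.contDiffOn_christoffel [FiniteDimensional ℝ E] {Ω : Set E} (hΩ : IsOpen Ω)
    {G : E → E →L[ℝ] E →L[ℝ] ℝ} (hG : IsMetricOn Ω G) (u v : E) :
    ContDiffOn ℝ ∞ (fun y => christoffel G y u v) Ω := by
  have : CompleteSpace E := FiniteDimensional.complete ℝ E
  have h1 : ∀ a b c, ContDiffOn ℝ ∞ (fun y => fderiv ℝ G y a b c) Ω := by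
    intro a b c
    have h : ContDiffOn ℝ ∞ (fun y => fderiv ℝ (fun z => G z b c) y a) Ω :=
      (((hG.smooth.clm_apply contDiffOn_const).clm_apply contDiffOn_const).fderiv_of_isOpen hΩ
        (by simp)).clm_apply contDiffOn_const
    exact h.congr fun y hy => fderiv_bilin_apply
      ((hG.smooth.contDiffAt (hΩ.mem_nhds hy)).differentiableAt (by simp)) a b c
  have h2 : ContDiffOn ℝ ∞ (fun y => (G y).inverse) Ω := by
    intro y hy
    exact (ContDiffAt.comp y (hG.inv y hy).contDiffAt_map_inverse
      (hG.smooth.contDiffAt (hΩ.mem_nhds hy))).contDiffWithinAt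
  refine h2.clm_apply (ContDiffOn.const_smul _ (contDiffOn_clm_apply.2 fun w => ?_))
  exact ((h1 u v w).add (h1 v u w)).sub (h1 w u v)

theorem IsTensorOn.covDeriv [FiniteDimensional ℝ E] {Ω : Set E} (hΩ : IsOpen Ω)
    {G : E → E →L[ℝ] E →L[ℝ] ℝ} (hG : IsMetricOn Ω G) {n : ℕ} {T : E → (Fin n → E) → ℝ}
    (hT : IsTensorOn Ω T) : IsTensorOn Ω (covDeriv G T) := by
  have hd : ∀ v, ∀ y ∈ Ω, DifferentiableAt ℝ (fun z => T z v) y := fun v y hy =>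
    ((hT.smooth v).contDiffAt (hΩ.mem_nhds hy)).differentiableAt (by simp)
  have htail : ∀ (v : Fin (n + 1) → E) (i : Fin n) (a : E),
      Fin.tail (Function.update v i.succ a) = Function.update (Fin.tail v) i a := fun v i a =>
    Fin.tail_update_succ v i a
  refine ⟨fun v => ?_, ?_, ?_⟩
  · refine ContDiffOn.sub ?_ (ContDiffOn.sum fun i _ => ?_)
    · exact ((hT.smooth _).fderiv_of_isOpen hΩ (by simp)).clm_apply contDiffOn_const
    · refine hT.contDiffOn_comp contDiffOn_id (fun y hy => hy) fun j => ?_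
      by_cases hj : j = i
      · subst hj
        simpa using hG.contDiffOn_christoffel hΩ (v 0) (Fin.tail v j)
      · simpa [hj] using contDiffOn_const
  · intro y hy v i a b
    simp only [CSAC.covDeriv]
    refine Fin.cases ?_ (fun i => ?_) i
    · simp only [Fin.tail_update_zero, Function.update_self, map_add, christoffel_add_left,
        hT.map_update_add y hy, Finset.sum_add_distrib]
      ring
    · simp only [htail]
      have h0 : ∀ a, Function.update v i.succ a 0 = v 0 := fun a =>
        Function.update_of_ne (Fin.succ_ne_zero i).symm _ _
      simp only [h0]
      have h1 : fderiv ℝ (fun z => T z (Function.update (Fin.tail v) i (a + b))) y =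
          fderiv ℝ (fun z => T z (Function.update (Fin.tail v) i a)) y +
          fderiv ℝ (fun z => T z (Function.update (Fin.tail v) i b)) y := by
        rw [← fderiv_add (hd _ y hy) (hd _ y hy)]
        refine Filter.EventuallyEq.fderiv_eq ?_
        filter_upwards [hΩ.mem_nhds hy] with z hz using hT.map_update_add z hz _ _ _ _
      rw [h1]
      have h2 : ∀ j : Fin n, T y (Function.update (Function.update (Fin.tail v) i (a + b)) j
            (christoffel G y (v 0) (Function.update (Fin.tail v) i (a + b) j))) =
          T y (Function.update (Function.update (Fin.tail v) i a) j
            (christoffel G y (v 0) (Function.update (Fin.tail v) i a j))) +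
          T y (Function.update (Function.update (Fin.tail v) i b) j
            (christoffel G y (v 0) (Function.update (Fin.tail v) i b j))) := by
        intro j
        by_cases hj : j = i
        · subst hj
          simp only [Function.update_idem, Function.update_self, christoffel_add_right,
            hT.map_update_add y hy]
        · simp only [Function.update_of_ne hj]
          simp only [Function.update_comm (Ne.symm hj), hT.map_update_add y hy]
      simp only [h2, Finset.sum_add_distrib, add_apply]
      ring
  · intro y hy v i c a
    simp only [CSAC.covDeriv]
    refine Fin.cases ?_ (fun i => ?_) i
    · simp only [Fin.tail_update_zero, Function.update_self, map_smul, christoffel_smul_left,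
        hT.map_update_smul y hy, ← Finset.mul_sum, smul_eq_mul]
      ring
    · simp only [htail]
      have h0 : ∀ a, Function.update v i.succ a 0 = v 0 := fun a =>
        Function.update_of_ne (Fin.succ_ne_zero i).symm _ _
      simp only [h0]
      have h1 : fderiv ℝ (fun z => T z (Function.update (Fin.tail v) i (c • a))) y =
          c • fderiv ℝ (fun z => T z (Function.update (Fin.tail v) i a)) y := by
        rw [← fderiv_const_smul (hd _ y hy)]
        refine Filter.EventuallyEq.fderiv_eq ?_
        filter_upwards [hΩ.mem_nhds hy] with z hz using hT.map_update_smul z hz _ _ _ _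
      rw [h1]
      have h2 : ∀ j : Fin n, T y (Function.update (Function.update (Fin.tail v) i (c • a)) j
            (christoffel G y (v 0) (Function.update (Fin.tail v) i (c • a) j))) =
          c * T y (Function.update (Function.update (Fin.tail v) i a) j
            (christoffel G y (v 0) (Function.update (Fin.tail v) i a j))) := by
        intro j
        by_cases hj : j = i
        · subst hj
          simp only [Function.update_idem, Function.update_self, christoffel_smul_right,
            hT.map_update_smul y hy]
        · simp only [Function.update_of_ne hj]
          simp only [Function.update_comm (Ne.symm hj), hT.map_update_smul y hy]
      simp only [h2, ← Finset.mul_sum, smul_apply, smul_eq_mul]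
      ring

theorem IsTensorOn.iterCovDeriv [FiniteDimensional ℝ E] {Ω : Set E} (hΩ : IsOpen Ω)
    {G : E → E →L[ℝ] E →L[ℝ] ℝ} (hG : IsMetricOn Ω G) {n : ℕ} {T : E → (Fin n → E) → ℝ}
    (hT : IsTensorOn Ω T) : ∀ k, IsTensorOn Ω (iterCovDeriv G T k)
  | 0 => hT
  | k + 1 => (IsTensorOn.iterCovDeriv hΩ hG hT k).covDeriv hΩ hG

theorem christoffel_congr {Ω : Set E} (hΩ : IsOpen Ω) {G G' : E → E →L[ℝ] E →L[ℝ] ℝ}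
    (h : ∀ y ∈ Ω, G y = G' y) {y : E} (hy : y ∈ Ω) (u v : E) :
    christoffel G y u v = christoffel G' y u v := by
  have : fderiv ℝ G y = fderiv ℝ G' y :=
    Filter.EventuallyEq.fderiv_eq (by filter_upwards [hΩ.mem_nhds hy] with z hz using h z hz)
  simp only [christoffel, this, h y hy]

theorem covDeriv_congr {Ω : Set E} (hΩ : IsOpen Ω) {G G' : E → E →L[ℝ] E →L[ℝ] ℝ}
    (h : ∀ y ∈ Ω, G y = G' y) {n : ℕ} {T T' : E → (Fin n → E) → ℝ} (h' : ∀ y ∈ Ω, T y = T' y) :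
    ∀ y ∈ Ω, covDeriv G T y = covDeriv G' T' y := by
  intro y hy
  funext v
  have : fderiv ℝ (fun z => T z (Fin.tail v)) y = fderiv ℝ (fun z => T' z (Fin.tail v)) y :=
    Filter.EventuallyEq.fderiv_eq (by
      filter_upwards [hΩ.mem_nhds hy] with z hz using by rw [h' z hz])
  simp only [covDeriv, this, h' y hy, christoffel_congr hΩ h hy]

/-- The iterated covariant derivative on an open set depends on the metric and on the tensor field
on this set only. -/
theorem iterCovDeriv_congr {Ω : Set E} (hΩ : IsOpen Ω) {G G' : E → E →L[ℝ] E →L[ℝ] ℝ}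
    (h : ∀ y ∈ Ω, G y = G' y) {n : ℕ} {T T' : E → (Fin n → E) → ℝ} (h' : ∀ y ∈ Ω, T y = T' y) :
    ∀ k, ∀ y ∈ Ω, iterCovDeriv G T k y = iterCovDeriv G' T' k y
  | 0 => h'
  | k + 1 => covDeriv_congr hΩ h (iterCovDeriv_congr hΩ h h' k)

theorem covDeriv_cast (G : E → E →L[ℝ] E →L[ℝ] ℝ) {n n' : ℕ} (h : n = n')
    (T : E → (Fin n → E) → ℝ) (y : E) (v : Fin (n' + 1) → E) :
    covDeriv G (fun y (v : Fin n' → E) => T y (v ∘ Fin.cast h)) y v =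
      covDeriv G T y (v ∘ Fin.cast (congrArg (· + 1) h)) := by
  subst h
  rfl

theorem iterCovDeriv_succ_eq (G : E → E →L[ℝ] E →L[ℝ] ℝ) {n : ℕ} (T : E → (Fin n → E) → ℝ) :
    ∀ (k : ℕ) (y : E) (v : Fin (n + (k + 1)) → E), iterCovDeriv G T (k + 1) y v =
      iterCovDeriv G (covDeriv G T) k y (v ∘ Fin.cast (by omega))
  | 0, _, _ => rfl
  | k + 1, y, v => by
    have h : iterCovDeriv G T (k + 1) = fun y (v : Fin (n + (k + 1)) → E) =>
        iterCovDeriv G (covDeriv G T) k y (v ∘ Fin.cast (by omega)) := by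
      funext y v; exact iterCovDeriv_succ_eq G T k y v
    change covDeriv G (iterCovDeriv G T (k + 1)) y v = _
    rw [h, covDeriv_cast]
    rfl

theorem covDeriv_add {Ω : Set E} (hΩ : IsOpen Ω) {G : E → E →L[ℝ] E →L[ℝ] ℝ} {n : ℕ}
    {T S : E → (Fin n → E) → ℝ} (hT : IsTensorOn Ω T) (hS : IsTensorOn Ω S) {y : E} (hy : y ∈ Ω)
    (v : Fin (n + 1) → E) :
    covDeriv G (fun y v => T y v + S y v) y v = covDeriv G T y v + covDeriv G S y v := by
  have h := fderiv_fun_add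
    (((hT.smooth (Fin.tail v)).contDiffAt (hΩ.mem_nhds hy)).differentiableAt (by simp))
    (((hS.smooth (Fin.tail v)).contDiffAt (hΩ.mem_nhds hy)).differentiableAt (by simp))
  simp only [covDeriv, h, Finset.sum_add_distrib, add_apply]
  ring

theorem iterCovDeriv_add [FiniteDimensional ℝ E] {Ω : Set E} (hΩ : IsOpen Ω)
    {G : E → E →L[ℝ] E →L[ℝ] ℝ} (hG : IsMetricOn Ω G) {n : ℕ}
    {T S : E → (Fin n → E) → ℝ} (hT : IsTensorOn Ω T) (hS : IsTensorOn Ω S) :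
    ∀ k, ∀ y ∈ Ω, ∀ v, iterCovDeriv G (fun y v => T y v + S y v) k y v =
      iterCovDeriv G T k y v + iterCovDeriv G S k y v
  | 0, _, _, _ => rfl
  | k + 1, y, hy, v => by
    rw [iterCovDeriv, covDeriv_congr hΩ (G' := G) (fun _ _ => rfl) (fun z hz => funext fun v =>
      iterCovDeriv_add hΩ hG hT hS k z hz v) y hy]
    exact covDeriv_add hΩ (hT.iterCovDeriv hΩ hG k) (hS.iterCovDeriv hΩ hG k) hy v

/-! ### Behaviour under changes of coordinates -/

section Naturality

variable {Ω' : Set F} {Ω : Set E} {ψ : F → E}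
  {G : E → E →L[ℝ] E →L[ℝ] ℝ}

/-- The pull-back of a covariant tensor field. -/
def pullTensor (ψ : F → E) {n : ℕ} (T : E → (Fin n → E) → ℝ) : F → (Fin n → F) → ℝ :=
  fun y v => T (ψ y) (fun i => fderiv ℝ ψ y (v i))

variable [FiniteDimensional ℝ F]

theorem IsMetricOn.pullBilin (hG : IsMetricOn Ω G) (hΩ' : IsOpen Ω') (hψ : ContDiffOn ℝ ∞ ψ Ω')
    (hm : MapsTo ψ Ω' Ω) (hinv : ∀ y ∈ Ω', (fderiv ℝ ψ y).IsInvertible) :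
    IsMetricOn Ω' (fun y => CSAC.pullBilin (G (ψ y)) (fderiv ℝ ψ y)) := by
  have h1 := hψ.fderiv_of_isOpen hΩ' (m := ∞) (by simp)
  refine ⟨?_, fun y hy u v => hG.symm _ (hm hy) _ _, fun y hy => ?_⟩
  · refine contDiffOn_clm_apply.2 fun u => contDiffOn_clm_apply.2 fun v => ?_
    exact ((hG.smooth.comp hψ hm).clm_apply (h1.clm_apply contDiffOn_const)).clm_apply
      (h1.clm_apply contDiffOn_const)
  · obtain ⟨A, hA⟩ := hinv y hy
    obtain ⟨B, hB⟩ := hG.inv _ (hm hy)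
    refine ⟨(A.trans B).trans (A.symm.arrowCongr (ContinuousLinearEquiv.refl ℝ ℝ)), ?_⟩
    ext u v
    simp [CSAC.pullBilin, ← hA, ← hB]

/-- The transformation law of the Christoffel maps. -/
theorem fderiv_christoffel_pullBilin (hΩ' : IsOpen Ω') (hΩ : IsOpen Ω) (hG : IsMetricOn Ω G)
    (hψ : ContDiffOn ℝ ∞ ψ Ω') (hm : MapsTo ψ Ω' Ω)
    (hinv : ∀ y ∈ Ω', (fderiv ℝ ψ y).IsInvertible)
    {y : F} (hy : y ∈ Ω') (u v : F) :
    fderiv ℝ ψ y (christoffel (fun y => pullBilin (G (ψ y)) (fderiv ℝ ψ y)) y u v) =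
      christoffel G (ψ y) (fderiv ℝ ψ y u) (fderiv ℝ ψ y v) + fderiv ℝ (fderiv ℝ ψ) y u v := by
  set G' : F → F →L[ℝ] F →L[ℝ] ℝ := fun y => pullBilin (G (ψ y)) (fderiv ℝ ψ y) with hG'
  have hmet := hG.pullBilin hΩ' hψ hm hinv
  have hsec : ∀ a b, fderiv ℝ (fderiv ℝ ψ) y a b = fderiv ℝ (fderiv ℝ ψ) y b a := by
    have h := (hψ.contDiffAt (hΩ'.mem_nhds hy)).isSymmSndFDerivAt
      (by simpa using! (mod_cast le_top : ((2 : ℕ∞) : WithTop ℕ∞) ≤ ∞))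
    exact fun a b => h.eq a b
  have hψd : DifferentiableAt ℝ ψ y := (hψ.contDiffAt (hΩ'.mem_nhds hy)).differentiableAt (by simp)
  have hψ2 : DifferentiableAt ℝ (fderiv ℝ ψ) y :=
    ((hψ.fderiv_of_isOpen hΩ' (m := ∞) (by simp)).contDiffAt (hΩ'.mem_nhds hy)).differentiableAt
      (by simp)
  have hGd : DifferentiableAt ℝ G (ψ y) :=
    (hG.smooth.contDiffAt (hΩ.mem_nhds (hm hy))).differentiableAt (by simp)
  have hG'd : DifferentiableAt ℝ G' y :=
    (hmet.smooth.contDiffAt (hΩ'.mem_nhds hy)).differentiableAt (by simp)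
  set A := fderiv ℝ ψ y with hA
  set D := fderiv ℝ (fderiv ℝ ψ) y with hD
  -- the derivative of the pulled back metric
  have hder : ∀ a b c, fderiv ℝ G' y a b c = fderiv ℝ G (ψ y) (A a) (A b) (A c) +
      G (ψ y) (D a b) (A c) + G (ψ y) (A b) (D a c) := by
    intro a b c
    have h1 := fderiv_bilin_apply hG'd a b c
    have h2 : HasFDerivAt (fun z => G (ψ z) (fderiv ℝ ψ z b) (fderiv ℝ ψ z c)) _ y :=
      ((hGd.hasFDerivAt.comp y hψd.hasFDerivAt).clm_apply
        (hψ2.hasFDerivAt.clm_apply (hasFDerivAt_const b y))).clm_apply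
        (hψ2.hasFDerivAt.clm_apply (hasFDerivAt_const c y))
    rw [h1]
    have h3 : (fun z => G' z b c) = (fun z => G (ψ z) (fderiv ℝ ψ z b) (fderiv ℝ ψ z c)) := rfl
    rw [h3, h2.fderiv]
    simp [← hA, ← hD]
    ring
  -- compare the two sides of the Koszul formula: the second derivatives that survive are `D u v`
  have key : ∀ w : F, G (ψ y) (A (christoffel G' y u v)) (A w) =
      G (ψ y) (christoffel G (ψ y) (A u) (A v) + D u v) (A w) := by
    intro w
    have h1 : G (ψ y) (A (christoffel G' y u v)) (A w) = G' y (christoffel G' y u v) w := rfl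
    rw [h1, apply_christoffel (hmet.inv y hy), map_add, add_apply,
      apply_christoffel (hG.inv _ (hm hy)), hder, hder, hder, hsec v u, hsec w u, hsec w v,
      hG.symm _ (hm hy) (A v) (D u w), hG.symm _ (hm hy) (A u) (D v w)]
    ring
  obtain ⟨A', hA'⟩ := hinv y hy
  refine (hG.inv _ (hm hy)).injective (ContinuousLinearMap.ext fun z => ?_)
  have := key (A'.symm z)
  have hz : A (A'.symm z) = z := by rw [hA, ← hA']; simp
  rwa [hz] at this

/-- The second derivatives of `ψ` that the product rule produces cancel those in the transformation
law of the Christoffel maps. -/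
theorem covDeriv_pullTensor [FiniteDimensional ℝ E] (hΩ' : IsOpen Ω')
    (hΩ : IsOpen Ω) (hG : IsMetricOn Ω G)
    (hψ : ContDiffOn ℝ ∞ ψ Ω') (hm : MapsTo ψ Ω' Ω)
    (hinv : ∀ y ∈ Ω', (fderiv ℝ ψ y).IsInvertible) {n : ℕ} {T : E → (Fin n → E) → ℝ}
    (hT : IsTensorOn Ω T) :
    ∀ y ∈ Ω', covDeriv (fun y => pullBilin (G (ψ y)) (fderiv ℝ ψ y)) (pullTensor ψ T) y =
      pullTensor ψ (covDeriv G T) y := by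
  intro y hy
  funext v
  have hψ2 : DifferentiableAt ℝ (fderiv ℝ ψ) y :=
    ((hψ.fderiv_of_isOpen hΩ' (m := ∞) (by simp)).contDiffAt (hΩ'.mem_nhds hy)).differentiableAt
      (by simp)
  have h1 := hT.hasFDerivAt_comp_apply hΩ (W := fun z i => fderiv ℝ ψ z (Fin.tail v i)) (hm hy)
    ((hψ.contDiffAt (hΩ'.mem_nhds hy)).differentiableAt (by simp))
    (fun i => hψ2.clm_apply (differentiableAt_const _)) (v 0)
  have h2 : ∀ i, fderiv ℝ (fun z => fderiv ℝ ψ z (Fin.tail v i)) y (v 0) =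
      fderiv ℝ (fderiv ℝ ψ) y (v 0) (Fin.tail v i) := by
    intro i
    rw [(hψ2.hasFDerivAt.clm_apply (hasFDerivAt_const (Fin.tail v i) y)).fderiv]
    simp
  have h3 : ∀ (i : Fin n) (a : F), (fun j => fderiv ℝ ψ y (Function.update (Fin.tail v) i a j)) =
        Function.update (fun j => fderiv ℝ ψ y (Fin.tail v j)) i (fderiv ℝ ψ y a) := by
    intro i a
    funext j
    by_cases hj : j = i
    · subst hj; simp
    · simp [hj]
  simp only [covDeriv, pullTensor, h3, fderiv_christoffel_pullBilin hΩ' hΩ hG hψ hm hinv hy,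
    hT.map_update_add _ (hm hy), Finset.sum_add_distrib]
  rw [h1]
  simp only [h2]
  change _ = fderiv ℝ (fun z => T z fun i => fderiv ℝ ψ y (Fin.tail v i)) (ψ y) _ - _
  simp only [Fin.tail]
  have h4 : (Fin.tail fun i => fderiv ℝ ψ y (v i)) = fun i : Fin n => fderiv ℝ ψ y (v i.succ) := rfl
  simp only [h4]
  ring

/-- Covariant differentiation commutes with pulling back under a local diffeomorphism. -/
theorem iterCovDeriv_pullTensor [FiniteDimensional ℝ E] (hΩ' : IsOpen Ω')
    (hΩ : IsOpen Ω) (hG : IsMetricOn Ω G)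
    (hψ : ContDiffOn ℝ ∞ ψ Ω') (hm : MapsTo ψ Ω' Ω)
    (hinv : ∀ y ∈ Ω', (fderiv ℝ ψ y).IsInvertible) {n : ℕ} {T : E → (Fin n → E) → ℝ}
    (hT : IsTensorOn Ω T) : ∀ k, ∀ y ∈ Ω',
      iterCovDeriv (fun y => pullBilin (G (ψ y)) (fderiv ℝ ψ y)) (pullTensor ψ T) k y =
        pullTensor ψ (iterCovDeriv G T k) y
  | 0, _, _ => rfl
  | k + 1, y, hy => by
    rw [iterCovDeriv, covDeriv_congr hΩ' (fun _ _ => rfl)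
      (iterCovDeriv_pullTensor hΩ' hΩ hG hψ hm hinv hT k) y hy]
    exact covDeriv_pullTensor hΩ' hΩ hG hψ hm hinv (hT.iterCovDeriv hΩ hG k) y hy

end Naturality

end TensorCalculus

/-! ### Families of functions with uniformly bounded derivatives -/

section Families

variable {E : Type*} [NormedAddCommGroup E] [NormedSpace ℝ E] {P : Type*}

/-- The functions `f p` have partial derivatives up to order `N` at the points `y p` that are
bounded uniformly in `p`. The order is counted by repeated directional derivatives. -/
def BddDeriv (y : P → E) : ℕ → (P → E → ℝ) → Prop
  | 0, f => ∃ C, ∀ p, |f p (y p)| ≤ C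
  | N + 1, f => (∃ C, ∀ p, |f p (y p)| ≤ C) ∧
      ∀ v, BddDeriv y N (fun p z => fderiv ℝ (f p) z v)

/-- The function `f p` is smooth near the point `y p`, for every `p`. -/
def SmoothFam (y : P → E) (f : P → E → ℝ) : Prop := ∀ p, ContDiffAt ℝ ∞ (f p) (y p)

variable {y : P → E} {f g : P → E → ℝ} {N : ℕ}

namespace SmoothFam

theorem fderiv_apply (hf : SmoothFam y f) (v : E) :
    SmoothFam y (fun p z => fderiv ℝ (f p) z v) := fun p =>
  ((hf p).fderiv_right (m := ∞) (by simp)).clm_apply contDiffAt_const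

theorem eventually_differentiableAt (hf : SmoothFam y f) (p : P) :
    ∀ᶠ z in 𝓝 (y p), DifferentiableAt ℝ (f p) z := by
  have h := ((hf p).of_le (m := 1) (mod_cast le_top)).eventually (by simp)
  exact h.mono fun z hz => hz.differentiableAt (by simp)

theorem mul (hf : SmoothFam y f) (hg : SmoothFam y g) :
    SmoothFam y (fun p z => f p z * g p z) := fun p => (hf p).mul (hg p)

theorem sum {ι : Type*} {s : Finset ι} {f : ι → P → E → ℝ} (h : ∀ i ∈ s, SmoothFam y (f i)) :
    SmoothFam y (fun p z => ∑ i ∈ s, f i p z) := fun p =>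
  ContDiffAt.sum fun i hi => h i hi p

end SmoothFam

namespace BddDeriv

theorem congr : ∀ {N : ℕ} {f g : P → E → ℝ}, BddDeriv y N f →
    (∀ p, f p =ᶠ[𝓝 (y p)] g p) → BddDeriv y N g
  | 0, _, _, ⟨C, hC⟩, h => ⟨C, fun p => by rw [← (h p).eq_of_nhds]; exact hC p⟩
  | _ + 1, _, _, ⟨⟨C, hC⟩, h'⟩, h =>
    ⟨⟨C, fun p => by rw [← (h p).eq_of_nhds]; exact hC p⟩, fun v =>
      congr (h' v) fun p => (h p).fderiv (𝕜 := ℝ) |>.mono fun z hz => congrArg (· v) hz⟩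

theorem of_succ : ∀ {N : ℕ} {f : P → E → ℝ}, BddDeriv y (N + 1) f → BddDeriv y N f
  | 0, _, h => h.1
  | _ + 1, _, h => ⟨h.1, fun v => of_succ (h.2 v)⟩

theorem add : ∀ {N : ℕ} {f g : P → E → ℝ}, SmoothFam y f → SmoothFam y g →
    BddDeriv y N f → BddDeriv y N g → BddDeriv y N (fun p z => f p z + g p z) := by
  intro N
  induction N with
  | zero =>
    rintro f g - - ⟨C, hC⟩ ⟨D, hD⟩
    exact ⟨C + D, fun p => (abs_add_le _ _).trans (add_le_add (hC p) (hD p))⟩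
  | succ N ih =>
    rintro f g hf hg ⟨⟨C, hC⟩, h1⟩ ⟨⟨D, hD⟩, h2⟩
    refine ⟨⟨C + D, fun p => (abs_add_le _ _).trans (add_le_add (hC p) (hD p))⟩, fun v => ?_⟩
    refine (ih (hf.fderiv_apply v) (hg.fderiv_apply v) (h1 v) (h2 v)).congr fun p => ?_
    filter_upwards [hf.eventually_differentiableAt p, hg.eventually_differentiableAt p]
      with z hz hz'
    rw [fderiv_fun_add hz hz']
    simp

theorem mul : ∀ {N : ℕ} {f g : P → E → ℝ}, SmoothFam y f → SmoothFam y g →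
    BddDeriv y N f → BddDeriv y N g → BddDeriv y N (fun p z => f p z * g p z) := by
  have h0 : ∀ {f g : P → E → ℝ}, (∃ C, ∀ p, |f p (y p)| ≤ C) → (∃ C, ∀ p, |g p (y p)| ≤ C) →
      ∃ C, ∀ p, |f p (y p) * g p (y p)| ≤ C := by
    rintro f g ⟨C, hC⟩ ⟨D, hD⟩
    exact ⟨C * D, fun p => by
      rw [abs_mul]
      exact mul_le_mul (hC p) (hD p) (abs_nonneg _) ((abs_nonneg _).trans (hC p))⟩
  intro N
  induction N with
  | zero => exact fun _ _ => h0
  | succ N ih =>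
    intro f g hf hg h1 h2
    refine ⟨h0 h1.1 h2.1, fun v => ?_⟩
    refine (add (hf.mul (hg.fderiv_apply v)) ((hg.mul (hf.fderiv_apply v)))
      (ih hf (hg.fderiv_apply v) h1.of_succ (h2.2 v))
      (ih hg (hf.fderiv_apply v) h2.of_succ (h1.2 v))).congr fun p => ?_
    filter_upwards [hf.eventually_differentiableAt p, hg.eventually_differentiableAt p]
      with z hz hz'
    rw [fderiv_fun_mul hz hz']
    simp

theorem const (c : P → ℝ) (hc : ∃ C, ∀ p, |c p| ≤ C) : ∀ N, BddDeriv y N (fun p _ => c p)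
  | 0 => hc
  | N + 1 => ⟨hc, fun v => by simpa using const 0 ⟨0, by simp⟩ N⟩

theorem const_mul {f : P → E → ℝ} (c : ℝ) (hf : SmoothFam y f) (h : BddDeriv y N f) :
    BddDeriv y N (fun p z => c * f p z) :=
  mul (f := fun _ _ => c) (fun _ => contDiffAt_const) hf (const _ ⟨|c|, fun _ => le_rfl⟩ N) h

theorem sub (hf : SmoothFam y f) (hg : SmoothFam y g)
    (h1 : BddDeriv y N f) (h2 : BddDeriv y N g) : BddDeriv y N (fun p z => f p z - g p z) := by
  have := add hf (fun p => contDiffAt_const.mul (hg p)) h1 (const_mul (-1) hg h2)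
  simpa [sub_eq_add_neg] using this

theorem sum {ι : Type*} {s : Finset ι} {f : ι → P → E → ℝ} (h : ∀ i ∈ s, SmoothFam y (f i))
    (h' : ∀ i ∈ s, BddDeriv y N (f i)) : BddDeriv y N (fun p z => ∑ i ∈ s, f i p z) := by
  classical
  induction s using Finset.induction_on with
  | empty => simpa using const (y := y) 0 ⟨0, by simp⟩ N
  | insert a s ha ih =>
    simp only [Finset.sum_insert ha]
    exact add (h a (by simp)) (SmoothFam.sum fun i hi => h i (by simp [hi])) (h' a (by simp))
      (ih (fun i hi => h i (by simp [hi])) (fun i hi => h' i (by simp [hi])))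

/-- A fixed smooth function has bounded derivatives at the points of a compact set. -/
theorem of_isCompact {Ω K : Set E} (hΩ : IsOpen Ω) (hK : IsCompact K) (hKΩ : K ⊆ Ω)
    (hy : ∀ p, y p ∈ K) : ∀ (N : ℕ) {f : E → ℝ}, ContDiffOn ℝ ∞ f Ω →
      BddDeriv y N (fun _ => f) := by
  have h0 : ∀ {f : E → ℝ}, ContDiffOn ℝ ∞ f Ω → ∃ C, ∀ p, |f (y p)| ≤ C := by
    intro f hf
    obtain ⟨C, hC⟩ := hK.exists_bound_of_continuousOn (hf.continuousOn.mono hKΩ)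
    exact ⟨C, fun p => hC _ (hy p)⟩
  intro N
  induction N with
  | zero => exact fun hf => h0 hf
  | succ N ih =>
    exact fun hf => ⟨h0 hf, fun v =>
      ih ((hf.fderiv_of_isOpen hΩ (by simp)).clm_apply contDiffOn_const)⟩

/-- If a linear system with bounded coefficients is uniformly coercive and its right-hand side is
bounded, together with derivatives, then the solution is bounded. -/
theorem of_linear_system {ι : Type*} [Fintype ι] {M : ι → ι → P → E → ℝ}
    (hM : ∀ a b, SmoothFam y (M a b)) (hM' : ∀ a b N, BddDeriv y N (M a b)) {c : ℝ} (hc : 0 < c)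
    (hcoer : ∀ p, ∀ x : ι → ℝ, c * ∑ a, x a ^ 2 ≤ ∑ a, (∑ b, M a b p (y p) * x b) * x a) :
    ∀ (N : ℕ) {f : ι → P → E → ℝ}, (∀ a, SmoothFam y (f a)) →
      (∀ a, BddDeriv y N (fun p z => ∑ b, M a b p z * f b p z)) → ∀ a, BddDeriv y N (f a) := by
  -- the bound of order zero: pair the system with its solution, and use coercivity and
  -- `2 K x ≤ K² / c + c x²`
  have h0 : ∀ {f : ι → P → E → ℝ},
      (∀ a, ∃ C, ∀ p, |∑ b, M a b p (y p) * f b p (y p)| ≤ C) →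
      ∀ a, ∃ C, ∀ p, |f a p (y p)| ≤ C := by
    intro f h a
    choose C hC using h
    refine ⟨√((∑ a, C a ^ 2) / c ^ 2), fun p => Real.abs_le_sqrt ?_⟩
    have h1 := hcoer p (fun b => f b p (y p))
    have h2 : ∀ a, (∑ b, M a b p (y p) * f b p (y p)) * f a p (y p) ≤
        (C a ^ 2 / c + c * f a p (y p) ^ 2) / 2 := by
      intro a
      have h3 : (∑ b, M a b p (y p) * f b p (y p)) ^ 2 ≤ C a ^ 2 :=
        sq_le_sq' (abs_le.1 (hC a p)).1 (abs_le.1 (hC a p)).2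
      set K := ∑ b, M a b p (y p) * f b p (y p)
      have h4 : 0 ≤ (K - c * f a p (y p)) ^ 2 / c := by positivity
      have h5 : (K - c * f a p (y p)) ^ 2 / c =
          K ^ 2 / c - 2 * (K * f a p (y p)) + c * f a p (y p) ^ 2 := by
        field_simp
        ring
      have h6 : K ^ 2 / c ≤ C a ^ 2 / c := by gcongr
      linarith
    have h7 : c * ∑ a, f a p (y p) ^ 2 ≤ ((∑ a, C a ^ 2) / c + c * ∑ a, f a p (y p) ^ 2) / 2 := by
      refine h1.trans ((Finset.sum_le_sum fun a _ => h2 a).trans (le_of_eq ?_))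
      rw [← Finset.sum_div, Finset.sum_add_distrib, Finset.mul_sum, Finset.sum_div]
    have h8 : f a p (y p) ^ 2 ≤ ∑ a, f a p (y p) ^ 2 :=
      Finset.single_le_sum (f := fun a => f a p (y p) ^ 2) (fun _ _ => sq_nonneg _)
        (Finset.mem_univ a)
    rw [le_div_iff₀ (by positivity)]
    have h9 : c * ∑ a, f a p (y p) ^ 2 ≤ (∑ a, C a ^ 2) / c := by linarith
    rw [le_div_iff₀ hc] at h9
    nlinarith [mul_le_mul_of_nonneg_left h8 (sq_nonneg c)]
  intro N
  induction N with
  | zero => exact fun _ h => h0 h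
  | succ N ih =>
    intro f hf h a
    refine ⟨h0 (fun a => (h a).1) a, fun v => ?_⟩
    -- the derivatives of the solution solve a system with the same matrix, whose right-hand side
    -- involves the solution itself and is bounded by induction
    have hfN : ∀ a, BddDeriv y N (f a) := ih hf fun a => (h a).of_succ
    refine ih (f := fun a p z => fderiv ℝ (f a p) z v) (fun a => (hf a).fderiv_apply v)
      (fun a => ?_) a
    have h1 : BddDeriv y N (fun p z => fderiv ℝ (fun z => ∑ b, M a b p z * f b p z) z v -
        ∑ b, fderiv ℝ (M a b p) z v * f b p z) := by
      refine sub ((SmoothFam.sum fun b _ => (hM a b).mul (hf b)).fderiv_apply v)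
        (SmoothFam.sum fun b _ => ((hM a b).fderiv_apply v).mul (hf b)) ((h a).2 v)
        (sum (fun b _ => ((hM a b).fderiv_apply v).mul (hf b)) fun b _ => ?_)
      exact mul ((hM a b).fderiv_apply v) (hf b) ((hM' a b (N + 1)).2 v) (hfN b)
    refine h1.congr fun p => ?_
    have e1 : ∀ᶠ z in 𝓝 (y p), ∀ b, DifferentiableAt ℝ (M a b p) z :=
      eventually_all.2 fun b => (hM a b).eventually_differentiableAt p
    have e2 : ∀ᶠ z in 𝓝 (y p), ∀ b, DifferentiableAt ℝ (f b p) z :=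
      eventually_all.2 fun b => (hf b).eventually_differentiableAt p
    filter_upwards [e1, e2] with z hz hz'
    rw [fderiv_fun_sum (A := fun b z => M a b p z * f b p z) fun b _ => (hz b).mul (hz' b)]
    simp only [sum_apply]
    rw [← Finset.sum_sub_distrib]
    refine Finset.sum_congr rfl fun b _ => ?_
    rw [fderiv_fun_mul (hz b) (hz' b)]
    simp
    ring

end BddDeriv

/-! ### Uniform bounds for covariant derivatives -/

theorem IsTensorOn.smoothFam {U : P → Set E} (hU : ∀ p, IsOpen (U p)) (hy : ∀ p, y p ∈ U p)
    {n : ℕ} {T : P → E → (Fin n → E) → ℝ} (hT : ∀ p, IsTensorOn (U p) (T p)) (v : Fin n → E) :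
    SmoothFam y (fun p z => T p z v) := fun p =>
  ((hT p).smooth v).contDiffAt ((hU p).mem_nhds (hy p))

/-- The correction terms of the covariant derivative, in terms of a basis. -/
theorem IsTensorOn.update_eq_sum {Ω : Set E} {n : ℕ} {T : E → (Fin n → E) → ℝ}
    (hT : IsTensorOn Ω T) {ι : Type*} [Fintype ι] (b : Module.Basis ι ℝ E) {z : E} (hz : z ∈ Ω)
    (v : Fin n → E) (i : Fin n) (w : E) :
    T z (Function.update v i w) = ∑ a, b.repr w a * T z (Function.update v i (b a)) := by
  have h := (hT.toMultilinear hz).map_update_sum (t := Finset.univ) (i := i)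
    (g := fun a => b.repr w a • b a) (m := v)
  rw [b.sum_repr w] at h
  refine h.trans (Finset.sum_congr rfl fun a _ => ?_)
  exact hT.map_update_smul z hz v i _ _

variable [FiniteDimensional ℝ E]

/-- If the covariant derivatives of a family of tensor fields, for a fixed metric, are uniformly
bounded at points of a compact set, then so are the partial derivatives of the components: a
partial derivative is a covariant derivative plus terms of lower order. -/
theorem bddDeriv_of_iterCovDeriv {Ω K : Set E} (hΩ : IsOpen Ω) (hK : IsCompact K) (hKΩ : K ⊆ Ω)
    {G : E → E →L[ℝ] E →L[ℝ] ℝ} (hG : IsMetricOn Ω G) (hyK : ∀ p, y p ∈ K)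
    {U : P → Set E} (hU : ∀ p, IsOpen (U p)) (hUΩ : ∀ p, U p ⊆ Ω) (hy : ∀ p, y p ∈ U p) :
    ∀ (N : ℕ) {n : ℕ} {T : P → E → (Fin n → E) → ℝ}, (∀ p, IsTensorOn (U p) (T p)) →
      (∀ j ≤ N, ∀ v, ∃ C, ∀ p, |iterCovDeriv G (T p) j (y p) v| ≤ C) →
      ∀ v, BddDeriv y N (fun p z => T p z v) := by
  let b := Module.finBasis ℝ E
  intro N
  induction N with
  | zero => exact fun _ h v => h 0 le_rfl v
  | succ N ih =>
    intro n T hT h v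
    refine ⟨h 0 (by omega) v, fun u => ?_⟩
    have hTN : ∀ v, BddDeriv y N (fun p z => T p z v) := ih hT fun j hj => h j (by omega)
    have hC : ∀ p, IsTensorOn (U p) (covDeriv G (T p)) := fun p =>
      (hT p).covDeriv (hU p) (hG.mono (hUΩ p))
    have hCN : BddDeriv y N (fun p z => covDeriv G (T p) z (Fin.cons u v : Fin (n + 1) → E)) := by
      refine ih hC (fun j hj w => ?_) _
      obtain ⟨C, hC⟩ := h (j + 1) (by omega) (w ∘ Fin.cast (by omega))
      refine ⟨C, fun p => ?_⟩
      have := hC p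
      rw [iterCovDeriv_succ_eq] at this
      exact this
    have hΓ : ∀ i a, SmoothFam y (fun _ z => b.repr (christoffel G z u (v i)) a) := fun i a p =>
      (b.coord a).toContinuousLinearMap.contDiff.contDiffAt.comp (y p)
        ((hG.contDiffOn_christoffel hΩ u (v i)).contDiffAt (hΩ.mem_nhds (hKΩ (hyK p))))
    have hS : ∀ v, SmoothFam y (fun p z => T p z v) := IsTensorOn.smoothFam hU hy hT
    have hsum : BddDeriv y N (fun p z => ∑ i, ∑ a, b.repr (christoffel G z u (v i)) a *
        T p z (Function.update v i (b a))) := by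
      refine BddDeriv.sum (fun i _ => SmoothFam.sum fun a _ => (hΓ i a).mul (hS _)) fun i _ =>
        BddDeriv.sum (fun a _ => (hΓ i a).mul (hS _)) fun a _ =>
          BddDeriv.mul (hΓ i a) (hS _) ?_ (hTN _)
      exact BddDeriv.of_isCompact hΩ hK hKΩ hyK N
        ((b.coord a).toContinuousLinearMap.contDiff.comp_contDiffOn
          (hG.contDiffOn_christoffel hΩ u (v i)))
    refine (BddDeriv.add (IsTensorOn.smoothFam hU hy hC _)
      (SmoothFam.sum fun i _ => SmoothFam.sum fun a _ => (hΓ i a).mul (hS _)) hCN hsum).congr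
      fun p => ?_
    filter_upwards [(hU p).mem_nhds (hy p)] with z hz
    have : ∀ i, ∑ a, b.repr (christoffel G z u (v i)) a * T p z (Function.update v i (b a)) =
        T p z (Function.update v i (christoffel G z u (v i))) := fun i =>
      ((hT p).update_eq_sum b hz v i _).symm
    simp only [this, covDeriv, Fin.cons_zero, Fin.tail_cons]
    simp

/-- The coordinates with respect to a basis are controlled by a coercive bilinear form. -/
theorem exists_pos_mul_sum_repr_sq_le {ι : Type*} [Fintype ι] (b : Module.Basis ι ℝ E) {c : ℝ}
    (hc : 0 < c) : ∃ c' > 0, ∀ v : E, c' * ∑ a, b.repr v a ^ 2 ≤ c * ‖v‖ ^ 2 := by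
  have h1 : ∀ v : E, ∑ a, b.repr v a ^ 2 ≤
      (∑ a, ‖(b.coord a).toContinuousLinearMap‖ ^ 2) * ‖v‖ ^ 2 := by
    intro v
    rw [Finset.sum_mul]
    refine Finset.sum_le_sum fun a _ => ?_
    have := (b.coord a).toContinuousLinearMap.le_opNorm v
    rw [← mul_pow, ← sq_abs]
    gcongr
    exact this
  set D := ∑ a, ‖(b.coord a).toContinuousLinearMap‖ ^ 2
  have hD : 0 ≤ D := Finset.sum_nonneg fun _ _ => sq_nonneg _
  refine ⟨c / (D + 1), by positivity, fun v => ?_⟩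
  calc c / (D + 1) * ∑ a, b.repr v a ^ 2 ≤ c / (D + 1) * (D * ‖v‖ ^ 2) := by gcongr; exact h1 v
    _ = c * ‖v‖ ^ 2 * (D / (D + 1)) := by ring
    _ ≤ c * ‖v‖ ^ 2 * 1 := by
      gcongr
      exact (div_le_one (by positivity)).2 (by linarith)
    _ = c * ‖v‖ ^ 2 := mul_one _

variable {U : P → Set E} {G : P → E → E →L[ℝ] E →L[ℝ] ℝ}

/-- The components of the Christoffel maps of a uniformly coercive family of metrics have bounded
derivatives if the components of the metrics do: by the Koszul formula they solve a linear system
whose matrix is the metric. -/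
theorem bddDeriv_christoffel (hU : ∀ p, IsOpen (U p)) (hy : ∀ p, y p ∈ U p)
    (hG : ∀ p, IsMetricOn (U p) (G p)) (hG' : ∀ u v N, BddDeriv y N (fun p z => G p z u v))
    {c : ℝ} (hc : 0 < c) (hcoer : ∀ p v, c * ‖v‖ ^ 2 ≤ G p (y p) v v)
    {ι : Type*} [Fintype ι] (b : Module.Basis ι ℝ E) (u v : E) (N : ℕ) (a : ι) :
    BddDeriv y N (fun p z => b.repr (christoffel (G p) z u v) a) := by
  have hGs : ∀ u v, SmoothFam y (fun p z => G p z u v) := fun u v p =>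
    (((hG p).smooth.clm_apply contDiffOn_const).clm_apply contDiffOn_const).contDiffAt
      ((hU p).mem_nhds (hy p))
  obtain ⟨c', hc', h'⟩ := exists_pos_mul_sum_repr_sq_le b hc
  refine BddDeriv.of_linear_system (M := fun a b' p z => G p z (b b') (b a))
    (f := fun a p z => b.repr (christoffel (G p) z u v) a)
    (fun _ _ => hGs _ _) (fun _ _ _ => hG' _ _ _) hc' (fun p x => ?_) N (fun a p => ?_)
    (fun a => ?_) a
  · let w : E := b.equivFun.symm x
    have hw : ∀ a, b.repr w a = x a := fun a =>
      congrFun (b.equivFun.apply_symm_apply x) a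
    have h1 := (h' w).trans (hcoer p w)
    simp only [hw] at h1
    refine h1.trans (le_of_eq ?_)
    have h2 : w = ∑ a, x a • b a := b.equivFun_symm_apply x
    conv_lhs => rw [h2]
    simp only [map_sum, map_smul, sum_apply, smul_apply, smul_eq_mul]
    refine Finset.sum_congr rfl fun i _ => ?_
    rw [mul_comm]
    congr 1
    exact Finset.sum_congr rfl fun _ _ => mul_comm _ _
  · exact (b.coord a).toContinuousLinearMap.contDiff.contDiffAt.comp (y p)
      (((hG p).contDiffOn_christoffel (hU p) u v).contDiffAt ((hU p).mem_nhds (hy p)))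
  · have h1 : ∀ u v w, SmoothFam y (fun p z => fderiv ℝ (fun z => G p z v w) z u) := fun u v w =>
      (hGs v w).fderiv_apply u
    have h2 : ∀ u v w, BddDeriv y N (fun p z => fderiv ℝ (fun z => G p z v w) z u) :=
      fun u v w => (hG' v w (N + 1)).2 u
    have h3 := BddDeriv.const_mul (1 / 2)
      (fun p => ((h1 u v (b a) p).add (h1 v u (b a) p)).sub (h1 (b a) u v p))
      (BddDeriv.sub (fun p => (h1 u v (b a) p).add (h1 v u (b a) p)) (h1 (b a) u v)
        (BddDeriv.add (h1 u v (b a)) (h1 v u (b a)) (h2 u v (b a)) (h2 v u (b a))) (h2 (b a) u v))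
    refine h3.congr fun p => ?_
    filter_upwards [(hU p).mem_nhds (hy p)] with z hz
    have hd : DifferentiableAt ℝ (G p) z :=
      ((hG p).smooth.contDiffAt ((hU p).mem_nhds hz)).differentiableAt (by simp)
    have h4 := apply_christoffel ((hG p).inv z hz) u v (b a)
    rw [fderiv_bilin_apply hd, fderiv_bilin_apply hd, fderiv_bilin_apply hd] at h4
    rw [← h4]
    generalize christoffel (G p) z u v = w
    have h5 : G p z w = ∑ a, b.repr w a • G p z (b a) := by
      conv_lhs => rw [← b.sum_repr w]
      simp only [map_sum, map_smul]
    rw [h5, sum_apply]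
    exact Finset.sum_congr rfl fun _ _ => mul_comm _ _

/-- Covariant derivatives of tensor fields with bounded partial derivatives are bounded, for a
uniformly coercive family of metrics with bounded partial derivatives. -/
theorem bddDeriv_iterCovDeriv (hU : ∀ p, IsOpen (U p)) (hy : ∀ p, y p ∈ U p)
    (hG : ∀ p, IsMetricOn (U p) (G p)) (hG' : ∀ u v N, BddDeriv y N (fun p z => G p z u v))
    {c : ℝ} (hc : 0 < c) (hcoer : ∀ p v, c * ‖v‖ ^ 2 ≤ G p (y p) v v)
    {n : ℕ} {T : P → E → (Fin n → E) → ℝ} (hT : ∀ p, IsTensorOn (U p) (T p))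
    (hT' : ∀ v N, BddDeriv y N (fun p z => T p z v)) :
    ∀ k v N, BddDeriv y N (fun p z => iterCovDeriv (G p) (T p) k z v) := by
  let b := Module.finBasis ℝ E
  intro k
  induction k with
  | zero => exact hT'
  | succ k ih =>
    intro v N
    have hk : ∀ p, IsTensorOn (U p) (iterCovDeriv (G p) (T p) k) := fun p =>
      (hT p).iterCovDeriv (hU p) (hG p) k
    have hS := IsTensorOn.smoothFam hU hy hk
    have hΓ : ∀ u v a, SmoothFam y (fun p z => b.repr (christoffel (G p) z u v) a) :=
      fun u v a p => (b.coord a).toContinuousLinearMap.contDiff.contDiffAt.comp (y p)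
        (((hG p).contDiffOn_christoffel (hU p) u v).contDiffAt ((hU p).mem_nhds (hy p)))
    have hs : ∀ i, SmoothFam y (fun p z => ∑ a,
        b.repr (christoffel (G p) z (v 0) (Fin.tail v i)) a *
          iterCovDeriv (G p) (T p) k z (Function.update (Fin.tail v) i (b a))) := fun i =>
      SmoothFam.sum fun a _ => (hΓ _ _ a).mul (hS _)
    refine (BddDeriv.sub ((hS (Fin.tail v)).fderiv_apply (v 0))
      (SmoothFam.sum (s := Finset.univ) fun i _ => hs i) ((ih (Fin.tail v) (N + 1)).2 (v 0))
      (BddDeriv.sum (fun i _ => hs i) fun i _ => BddDeriv.sum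
        (fun a _ => (hΓ _ _ a).mul (hS _)) fun a _ => BddDeriv.mul (hΓ _ _ a) (hS _)
          (bddDeriv_christoffel hU hy hG hG' hc hcoer b _ _ N a) (ih _ N))).congr fun p => ?_
    filter_upwards [(hU p).mem_nhds (hy p)] with z hz
    simp only [← (hk p).update_eq_sum b hz]
    rfl

/-- Uniform bounds on the components of multilinear forms give bounds on their norms. -/
theorem exists_bound_of_bounded_apply {Ω : P → Set E} {n : ℕ} {T : P → E → (Fin n → E) → ℝ}
    (hT : ∀ p, IsTensorOn (Ω p) (T p)) (hy : ∀ p, y p ∈ Ω p)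
    (h : ∀ v, ∃ C, ∀ p, |T p (y p) v| ≤ C) :
    ∃ C, 0 ≤ C ∧ ∀ p v, |T p (y p) v| ≤ C * ∏ i, ‖v i‖ := by
  let b := Module.finBasis ℝ E
  choose C hC using h
  set D := ∑ a, ‖(b.coord a).toContinuousLinearMap‖
  have hD : ∀ v a, |b.repr v a| ≤ D * ‖v‖ := fun v a =>
    ((b.coord a).toContinuousLinearMap.le_opNorm v).trans (by
      gcongr
      exact Finset.single_le_sum (f := fun a => ‖(b.coord a).toContinuousLinearMap‖)
        (fun _ _ => norm_nonneg _) (Finset.mem_univ a))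
  have hD0 : 0 ≤ D := Finset.sum_nonneg fun _ _ => norm_nonneg _
  refine ⟨∑ a : Fin n → Fin (Module.finrank ℝ E), D ^ n * |C fun i => b (a i)|,
    Finset.sum_nonneg fun _ _ => by positivity, fun p v => ?_⟩
  rw [(hT p).apply_eq_sum b (hy p), Finset.sum_mul]
  refine (Finset.abs_sum_le_sum_abs _ _).trans (Finset.sum_le_sum fun a _ => ?_)
  rw [abs_mul, Finset.abs_prod]
  have h1 : ∏ i, |b.repr (v i) (a i)| ≤ D ^ n * ∏ i, ‖v i‖ := by
    refine (Finset.prod_le_prod (fun _ _ => abs_nonneg _) fun i _ => hD (v i) (a i)).trans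
      (le_of_eq ?_)
    rw [Finset.prod_mul_distrib]
    simp
  calc _ ≤ (D ^ n * ∏ i, ‖v i‖) * |C fun i => b (a i)| := by
        exact mul_le_mul h1 ((hC _ p).trans (le_abs_self _)) (abs_nonneg _) (by positivity)
    _ = _ := by ring

end Families

/-! ### Pulling back tensor fields from a manifold to a vector space -/

section PullBack

variable {E H : Type*} [NormedAddCommGroup E] [NormedSpace ℝ E] [TopologicalSpace H]
  {I : ModelWithCorners ℝ E H}
  {M : Type*} [TopologicalSpace M] [ChartedSpace H M]
  {F : Type*} [NormedAddCommGroup F] [NormedSpace ℝ F]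

variable (I) in
/-- The pull-back of a 1-form under a map from a vector space to a manifold. -/
def pullForm (f : F → M) (α : OneField I M) : F → F →L[ℝ] ℝ := fun y =>
  (α (f y)).comp (mfderiv 𝓘(ℝ, F) I f y)

variable (I) in
/-- The pull-back of a covariant tensor field under a map from a vector space to a manifold. -/
def pullField (f : F → M) {n : ℕ} (T : (x : M) → (Fin n → TangentSpace I x) → ℝ) :
    F → (Fin n → F) → ℝ := fun y v => T (f y) (fun i => mfderiv 𝓘(ℝ, F) I f y (v i))

variable (I) in
/-- The pull-back of a field of bilinear forms under a map from a vector space to a manifold. -/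
def pullMet (f : F → M) (G : (x : M) → TangentSpace I x →L[ℝ] TangentSpace I x →L[ℝ] ℝ) :
    F → F →L[ℝ] F →L[ℝ] ℝ := fun y =>
  pullBilin (V := F) (W := E) (G (f y)) (mfderiv 𝓘(ℝ, F) I f y)

theorem extChartAt_symm_comp {X : Type*} {Ω : Set X} {f : X → M} {p : M} {y : X}
    (hy : y ∈ Ω ∩ f ⁻¹' (chartAt H p).source) :
    (extChartAt I p).symm (extChartAt I p (f y)) = f y :=
  (extChartAt I p).left_inv (by rw [extChartAt_source]; exact hy.2)

/-- A constant vector is mapped by the differential of a smooth map to a smooth vector field along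
that map. -/
theorem contMDiffAt_mfderiv_const [IsManifold I ∞ M] {Ω : Set F} (hΩ : IsOpen Ω) {f : F → M}
    (hf : ContMDiffOn 𝓘(ℝ, F) I ∞ f Ω) (v : F) {y : F} (hy : y ∈ Ω) :
    ContMDiffAt 𝓘(ℝ, F) (I.prod 𝓘(ℝ, E)) ∞
      (fun y => (TotalSpace.mk' E (f y) (mfderiv 𝓘(ℝ, F) I f y v) : TangentBundle I M)) y := by
  have h1 := hf.contMDiffOn_tangentMapWithin (m := ∞) (by simp) hΩ.uniqueMDiffOn
  have h2 : ContMDiffAt 𝓘(ℝ, F) (𝓘(ℝ, F).prod 𝓘(ℝ, F)) ∞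
      (fun y => (TotalSpace.mk' F y v : TangentBundle 𝓘(ℝ, F) F)) y :=
    (contMDiffAt_vectorSpace_iff_contDiffAt (V := fun _ => v)).2 contDiffAt_const
  have h3 : ContMDiffWithinAt 𝓘(ℝ, F) (I.prod 𝓘(ℝ, E)) ∞
      (fun y => tangentMapWithin 𝓘(ℝ, F) I f Ω (TotalSpace.mk' F y v)) Ω y :=
    ContMDiffWithinAt.comp y (h1 _ (by exact hy)) h2.contMDiffWithinAt (fun z hz => hz)
  refine (h3.contMDiffAt (hΩ.mem_nhds hy)).congr_of_eventuallyEq ?_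
  filter_upwards [hΩ.mem_nhds hy] with z hz
  simp only [tangentMapWithin]
  rw [mfderivWithin_of_isOpen hΩ hz]

theorem contDiffOn_pullForm_apply [IsManifold I ∞ M] {Ω : Set F} (hΩ : IsOpen Ω) {f : F → M}
    (hf : ContMDiffOn 𝓘(ℝ, F) I ∞ f Ω) {α : OneField I M} (hα : IsSmoothForm α) (v : F) :
    ContDiffOn ℝ ∞ (fun y => pullForm I f α y v) Ω := by
  intro y hy
  have h1 : ContMDiffAt 𝓘(ℝ, F) (I.prod 𝓘(ℝ, E →L[ℝ] ℝ)) ∞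
      (fun y => TotalSpace.mk' (E →L[ℝ] ℝ)
        (E := fun x : M => TangentSpace I x →L[ℝ] Trivial M ℝ x) (f y) (α (f y))) y :=
    (hα (f y)).comp y (hf.contMDiffAt (hΩ.mem_nhds hy))
  have h2 := ContMDiffAt.clm_bundle_apply (E₂ := Trivial M ℝ) h1
    (contMDiffAt_mfderiv_const hΩ hf v hy)
  have h3 := (contMDiffAt_totalSpace.1 h2).2
  exact (contMDiffAt_iff_contDiffAt.1 h3).contDiffWithinAt

theorem contDiffOn_pullForm [FiniteDimensional ℝ F] [IsManifold I ∞ M] {Ω : Set F}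
    (hΩ : IsOpen Ω) {f : F → M} (hf : ContMDiffOn 𝓘(ℝ, F) I ∞ f Ω) {α : OneField I M}
    (hα : IsSmoothForm α) : ContDiffOn ℝ ∞ (pullForm I f α) Ω :=
  contDiffOn_clm_apply.2 fun v => contDiffOn_pullForm_apply hΩ hf hα v

theorem contDiffOn_pullMet_apply [IsManifold I ∞ M] {Ω : Set F} (hΩ : IsOpen Ω) {f : F → M}
    (hf : ContMDiffOn 𝓘(ℝ, F) I ∞ f Ω)
    (g : ContMDiffRiemannianMetric I ∞ E (fun x : M => TangentSpace I x)) (u v : F) :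
    ContDiffOn ℝ ∞ (fun y => pullMet I f g.inner y u v) Ω := by
  intro y hy
  have h1 : ContMDiffAt 𝓘(ℝ, F) (I.prod 𝓘(ℝ, E →L[ℝ] E →L[ℝ] ℝ)) ∞
      (fun y => TotalSpace.mk' (E →L[ℝ] E →L[ℝ] ℝ)
        (E := fun x : M => TangentSpace I x →L[ℝ] TangentSpace I x →L[ℝ] Trivial M ℝ x)
        (f y) (g.inner (f y))) y :=
    (g.contMDiff (f y)).comp y (hf.contMDiffAt (hΩ.mem_nhds hy))
  have h2 := ContMDiffAt.clm_bundle_apply₂ (E₃ := Trivial M ℝ) h1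
    (contMDiffAt_mfderiv_const hΩ hf u hy) (contMDiffAt_mfderiv_const hΩ hf v hy)
  have h3 := (contMDiffAt_totalSpace.1 h2).2
  exact (contMDiffAt_iff_contDiffAt.1 h3).contDiffWithinAt

theorem contMDiffOn_extChartAt_comp [IsManifold I ∞ M] {Ω : Set F} {f : F → M}
    (hf : ContMDiffOn 𝓘(ℝ, F) I ∞ f Ω) (p : M) :
    ContDiffOn ℝ ∞ (extChartAt I p ∘ f) (Ω ∩ f ⁻¹' (chartAt H p).source) := by
  rw [← contMDiffOn_iff_contDiffOn]
  exact (contMDiffOn_extChartAt (x := p)).comp (hf.mono inter_subset_left) (fun y hy => hy.2)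

theorem isOpen_inter_preimage_chart_source [IsManifold I ∞ M] {Ω : Set F} (hΩ : IsOpen Ω)
    {f : F → M} (hf : ContMDiffOn 𝓘(ℝ, F) I ∞ f Ω) (p : M) :
    IsOpen (Ω ∩ f ⁻¹' (chartAt H p).source) :=
  hf.continuousOn.isOpen_inter_preimage hΩ (chartAt H p).open_source

variable [I.Boundaryless]

/-- The differential of a map into `M` factors through the coordinate representation of the map.
The pull-back of a tensor field to a vector space is therefore the pull-back of its coordinate
representation. -/
theorem mfderiv_eq_comp_extChartAt [IsManifold I ∞ M] {Ω : Set F} (hΩ : IsOpen Ω) {f : F → M}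
    (hf : ContMDiffOn 𝓘(ℝ, F) I ∞ f Ω) (p : M) {y : F}
    (hy : y ∈ Ω ∩ f ⁻¹' (chartAt H p).source) :
    mfderiv 𝓘(ℝ, F) I f y =
      (mfderiv 𝓘(ℝ, E) I (extChartAt I p).symm (extChartAt I p (f y)) : E →L[ℝ] E).comp
        (fderiv ℝ (extChartAt I p ∘ f) y) := by
  have hO := isOpen_inter_preimage_chart_source hΩ hf p
  have h1 : MDifferentiableAt 𝓘(ℝ, F) 𝓘(ℝ, E) (extChartAt I p ∘ f) y :=
    (((contMDiffOn_extChartAt_comp hf p).contDiffAt (hO.mem_nhds hy)).differentiableAt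
      (by simp)).mdifferentiableAt
  have hs : f y ∈ (extChartAt I p).source := by rw [extChartAt_source]; exact hy.2
  have h2 : MDifferentiableAt 𝓘(ℝ, E) I (extChartAt I p).symm ((extChartAt I p ∘ f) y) :=
    ((contMDiffOn_extChartAt_symm (n := ∞) p).contMDiffAt
      ((isOpen_extChartAt_target p).mem_nhds ((extChartAt I p).map_source hs))).mdifferentiableAt
      (by simp)
  have h3 := mfderiv_comp y h2 h1
  rw [mfderiv_eq_fderiv] at h3
  have h4 : f =ᶠ[𝓝 y] (extChartAt I p).symm ∘ (extChartAt I p ∘ f) := by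
    filter_upwards [hO.mem_nhds hy] with z hz
    exact ((extChartAt I p).left_inv (by rw [extChartAt_source]; exact hz.2)).symm
  exact (h4.mfderiv_eq).trans h3

theorem pullForm_eq [IsManifold I ∞ M] {Ω : Set F} (hΩ : IsOpen Ω) {f : F → M}
    (hf : ContMDiffOn 𝓘(ℝ, F) I ∞ f Ω) (α : OneField I M) (p : M) {y : F}
    (hy : y ∈ Ω ∩ f ⁻¹' (chartAt H p).source) :
    pullForm I f α y = (chartForm I p α ((extChartAt I p ∘ f) y)).comp
      (fderiv ℝ (extChartAt I p ∘ f) y) := by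
  ext v
  have h := mfderiv_eq_comp_extChartAt hΩ hf p hy
  have h' := extChartAt_symm_comp (I := I) hy
  simp only [pullForm, chartForm, ContinuousLinearMap.comp_apply, Function.comp_apply, h]
  rw [h']
  rfl

theorem pullField_eq [IsManifold I ∞ M] {Ω : Set F} (hΩ : IsOpen Ω) {f : F → M}
    (hf : ContMDiffOn 𝓘(ℝ, F) I ∞ f Ω) {n : ℕ} (T : (x : M) → (Fin n → TangentSpace I x) → ℝ)
    (p : M) {y : F} (hy : y ∈ Ω ∩ f ⁻¹' (chartAt H p).source) :
    pullField I f T y = pullTensor (extChartAt I p ∘ f) (chartTensor I p T) y := by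
  funext v
  have h := mfderiv_eq_comp_extChartAt hΩ hf p hy
  have h' := extChartAt_symm_comp (I := I) hy
  simp only [pullField, chartTensor, pullTensor, Function.comp_apply, h]
  congr 1
  rw [h']

theorem pullMet_eq [IsManifold I ∞ M] {Ω : Set F} (hΩ : IsOpen Ω) {f : F → M}
    (hf : ContMDiffOn 𝓘(ℝ, F) I ∞ f Ω)
    (G : (x : M) → TangentSpace I x →L[ℝ] TangentSpace I x →L[ℝ] ℝ)
    (p : M) {y : F} (hy : y ∈ Ω ∩ f ⁻¹' (chartAt H p).source) :
    pullMet I f G y = pullBilin (chartMetric I p G ((extChartAt I p ∘ f) y))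
      (fderiv ℝ (extChartAt I p ∘ f) y) := by
  ext u v
  have h := mfderiv_eq_comp_extChartAt hΩ hf p hy
  have h' := extChartAt_symm_comp (I := I) hy
  simp only [pullMet, chartMetric, pullBilin, Function.comp_apply, h,
    ContinuousLinearMap.bilinearComp_apply]
  rw [h']
  rfl

/-- The pull-back of a closed form is closed. -/
theorem fderiv_pullForm_symm [IsManifold I ∞ M] {Ω : Set F} (hΩ : IsOpen Ω) {f : F → M}
    (hf : ContMDiffOn 𝓘(ℝ, F) I ∞ f Ω) {α : OneField I M} (hα : α ∈ closedForms I M)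
    {y : F} (hy : y ∈ Ω) (u v : F) :
    fderiv ℝ (pullForm I f α) y u v = fderiv ℝ (pullForm I f α) y v u := by
  set ψ := extChartAt I (f y) ∘ f with hψdef
  have hO := isOpen_inter_preimage_chart_source hΩ hf (f y)
  have hy' : y ∈ Ω ∩ f ⁻¹' (chartAt H (f y)).source := ⟨hy, mem_chart_source H (f y)⟩
  have hψ := contMDiffOn_extChartAt_comp hf (f y)
  have hsec : ∀ a b, fderiv ℝ (fderiv ℝ ψ) y a b = fderiv ℝ (fderiv ℝ ψ) y b a := by
    have h := (hψ.contDiffAt (hO.mem_nhds hy')).isSymmSndFDerivAt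
      (by simpa using! (mod_cast le_top : ((2 : ℕ∞) : WithTop ℕ∞) ≤ ∞))
    exact fun a b => h.eq a b
  have hψd : DifferentiableAt ℝ ψ y := (hψ.contDiffAt (hO.mem_nhds hy')).differentiableAt (by simp)
  have hψ2 : DifferentiableAt ℝ (fderiv ℝ ψ) y :=
    ((hψ.fderiv_of_isOpen hO (m := ∞) (by simp)).contDiffAt (hO.mem_nhds hy')).differentiableAt
      (by simp)
  have hd : DifferentiableAt ℝ (chartForm I (f y) α) (ψ y) :=
    hα.1.differentiableAt_chartForm I (f y)
  have h1 : pullForm I f α =ᶠ[𝓝 y] fun z => (chartForm I (f y) α (ψ z)).comp (fderiv ℝ ψ z) := by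
    filter_upwards [hO.mem_nhds hy'] with z hz using pullForm_eq hΩ hf α (f y) hz
  have h2 := (hd.hasFDerivAt.comp y hψd.hasFDerivAt).clm_comp hψ2.hasFDerivAt
  have h3 : HasFDerivAt (pullForm I f α) _ y := HasFDerivAt.congr_of_eventuallyEq h2 h1
  have h4 := hα.2 (f y)
  rw [h3.fderiv]
  have h5 := h4 (fderiv ℝ ψ y u) (fderiv ℝ ψ y v)
  have h6 : extChartAt I (f y) (f y) = ψ y := rfl
  rw [h6] at h5
  simp [hsec u v, h5]

end PullBack

/-! ### Primitives of closed 1-forms -/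

section Primitives

variable {E H : Type*} [NormedAddCommGroup E] [NormedSpace ℝ E] [TopologicalSpace H]
  {I : ModelWithCorners ℝ E H}
  {M : Type*} [TopologicalSpace M] [ChartedSpace H M]
  {F : Type*} [NormedAddCommGroup F] [NormedSpace ℝ F]

/-- The function `u` is a primitive of the 1-form `α` on the set `S`. -/
def IsPrim (α : OneField I M) (S : Set M) (u : M → ℝ) : Prop :=
  ∀ x ∈ S, HasMFDerivAt I 𝓘(ℝ, ℝ) u x (α x)

namespace IsPrim

variable {α β : OneField I M} {S S' : Set M} {u w : M → ℝ}

theorem mono (h : IsPrim α S u) (hS : S' ⊆ S) : IsPrim α S' u := fun x hx => h x (hS hx)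

theorem congr (h : IsPrim α S u) (hS : IsOpen S) (huw : ∀ x ∈ S, w x = u x) : IsPrim α S w :=
  fun x hx => (h x hx).congr_of_eventuallyEq (by
    filter_upwards [hS.mem_nhds hx] with z hz using huw z hz)

theorem add (h : IsPrim α S u) (h' : IsPrim β S w) : IsPrim (α + β) S (fun x => u x + w x) :=
  fun x hx => (h x hx).add (h' x hx)

theorem sub (h : IsPrim α S u) (h' : IsPrim β S w) : IsPrim (α - β) S (fun x => u x - w x) :=
  fun x hx => (h x hx).sub (h' x hx)

theorem add_const (h : IsPrim α S u) (c : ℝ) : IsPrim α S (fun x => u x + c) := by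
  have : IsPrim (0 : OneField I M) S (fun _ => c) := fun x _ => hasMFDerivAt_const c x
  simpa using h.add this

theorem continuousAt (h : IsPrim α S u) {x : M} (hx : x ∈ S) : ContinuousAt u x :=
  (h x hx).continuousAt

/-- The derivative of a primitive along a map from a vector space. -/
theorem hasFDerivAt_comp (h : IsPrim α S u) {f : F → M} {y : F} (hy : f y ∈ S)
    (hf : MDifferentiableAt 𝓘(ℝ, F) I f y) :
    HasFDerivAt (fun z => u (f z)) (pullForm I f α y) y :=
  ((h (f y) hy).comp y hf.hasMFDerivAt).hasFDerivAt

end IsPrim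

theorem isPrim_d (f : SmoothFun I M) (S : Set M) : IsPrim (d I M f) S f := fun x _ =>
  (f.contMDiff.mdifferentiableAt (by simp)).hasMFDerivAt

theorem isPrim_univ_iff_d_eq {f : SmoothFun I M} {α : OneField I M} :
    IsPrim α univ f ↔ d I M f = α := by
  refine ⟨fun h => funext fun x => ?_, fun h => h ▸ isPrim_d f _⟩
  exact (h x (mem_univ x)).mfderiv

end Primitives

section Primitives

variable {E H : Type*} [NormedAddCommGroup E] [NormedSpace ℝ E] [TopologicalSpace H]
  {I : ModelWithCorners ℝ E H}
  {M : Type*} [TopologicalSpace M] [ChartedSpace H M]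
  {F : Type*} [NormedAddCommGroup F] [NormedSpace ℝ F]

/-- A function that is locally constant on a preconnected set is constant there. -/
theorem eq_of_isPreconnected {X Y : Type*} [TopologicalSpace X] {S : Set X} (hS : IsPreconnected S)
    {f : X → Y} (hf : ∀ x ∈ S, ∀ᶠ z in 𝓝[S] x, f z = f x) {x y : X} (hx : x ∈ S) (hy : y ∈ S) :
    f x = f y := by
  refine hS.induction₂ (fun a b => f a = f b) (fun a ha => ?_) ?_ ?_ hx hy
  · filter_upwards [hf a ha] with z hz using hz.symm
  · exact fun _ _ _ _ _ _ => Eq.trans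
  · exact fun _ _ _ _ => Eq.symm

variable [I.Boundaryless] [IsManifold I ∞ M]

theorem IsPrim.eventually_eq {S : Set M} (hS : IsOpen S) {u : M → ℝ}
    (hu : IsPrim (0 : OneField I M) S u) {x : M} (hx : x ∈ S) : ∀ᶠ z in 𝓝 x, u z = u x := by
  set f := (extChartAt I x).symm
  have hf := contMDiffOn_extChartAt_symm (I := I) (n := ∞) x
  have hO : IsOpen ((extChartAt I x).target ∩ f ⁻¹' S) :=
    hf.continuousOn.isOpen_inter_preimage (isOpen_extChartAt_target x) hS
  have hxO : extChartAt I x x ∈ (extChartAt I x).target ∩ f ⁻¹' S :=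
    ⟨mem_extChartAt_target x, by simpa [f] using hx⟩
  obtain ⟨ε, hε, hball⟩ := Metric.isOpen_iff.1 hO _ hxO
  have hd : ∀ y ∈ Metric.ball (extChartAt I x x) ε,
      HasFDerivAt (fun z => u (f z)) (0 : E →L[ℝ] ℝ) y := by
    intro y hy
    have h := hu.hasFDerivAt_comp (f := f) (hball hy).2
      ((hf.contMDiffAt ((isOpen_extChartAt_target x).mem_nhds (hball hy).1)).mdifferentiableAt
        (by simp))
    exact h
  have hc : ∀ y ∈ Metric.ball (extChartAt I x x) ε, u (f y) = u x := by
    intro y hy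
    have := (convex_ball (extChartAt I x x) ε).is_const_of_fderivWithin_eq_zero (𝕜 := ℝ)
      (f := fun z => u (f z)) (fun z hz => (hd z hz).differentiableAt.differentiableWithinAt)
      (fun z hz => by
        rw [fderivWithin_of_isOpen Metric.isOpen_ball hz, (hd z hz).fderiv])
      hy (Metric.mem_ball_self hε)
    simpa [f] using this
  filter_upwards [(continuousAt_extChartAt (I := I) x).preimage_mem_nhds
    (Metric.ball_mem_nhds _ hε), extChartAt_source_mem_nhds (I := I) x] with z hz hz'
  have := hc _ hz
  rwa [(extChartAt I x).left_inv hz'] at this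

theorem IsPrim.sub_eventually_eq {α : OneField I M} {S : Set M} (hS : IsOpen S) {u w : M → ℝ}
    (hu : IsPrim α S u) (hw : IsPrim α S w) {x : M} (hx : x ∈ S) :
    ∀ᶠ z in 𝓝 x, u z - w z = u x - w x := by
  have h := hu.sub hw
  rw [sub_self] at h
  exact h.eventually_eq hS hx

theorem IsPrim.sub_eq_of_isPreconnected {α : OneField I M} {S : Set M} (hS : IsOpen S)
    (hS' : IsPreconnected S) {u w : M → ℝ}
    (hu : IsPrim α S u) (hw : IsPrim α S w) {x y : M} (hx : x ∈ S) (hy : y ∈ S) :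
    u x - w x = u y - w y :=
  eq_of_isPreconnected (f := fun z => u z - w z) hS'
    (fun _ hz => (hu.sub_eventually_eq hS hw hz).filter_mono nhdsWithin_le_nhds) hx hy

theorem IsPrim.contMDiffOn [FiniteDimensional ℝ E] {α : OneField I M} (hα : IsSmoothForm α)
    {S : Set M} (hS : IsOpen S) {u : M → ℝ} (hu : IsPrim α S u) :
    ContMDiffOn I 𝓘(ℝ, ℝ) ∞ u S := by
  intro x hx
  set f := (extChartAt I x).symm
  have hf := contMDiffOn_extChartAt_symm (I := I) (n := ∞) x
  have hO : IsOpen ((extChartAt I x).target ∩ f ⁻¹' S) :=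
    hf.continuousOn.isOpen_inter_preimage (isOpen_extChartAt_target x) hS
  have hxO : extChartAt I x x ∈ (extChartAt I x).target ∩ f ⁻¹' S :=
    ⟨mem_extChartAt_target x, by simpa [f] using hx⟩
  have hd : ∀ y ∈ (extChartAt I x).target ∩ f ⁻¹' S,
      HasFDerivAt (fun z => u (f z)) (pullForm I f α y) y := fun y hy =>
    hu.hasFDerivAt_comp (f := f) hy.2
      ((hf.contMDiffAt ((isOpen_extChartAt_target x).mem_nhds hy.1)).mdifferentiableAt (by simp))
  have h1 : ContDiffOn ℝ ∞ (fun z => u (f z)) ((extChartAt I x).target ∩ f ⁻¹' S) := by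
    rw [contDiffOn_infty_iff_fderiv_of_isOpen hO]
    refine ⟨fun y hy => (hd y hy).differentiableAt.differentiableWithinAt, ?_⟩
    refine (contDiffOn_pullForm hO (hf.mono inter_subset_left) hα).congr fun y hy => ?_
    exact (hd y hy).fderiv
  have h2 : ContMDiffAt I 𝓘(ℝ, ℝ) ∞ ((fun z => u (f z)) ∘ extChartAt I x) x :=
    ContMDiffAt.comp x (h1.contDiffAt (hO.mem_nhds hxO)).contMDiffAt contMDiffAt_extChartAt
  refine (h2.congr_of_eventuallyEq ?_).contMDiffWithinAt
  filter_upwards [extChartAt_source_mem_nhds (I := I) x] with z hz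
  simp only [Function.comp_apply, f, (extChartAt I x).left_inv hz]

/-- A primitive of a smooth 1-form on the whole manifold, as a smooth function. -/
def IsPrim.toSmoothFun [FiniteDimensional ℝ E] {α : OneField I M} (hα : IsSmoothForm α)
    {u : M → ℝ} (hu : IsPrim α univ u) : SmoothFun I M :=
  ⟨u, contMDiffOn_univ.1 (hu.contMDiffOn hα isOpen_univ)⟩

theorem IsPrim.d_toSmoothFun [FiniteDimensional ℝ E] {α : OneField I M} (hα : IsSmoothForm α)
    {u : M → ℝ} (hu : IsPrim α univ u) : d I M (hu.toSmoothFun hα) = α :=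
  isPrim_univ_iff_d_eq.1 hu

/-- The Poincaré lemma, on the image of a convex set under a diffeomorphism from an open subset of
a vector space. -/
theorem exists_isPrim_image_convex [FiniteDimensional ℝ F] (e : OpenPartialHomeomorph F M)
    (he : ContMDiffOn 𝓘(ℝ, F) I ∞ e e.source) (he' : ContMDiffOn I 𝓘(ℝ, F) ∞ e.symm e.target)
    {C : Set F} (hC : Convex ℝ C) (hCo : IsOpen C) (hCe : C ⊆ e.source)
    {α : OneField I M} (hα : α ∈ closedForms I M) : ∃ u, IsPrim α (e '' C) u := by
  have h1 : DifferentiableOn ℝ (pullForm I e α) C :=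
    (contDiffOn_pullForm hCo (he.mono hCe) hα.1).differentiableOn (by simp)
  obtain ⟨w, hw⟩ := hC.exists_forall_hasFDerivAt_of_fderiv_symmetric hCo h1
    fun y hy a b => fderiv_pullForm_symm hCo (he.mono hCe) hα hy a b
  refine ⟨w ∘ e.symm, ?_⟩
  rintro _ ⟨y, hy, rfl⟩
  have hey : e.symm (e y) = y := e.left_inv (hCe hy)
  have h2' : HasFDerivAt w (pullForm I e α (e.symm (e y))) (e.symm (e y)) := by
    rw [hey]; exact hw y hy
  have h2 := h2'.hasMFDerivAt
  have h3 : MDifferentiableAt I 𝓘(ℝ, F) e.symm (e y) :=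
    (he'.contMDiffAt (e.open_target.mem_nhds (e.map_source (hCe hy)))).mdifferentiableAt (by simp)
  have h4 := h2.comp (e y) h3.hasMFDerivAt
  have h5 : MDifferentiableAt 𝓘(ℝ, F) I e (e.symm (e y)) := by
    rw [hey]
    exact (he.contMDiffAt (e.open_source.mem_nhds (hCe hy))).mdifferentiableAt (by simp)
  have h6 : (mfderiv 𝓘(ℝ, F) I e (e.symm (e y))).comp (mfderiv I 𝓘(ℝ, F) e.symm (e y)) =
      ContinuousLinearMap.id ℝ (TangentSpace I (e y)) := by
    rw [← mfderiv_comp (e y) h5 h3, ← mfderiv_id]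
    refine Filter.EventuallyEq.mfderiv_eq ?_
    filter_upwards [e.open_target.mem_nhds (e.map_source (hCe hy))] with z hz using e.right_inv hz
  refine h4.congr_mfderiv ?_
  ext v
  have h7 := congrArg (fun A => A v) h6
  have h8 : mfderiv 𝓘(ℝ, F) I e (e.symm (e y)) (mfderiv I 𝓘(ℝ, F) e.symm (e y) v) = v := h7
  change α (e (e.symm (e y))) (mfderiv 𝓘(ℝ, F) I e (e.symm (e y))
    (mfderiv I 𝓘(ℝ, F) e.symm (e y) v)) = α (e y) v
  have h9 : e (e.symm (e y)) = e y := by rw [hey]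
  rw [h9] at h8 ⊢
  exact congrArg (α (e y)) h8

end Primitives

/-! ### Tensor fields on a manifold in coordinates -/

section Bounds

variable {E H : Type*} [NormedAddCommGroup E] [NormedSpace ℝ E] [TopologicalSpace H]
  {I : ModelWithCorners ℝ E H}
  {M : Type*} [TopologicalSpace M] [ChartedSpace H M]
  {F : Type*} [NormedAddCommGroup F] [NormedSpace ℝ F]

variable (I) in
/-- The part of the target of the chart at `p` that corresponds to the set `O`. -/
def chartDom (O : Set M) (p : M) : Set E :=
  (extChartAt I p).target ∩ (extChartAt I p).symm ⁻¹' O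

/-- `T` is a smooth covariant tensor field on the set `O`, in all preferred charts. -/
def IsTensorField (O : Set M) {n : ℕ} (T : (x : M) → (Fin n → TangentSpace I x) → ℝ) : Prop :=
  ∀ p, IsTensorOn (chartDom I O p) (chartTensor I p T)

/-- `G` is a smooth field of symmetric nondegenerate bilinear forms on the set `O`, in all
preferred charts. -/
def IsMetricField (O : Set M) (G : (x : M) → TangentSpace I x →L[ℝ] TangentSpace I x →L[ℝ] ℝ) :
    Prop :=
  ∀ p, IsMetricOn (chartDom I O p) (chartMetric I p G)

theorem mem_chartDom {O : Set M} {p : M} (hp : p ∈ O) : extChartAt I p p ∈ chartDom I O p :=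
  ⟨mem_extChartAt_target p, by simpa using hp⟩

variable [I.Boundaryless]

theorem isOpen_chartDom {O : Set M} (hO : IsOpen O) (p : M) : IsOpen (chartDom I O p) :=
  (continuousOn_extChartAt_symm p).isOpen_inter_preimage (isOpen_extChartAt_target p) hO

/-- A bilinear form that is positive definite on a finite-dimensional space is nondegenerate. -/
theorem isInvertible_of_pos [FiniteDimensional ℝ E] {B : E →L[ℝ] E →L[ℝ] ℝ}
    (hB : ∀ v ≠ 0, 0 < B v v) : B.IsInvertible := by
  have hinj : Function.Injective B := by
    refine (injective_iff_map_eq_zero B).2 fun v hv => ?_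
    by_contra h
    have := hB v h
    simp [hv] at this
  have hdim : Module.finrank ℝ E = Module.finrank ℝ (E →L[ℝ] ℝ) := by
    have h1 : Module.finrank ℝ (E →ₗ[ℝ] ℝ) = Module.finrank ℝ E := Subspace.dual_finrank_eq
    rw [← h1]
    exact (LinearMap.toContinuousLinearMap (𝕜 := ℝ) (E := E) (F' := ℝ)).finrank_eq
  exact ⟨(LinearEquiv.ofInjectiveOfFinrankEq B.toLinearMap hinj hdim).toContinuousLinearEquiv, rfl⟩

variable [IsManifold I ∞ M]

/-- The bound on covariant derivatives may be checked after pulling back under a local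
diffeomorphism from a vector space. -/
theorem covDerivBound_iff_pull [FiniteDimensional ℝ E] [FiniteDimensional ℝ F] {O : Set M}
    (hO : IsOpen O)
    {G : (x : M) → TangentSpace I x →L[ℝ] TangentSpace I x →L[ℝ] ℝ} (hG : IsMetricField O G)
    {n : ℕ} {T : (x : M) → (Fin n → TangentSpace I x) → ℝ} (hT : IsTensorField O T)
    {Ω : Set F} (hΩ : IsOpen Ω) {f : F → M} (hf : ContMDiffOn 𝓘(ℝ, F) I ∞ f Ω)
    (hfO : MapsTo f Ω O)
    (hinv : ∀ y ∈ Ω, (mfderiv 𝓘(ℝ, F) I f y : F →L[ℝ] E).IsInvertible)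
    (k : ℕ) {y : F} (hy : y ∈ Ω) (c : ℝ) :
    CovDerivBound I G T k (f y) c ↔ ∀ v : Fin (n + k) → F,
      |iterCovDeriv (pullMet I f G) (pullField I f T) k y v| ≤
        c * ∏ i, √(pullMet I f G y (v i) (v i)) := by
  set p := f y with hp
  set ψ := extChartAt I p ∘ f with hψdef
  have hΩ' := isOpen_inter_preimage_chart_source hΩ hf p
  have hy' : y ∈ Ω ∩ f ⁻¹' (chartAt H p).source := ⟨hy, mem_chart_source H (f y)⟩
  have hψ := contMDiffOn_extChartAt_comp hf p
  have hm : MapsTo ψ (Ω ∩ f ⁻¹' (chartAt H p).source) (chartDom I O p) := by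
    intro z hz
    have hs : f z ∈ (extChartAt I p).source := by rw [extChartAt_source]; exact hz.2
    refine ⟨(extChartAt I p).map_source hs, ?_⟩
    change (extChartAt I p).symm (extChartAt I p (f z)) ∈ O
    rw [(extChartAt I p).left_inv hs]
    exact hfO hz.1
  have hinv' : ∀ z ∈ Ω ∩ f ⁻¹' (chartAt H p).source, (fderiv ℝ ψ z).IsInvertible := by
    intro z hz
    have h1 := mfderiv_eq_comp_extChartAt hΩ hf p hz
    obtain ⟨A, hA⟩ := hinv z hz.1
    have hA' : Function.Injective (mfderiv 𝓘(ℝ, F) I f z : F →L[ℝ] E) := by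
      rw [← hA]; exact A.injective
    have hinj : Function.Injective (fderiv ℝ ψ z) := by
      rw [h1] at hA'
      exact Function.Injective.of_comp (f := (mfderiv 𝓘(ℝ, E) I (extChartAt I p).symm
        (extChartAt I p (f z)) : E →L[ℝ] E)) hA'
    exact ⟨(LinearEquiv.ofInjectiveOfFinrankEq (fderiv ℝ ψ z).toLinearMap hinj
      A.toLinearEquiv.finrank_eq).toContinuousLinearEquiv, rfl⟩
  have h1 := iterCovDeriv_congr hΩ' (fun z hz => pullMet_eq hΩ hf G p hz)
    (fun z hz => pullField_eq hΩ hf T p hz) k y hy'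
  rw [h1, iterCovDeriv_pullTensor hΩ' (isOpen_chartDom hO p) (hG p) hψ hm hinv' (hT p) k y hy',
    pullMet_eq hΩ hf G p hy']
  obtain ⟨A, hA⟩ := hinv' y hy'
  simp only [pullTensor]
  constructor
  · exact fun h v => h fun i => fderiv ℝ ψ y (v i)
  · intro h v
    have h2 := h fun i => A.symm (v i)
    have h3 : ∀ w, fderiv ℝ (extChartAt I p ∘ f) y (A.symm w) = w := fun w => by
      rw [← hψdef, ← hA]; simp
    simp only [pullBilin, ContinuousLinearMap.bilinearComp_apply, h3] at h2
    exact h2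

end Bounds

section Bounds

variable {E H : Type*} [NormedAddCommGroup E] [NormedSpace ℝ E] [TopologicalSpace H]
  {I : ModelWithCorners ℝ E H}
  {M : Type*} [TopologicalSpace M] [ChartedSpace H M]
  {F : Type*} [NormedAddCommGroup F] [NormedSpace ℝ F]

theorem isTensorOn_linear {Ω : Set E} {A : E → E →L[ℝ] ℝ}
    (hA : ∀ v, ContDiffOn ℝ ∞ (fun y => A y v) Ω) :
    IsTensorOn Ω (fun y (v : Fin 1 → E) => A y (v 0)) := by
  refine ⟨fun v => hA _, fun y _ v i a b => ?_, fun y _ v i c a => ?_⟩ <;>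
  · obtain rfl : i = 0 := Subsingleton.elim _ _
    simp

theorem isTensorOn_bilinear {Ω : Set E} {B : E → E →L[ℝ] E →L[ℝ] ℝ}
    (hB : ∀ u v, ContDiffOn ℝ ∞ (fun y => B y u v) Ω) :
    IsTensorOn Ω (fun y (v : Fin 2 → E) => B y (v 0) (v 1)) := by
  refine ⟨fun v => hB _ _, fun y _ v i a b => ?_, fun y _ v i c a => ?_⟩ <;>
  · fin_cases i <;> simp

variable [I.Boundaryless] [IsManifold I ∞ M]

theorem mfderiv_extChartAt_symm_isInvertible (p : M) {y : E} (hy : y ∈ (extChartAt I p).target) :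
    (mfderiv 𝓘(ℝ, E) I (extChartAt I p).symm y : E →L[ℝ] E).IsInvertible := by
  have h1 : MDifferentiableAt 𝓘(ℝ, E) I (extChartAt I p).symm y :=
    ((contMDiffOn_extChartAt_symm (n := ∞) p).contMDiffAt
      ((isOpen_extChartAt_target p).mem_nhds hy)).mdifferentiableAt (by simp)
  have hs := (extChartAt I p).map_target hy
  have h2 : MDifferentiableAt I 𝓘(ℝ, E) (extChartAt I p) ((extChartAt I p).symm y) :=
    mdifferentiableAt_extChartAt (by rwa [← extChartAt_source I])
  have h3 : MDifferentiableAt 𝓘(ℝ, E) I (extChartAt I p).symm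
      (extChartAt I p ((extChartAt I p).symm y)) := by
    rwa [(extChartAt I p).right_inv hy]
  refine ContinuousLinearMap.IsInvertible.of_inverse
    (g := (mfderiv I 𝓘(ℝ, E) (extChartAt I p) ((extChartAt I p).symm y) : E →L[ℝ] E)) ?_ ?_
  · have h4 := mfderiv_comp ((extChartAt I p).symm y) h3 h2
    rw [(extChartAt I p).right_inv hy] at h4
    refine Eq.trans h4.symm ?_
    have h5 : (extChartAt I p).symm ∘ extChartAt I p =ᶠ[𝓝 ((extChartAt I p).symm y)] id := by
      filter_upwards [(isOpen_extChartAt_source p).mem_nhds hs] with z hz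
      exact (extChartAt I p).left_inv hz
    rw [h5.mfderiv_eq, mfderiv_id]
  · refine Eq.trans (mfderiv_comp y h2 h1).symm ?_
    have h5 : extChartAt I p ∘ (extChartAt I p).symm =ᶠ[𝓝 y] id := by
      filter_upwards [(isOpen_extChartAt_target p).mem_nhds hy] with z hz
      exact (extChartAt I p).right_inv hz
    rw [h5.mfderiv_eq, mfderiv_id]

theorem isTensorField_formTensor {α : OneField I M} (hα : IsSmoothForm α) :
    IsTensorField univ (formTensor I α) := fun p =>
  isTensorOn_linear (A := pullForm I (extChartAt I p).symm α) fun v =>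
    (contDiffOn_pullForm_apply (isOpen_extChartAt_target p)
      (contMDiffOn_extChartAt_symm p) hα v).mono
      inter_subset_left

theorem contDiffOn_comp_extChartAt_symm (f : SmoothFun I M) (p : M) :
    ContDiffOn ℝ ∞ (fun y => f ((extChartAt I p).symm y)) (extChartAt I p).target := by
  rw [← contMDiffOn_iff_contDiffOn]
  exact f.contMDiff.comp_contMDiffOn (contMDiffOn_extChartAt_symm p)

theorem isMetricOn_pullMet [FiniteDimensional ℝ F] {Ω : Set F} (hΩ : IsOpen Ω) {f : F → M}
    (hf : ContMDiffOn 𝓘(ℝ, F) I ∞ f Ω)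
    (hinj : ∀ y ∈ Ω, Function.Injective (mfderiv 𝓘(ℝ, F) I f y : F → E))
    (g : ContMDiffRiemannianMetric I ∞ E (fun x : M => TangentSpace I x)) :
    IsMetricOn Ω (pullMet I f g.inner) := by
  refine ⟨?_, fun y _ u v => g.symm _ _ _, fun y hy => isInvertible_of_pos fun v hv => ?_⟩
  · exact contDiffOn_clm_apply.2 fun u => contDiffOn_clm_apply.2 fun v =>
      contDiffOn_pullMet_apply hΩ hf g u v
  · refine g.pos (f y) _ fun h => hv (hinj y hy ?_)
    exact h.trans (map_zero (mfderiv 𝓘(ℝ, F) I f y)).symm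

theorem isMetricField_inner [FiniteDimensional ℝ E]
    (g : ContMDiffRiemannianMetric I ∞ E (fun x : M => TangentSpace I x)) :
    IsMetricField univ g.inner := fun p =>
  (isMetricOn_pullMet (isOpen_extChartAt_target p) (contMDiffOn_extChartAt_symm p)
    (fun _ hy => (mfderiv_extChartAt_symm_isInvertible p hy).injective) g).mono inter_subset_left

/-- The bound of order zero, in terms of tangent vectors. -/
theorem covDerivBound_zero_iff {G : (x : M) → TangentSpace I x →L[ℝ] TangentSpace I x →L[ℝ] ℝ}
    {n : ℕ} {T : (x : M) → (Fin n → TangentSpace I x) → ℝ} {p : M} {c : ℝ} :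
    CovDerivBound I G T 0 p c ↔
      ∀ v : Fin n → TangentSpace I p, |T p v| ≤ c * ∏ i, √(G p (v i) (v i)) := by
  let B : E →L[ℝ] E := mfderiv 𝓘(ℝ, E) I (extChartAt I p).symm (extChartAt I p p)
  have hB : B.IsInvertible :=
    mfderiv_extChartAt_symm_isInvertible (I := I) p (mem_extChartAt_target p)
  obtain ⟨A, hA⟩ := hB
  have hp : (extChartAt I p).symm (extChartAt I p p) = p := extChartAt_to_inv p
  have h1 : ∀ v : Fin n → E, chartTensor I p T (extChartAt I p p) v = T p (fun i => A (v i)) := by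
    intro v
    simp only [chartTensor]
    have : ∀ i, mfderiv 𝓘(ℝ, E) I (extChartAt I p).symm (extChartAt I p p) (v i) = A (v i) :=
      fun i => congrArg (fun B : E →L[ℝ] E => B (v i)) hA.symm
    simp only [this]
    rw [hp]
  have h2 : ∀ u v : E, chartMetric I p G (extChartAt I p p) u v = G p (A u) (A v) := by
    intro u v
    have : chartMetric I p G (extChartAt I p p) =
        pullBilin (V := E) (W := E) (G ((extChartAt I p).symm (extChartAt I p p))) A := by
      rw [chartMetric]
      exact congrArg _ hA.symm
    rw [this, hp]
    rfl
  change (∀ v : Fin n → E, |chartTensor I p T (extChartAt I p p) v| ≤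
    c * ∏ i, √(chartMetric I p G (extChartAt I p p) (v i) (v i))) ↔ _
  simp only [h1, h2]
  constructor
  · intro h v
    obtain ⟨w, rfl⟩ : ∃ w : Fin n → E, v = fun i => A (w i) :=
      ⟨fun i => A.symm (v i), funext fun i => (A.apply_symm_apply (v i)).symm⟩
    exact h w
  · exact fun h v => h _

theorem CovDerivBound.mono {G : (x : M) → TangentSpace I x →L[ℝ] TangentSpace I x →L[ℝ] ℝ}
    {n : ℕ} {T : (x : M) → (Fin n → TangentSpace I x) → ℝ} {k : ℕ} {p : M} {c c' : ℝ}
    (h : CovDerivBound I G T k p c) (hc : c ≤ c') : CovDerivBound I G T k p c' := fun v =>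
  (h v).trans (by gcongr)

theorem CovDerivBound.add [FiniteDimensional ℝ E]
    {G : (x : M) → TangentSpace I x →L[ℝ] TangentSpace I x →L[ℝ] ℝ}
    (hG : IsMetricField univ G)
    {n : ℕ} {T S : (x : M) → (Fin n → TangentSpace I x) → ℝ} (hT : IsTensorField univ T)
    (hS : IsTensorField univ S) {k : ℕ} {p : M} {c c' : ℝ}
    (h : CovDerivBound I G T k p c) (h' : CovDerivBound I G S k p c') :
    CovDerivBound I G (fun x v => T x v + S x v) k p (c + c') := by
  intro v
  have h1 := iterCovDeriv_add (isOpen_chartDom isOpen_univ p) (hG p) (hT p) (hS p) k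
    (extChartAt I p p) (mem_chartDom (mem_univ p)) v
  have h2 : chartTensor I p (fun x v => T x v + S x v) = fun y v =>
    chartTensor I p T y v + chartTensor I p S y v := rfl
  rw [h2, h1, add_mul]
  exact (abs_add_le _ _).trans (add_le_add (h v) (h' v))

/-- The bound at a point depends only on the tensor field near this point. -/
theorem CovDerivBound.congr_field {G : (x : M) → TangentSpace I x →L[ℝ] TangentSpace I x →L[ℝ] ℝ}
    {n : ℕ} {T S : (x : M) → (Fin n → TangentSpace I x) → ℝ} {k : ℕ} {p : M} {c : ℝ}
    (h : CovDerivBound I G T k p c) {O : Set M} (hO : IsOpen O) (hp : p ∈ O)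
    (hTS : ∀ x ∈ O, S x = T x) : CovDerivBound I G S k p c := by
  intro v
  have h1 := iterCovDeriv_congr (isOpen_chartDom hO p) (G := chartMetric I p G)
    (G' := chartMetric I p G) (fun _ _ => rfl) (T := chartTensor I p S) (T' := chartTensor I p T)
    (fun y hy => by funext w; simp only [chartTensor]; rw [hTS _ hy.2]) k
    (extChartAt I p p) (mem_chartDom hp)
  rw [h1]
  exact h v

theorem covDeriv_zero {G : E → E →L[ℝ] E →L[ℝ] ℝ} {n : ℕ} :
    covDeriv G (fun _ (_ : Fin n → E) => 0) = fun _ _ => 0 := by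
  funext y v
  simp [covDeriv]

theorem covDerivBound_zero_field
    {G : (x : M) → TangentSpace I x →L[ℝ] TangentSpace I x →L[ℝ] ℝ} {n : ℕ} (k : ℕ) (p : M)
    {c : ℝ} (hc : 0 ≤ c) :
    CovDerivBound I G (fun x (_ : Fin n → TangentSpace I x) => 0) k p c := by
  intro v
  have h : ∀ k, iterCovDeriv (chartMetric I p G) (chartTensor I p
      (fun x (_ : Fin n → TangentSpace I x) => 0)) k = fun _ _ => 0 := by
    intro k
    induction k with
    | zero => rfl
    | succ k ih =>
      rw [iterCovDeriv, ih]
      exact covDeriv_zero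
  rw [h]
  simpa using mul_nonneg hc (Finset.prod_nonneg fun _ _ => Real.sqrt_nonneg _)

theorem covDeriv_chartTensor_funTensor (f : SmoothFun I M) (p : M)
    (G : E → E →L[ℝ] E →L[ℝ] ℝ) {y : E} (hy : y ∈ (extChartAt I p).target) :
    covDeriv G (chartTensor I p (funTensor I f)) y =
      chartTensor I p (formTensor I (d I M f)) y := by
  funext v
  have h1 := (isPrim_d f univ).hasFDerivAt_comp (f := (extChartAt I p).symm) (y := y) (mem_univ _)
    (((contMDiffOn_extChartAt_symm (n := ∞) p).contMDiffAt
      ((isOpen_extChartAt_target p).mem_nhds hy)).mdifferentiableAt (by simp))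
  have h2 : fderiv ℝ (fun z => chartTensor I p (funTensor I f) z (Fin.tail v)) y =
    pullForm I (extChartAt I p).symm (d I M f) y := h1.fderiv
  simp only [covDeriv, h2, Finset.univ_eq_empty, Finset.sum_empty, sub_zero]
  rfl

/-- `∇^(k+1) f = ∇^k df`. -/
theorem covDerivBound_funTensor_succ_iff
    {G : (x : M) → TangentSpace I x →L[ℝ] TangentSpace I x →L[ℝ] ℝ} (f : SmoothFun I M)
    (k : ℕ) (p : M) (c : ℝ) : CovDerivBound I G (funTensor I f) (k + 1) p c ↔
      CovDerivBound I G (formTensor I (d I M f)) k p c := by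
  have h1 : ∀ v, iterCovDeriv (chartMetric I p G) (chartTensor I p (funTensor I f)) (k + 1)
      (extChartAt I p p) v = iterCovDeriv (chartMetric I p G)
        (chartTensor I p (formTensor I (d I M f))) k (extChartAt I p p)
          (v ∘ Fin.cast (by omega)) := by
    intro v
    rw [iterCovDeriv_succ_eq]
    exact congrFun (iterCovDeriv_congr (isOpen_extChartAt_target p) (fun _ _ => rfl)
      (fun y hy => covDeriv_chartTensor_funTensor f p _ hy) k _ (mem_extChartAt_target p)) _
  have e : 0 + (k + 1) = 1 + k := by omega
  have h2 : ∀ v : Fin (0 + (k + 1)) → E,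
      ∏ i, √(chartMetric I p G (extChartAt I p p) (v i) (v i)) =
      ∏ i : Fin (1 + k), √(chartMetric I p G (extChartAt I p p)
        ((v ∘ Fin.cast e.symm) i) ((v ∘ Fin.cast e.symm) i)) := fun v =>
    Fintype.prod_equiv (finCongr e) _ _ fun i => rfl
  constructor
  · intro h v
    have := h (v ∘ Fin.cast e)
    rw [h1, h2] at this
    exact this
  · intro h v
    rw [h1, h2]
    exact h _

end Bounds

/-! ### Weighted spaces -/

namespace CSACManifold

variable {m s l : ℕ}
  {L : Type*} [TopologicalSpace L] [ChartedSpace (Model m) L] [IsManifold (𝓡 m) ∞ L]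
  {Λ : Fin s ⊕ Fin l → Type*} [∀ i, TopologicalSpace (Λ i)]
  [∀ i, ChartedSpace (Model (m - 1)) (Λ i)] [∀ i, IsManifold (𝓡 (m - 1)) ∞ (Λ i)]
  (X : CSACManifold m s l L Λ) {β : Fin s ⊕ Fin l → ℝ}

theorem eventually_endFilter_openRange {a : ℝ} (ha : 0 < a) (i : Fin s ⊕ Fin l) :
    ∀ᶠ r in endFilter i, r ∈ openRange a i := by
  rcases i with i | i
  · exact Ioo_mem_nhdsGT ha
  · exact Ioi_mem_atTop a

theorem openRange_subset_closedRange (a : ℝ) (i : Fin s ⊕ Fin l) :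
    openRange a i ⊆ closedRange a i := by
  rcases i with i | i
  · exact Ioo_subset_Ioc_self
  · exact Ioi_subset_Ici_self

theorem isOpen_openRange (a : ℝ) (i : Fin s ⊕ Fin l) : IsOpen (openRange a i) := by
  rcases i with i | i
  · exact isOpen_Ioo
  · exact isOpen_Ioi

theorem isOpen_endSet (i : Fin s ⊕ Fin l) : IsOpen (X.endSet i) :=
  (X.φ i).isOpen_image_of_subset_source (isOpen_univ.prod (isOpen_openRange _ i))
    ((prod_mono_right (openRange_subset_closedRange _ i)).trans (X.range_source i))

theorem mem_endSet {i : Fin s ⊕ Fin l} {r : ℝ} (hr : r ∈ openRange (X.a i) i) (θ : Λ i) :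
    X.φ i (θ, r) ∈ X.endSet i := ⟨(θ, r), ⟨mem_univ _, hr⟩, rfl⟩

variable {X}

theorem IsWeighted.add {n : ℕ} {T S : (x : L) → (Fin n → TangentSpace (𝓡 m) x) → ℝ}
    (hT : X.IsWeighted β T) (hS : X.IsWeighted β S) (hT' : IsTensorField univ T)
    (hS' : IsTensorField univ S) : X.IsWeighted β (fun x v => T x v + S x v) := by
  intro i k
  obtain ⟨C, hC⟩ := hT i k
  obtain ⟨D, hD⟩ := hS i k
  refine ⟨C + D, ?_⟩
  filter_upwards [hC, hD] with r h1 h2 θ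
  rw [add_mul]
  exact (h1 θ).add (isMetricField_inner X.g) hT' hS' (h2 θ)

theorem IsWeighted.congr {n : ℕ} {T S : (x : L) → (Fin n → TangentSpace (𝓡 m) x) → ℝ}
    (hT : X.IsWeighted β T) (h : ∀ i, ∀ x ∈ X.endSet i, S x = T x) : X.IsWeighted β S := by
  intro i k
  obtain ⟨C, hC⟩ := hT i k
  refine ⟨C, ?_⟩
  filter_upwards [hC, eventually_endFilter_openRange (X.a_pos i) i] with r h1 h2 θ
  exact (h1 θ).congr_field (X.isOpen_endSet i) (X.mem_endSet h2 θ) (h i)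

/-- A function lies in the weighted space `C^∞_β` if and only if it is `O(r^β)` and its
differential lies in `C^∞_{β-1}`. -/
theorem mem_weightedFun_iff {f : SmoothFun (𝓡 m) L} : f ∈ X.weightedFun β ↔
    (∀ i, ∃ C : ℝ, ∀ᶠ r in endFilter i, ∀ θ, |f (X.φ i (θ, r))| ≤ C * r ^ β i) ∧
      X.IsWeighted (fun i => β i - 1) (formTensor (𝓡 m) (d (𝓡 m) L f)) := by
  have h0 : ∀ (i : Fin s ⊕ Fin l) (r : ℝ) (θ : Λ i) (c : ℝ),
      CovDerivBound (𝓡 m) X.g.inner (funTensor (𝓡 m) f) 0 (X.φ i (θ, r)) c ↔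
      |f (X.φ i (θ, r))| ≤ c := by
    intro i r θ c
    rw [covDerivBound_zero_iff]
    simp [funTensor]
  constructor
  · intro h
    refine ⟨fun i => ?_, fun i k => ?_⟩
    · obtain ⟨C, hC⟩ := h i 0
      refine ⟨C, ?_⟩
      filter_upwards [hC] with r hr θ
      have := (h0 _ _ _ _).1 (hr θ)
      simpa using this
    · obtain ⟨C, hC⟩ := h i (k + 1)
      refine ⟨C, ?_⟩
      filter_upwards [hC] with r hr θ
      have := (covDerivBound_funTensor_succ_iff _ _ _ _).1 (hr θ)
      convert this using 3
      push_cast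
      ring
  · rintro ⟨h1, h2⟩ i k
    rcases k with _ | k
    · obtain ⟨C, hC⟩ := h1 i
      refine ⟨C, ?_⟩
      filter_upwards [hC] with r hr θ
      rw [h0]
      simpa using hr θ
    · obtain ⟨C, hC⟩ := h2 i k
      refine ⟨C, ?_⟩
      filter_upwards [hC] with r hr θ
      rw [covDerivBound_funTensor_succ_iff]
      convert hr θ using 3
      push_cast
      ring

end CSACManifold

/-! ### The conical metric -/

section Cone

variable {k : ℕ} {Λ : Type*} [TopologicalSpace Λ] [ChartedSpace (Model k) Λ]
  {W : Type*} [NormedAddCommGroup W] [NormedSpace ℝ W]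

/-- The conical metric on the velocity vectors of a map into `Λ × ℝ`. -/
theorem coneMetric_mfderiv
    (g' : (θ : Λ) → TangentSpace (𝓡 k) θ →L[ℝ] TangentSpace (𝓡 k) θ →L[ℝ] ℝ)
    {f : W → Λ × ℝ} {y : W} (hf : MDifferentiableAt 𝓘(ℝ, W) (coneModel k) f y) (u v : W) :
    coneMetric g' (f y) (mfderiv 𝓘(ℝ, W) (coneModel k) f y u)
        (mfderiv 𝓘(ℝ, W) (coneModel k) f y v) =
      fderiv ℝ (fun y => (f y).2) y u * fderiv ℝ (fun y => (f y).2) y v +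
        (f y).2 ^ 2 * pullMet (𝓡 k) (fun y => (f y).1) g' y u v := by
  have h1 : ∀ w, mfderiv (coneModel k) 𝓘(ℝ, ℝ) Prod.snd (f y)
      (mfderiv 𝓘(ℝ, W) (coneModel k) f y w) = fderiv ℝ (fun y => (f y).2) y w := by
    intro w
    have := mfderiv_comp y (mdifferentiableAt_snd (I := 𝓡 k) (I' := 𝓘(ℝ, ℝ)) (x := f y)) hf
    rw [← mfderiv_eq_fderiv]
    exact (congrArg (fun A => A w) this).symm
  have h2 : ∀ w, mfderiv (coneModel k) (𝓡 k) Prod.fst (f y)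
      (mfderiv 𝓘(ℝ, W) (coneModel k) f y w) =
        mfderiv 𝓘(ℝ, W) (𝓡 k) (fun y => (f y).1) y w := by
    intro w
    have := mfderiv_comp y (mdifferentiableAt_fst (I := 𝓡 k) (I' := 𝓘(ℝ, ℝ)) (x := f y)) hf
    exact (congrArg (fun A => A w) this).symm
  have h3 : ∀ a b : Model k × ℝ, coneMetric g' (f y) a b =
      HMul.hMul (α := ℝ) (β := ℝ) (mfderiv (coneModel k) 𝓘(ℝ, ℝ) Prod.snd (f y) a)
        (mfderiv (coneModel k) 𝓘(ℝ, ℝ) Prod.snd (f y) b) +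
      (f y).2 ^ 2 * g' (f y).1 (mfderiv (coneModel k) (𝓡 k) Prod.fst (f y) a)
        (mfderiv (coneModel k) (𝓡 k) Prod.fst (f y) b) := fun a b => rfl
  exact (h3 _ _).trans (congrArg₂ (fun a b : ℝ => a + b)
    (congrArg₂ (fun a b : ℝ => a * b) (h1 u) (h1 v))
    (congrArg₂ (fun a b : TangentSpace (𝓡 k) (f y).1 => (f y).2 ^ 2 * g' (f y).1 a b)
      (h2 u) (h2 v)))

end Cone

namespace CSACManifold

variable {m s l : ℕ}
  {L : Type*} [TopologicalSpace L] [ChartedSpace (Model m) L] [IsManifold (𝓡 m) ∞ L]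
  {Λ : Fin s ⊕ Fin l → Type*} [∀ i, TopologicalSpace (Λ i)]
  [∀ i, ChartedSpace (Model (m - 1)) (Λ i)] [∀ i, IsManifold (𝓡 (m - 1)) ∞ (Λ i)]
  (X : CSACManifold m s l L Λ)

/-! ### The geometry of the ends -/

/-- The function `r ^ β` tends to zero along the end with index `i`. -/
def Decays (i : Fin s ⊕ Fin l) (β : ℝ) : Prop :=
  Sum.elim (fun _ => 0 < β) (fun _ => β < 0) i

theorem Decays.tendsto {i : Fin s ⊕ Fin l} {β : ℝ} (h : Decays i β) :
    Tendsto (fun r : ℝ => r ^ β) (endFilter i) (𝓝 0) := by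
  rcases i with i | i
  · have h' : (0 : ℝ) < β := h
    have := (Real.continuousAt_rpow_const 0 β (Or.inr h'.le)).tendsto
    rw [Real.zero_rpow h'.ne'] at this
    exact this.mono_left nhdsWithin_le_nhds
  · have h' : β < 0 := h
    have := tendsto_rpow_neg_atTop (y := -β) (by linarith)
    simpa using! this

theorem Decays.ne_zero {i : Fin s ⊕ Fin l} {β : ℝ} (h : Decays i β) : β ≠ 0 := by
  rcases i with i | i
  · exact ne_of_gt h
  · exact ne_of_lt h

theorem decays_ν (i : Fin s ⊕ Fin l) : Decays i (X.ν i) := by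
  rcases i with i | i
  · exact X.ν_pos i
  · exact X.ν_neg i

instance endFilter_neBot (i : Fin s ⊕ Fin l) : (endFilter i).NeBot := by
  rcases i with i | i
  · exact (inferInstance : (𝓝[>] (0 : ℝ)).NeBot)
  · exact (inferInstance : (atTop : Filter ℝ).NeBot)

theorem openRange_pos {b : ℝ} (hb : 0 < b) {i : Fin s ⊕ Fin l} {r : ℝ} (hr : r ∈ openRange b i) :
    0 < r := by
  rcases i with i | i
  · have hr' : r ∈ Ioo 0 b := hr
    exact hr'.1
  · have hr' : b < r := hr
    linarith

theorem convex_openRange (b : ℝ) (i : Fin s ⊕ Fin l) : Convex ℝ (openRange b i) := by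
  rcases i with i | i
  · exact convex_Ioo 0 b
  · exact convex_Ioi b

theorem mem_closedRange_self {a : ℝ} (ha : 0 < a) (i : Fin s ⊕ Fin l) : a ∈ closedRange a i := by
  rcases i with i | i
  · exact (⟨ha, le_rfl⟩ : a ∈ Ioc 0 a)
  · exact (le_rfl : a ≤ a)

/-- A property that holds eventually along an end holds on a smaller end. -/
theorem exists_openRange_of_eventually {i : Fin s ⊕ Fin l} {p : ℝ → Prop}
    (h : ∀ᶠ r in endFilter i, p r) {a : ℝ} (ha : 0 < a) :
    ∃ r₀ > 0, openRange r₀ i ⊆ openRange a i ∧ ∀ r ∈ openRange r₀ i, p r := by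
  rcases i with i | i
  · obtain ⟨c, hc, h'⟩ := mem_nhdsGT_iff_exists_Ioo_subset.1 h
    exact ⟨min a c, lt_min ha hc, Ioo_subset_Ioo_right (min_le_left _ _),
      fun r hr => h' ⟨hr.1, hr.2.trans_le (min_le_right _ _)⟩⟩
  · obtain ⟨c, h'⟩ := eventually_atTop.1 h
    exact ⟨max a c, lt_max_of_lt_left ha, Ioi_subset_Ioi (le_max_left _ _),
      fun r hr => h' r ((le_max_right a c).trans (le_of_lt hr))⟩

section Collar

variable [∀ i, CompactSpace (Λ i)]

/-- The parametrization of an end is defined on a slightly larger range of radii. -/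
theorem exists_collar (i : Fin s ⊕ Fin l) : ∃ b, 0 < b ∧
    closedRange (X.a i) i ⊆ openRange b i ∧ univ ×ˢ openRange b i ⊆ (X.φ i).source := by
  have hsub : (univ : Set (Λ i)) ×ˢ {X.a i} ⊆ (X.φ i).source :=
    (prod_mono_right (singleton_subset_iff.2 (mem_closedRange_self (X.a_pos i) i))).trans
      (X.range_source i)
  obtain ⟨u, v, -, hv, hu', hv', huv⟩ := generalized_tube_lemma isCompact_univ isCompact_singleton
    (X.φ i).open_source hsub
  obtain ⟨δ, hδ, hδv⟩ := Metric.isOpen_iff.1 hv _ (hv' rfl)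
  have hball : ∀ (θ : Λ i) (r : ℝ), |r - X.a i| < δ → (θ, r) ∈ (X.φ i).source := fun θ r hr =>
    huv ⟨hu' (mem_univ θ), hδv (by simpa [Real.dist_eq] using hr)⟩
  have ha := X.a_pos i
  have hsrc := X.range_source i
  rcases i with i | i
  · refine ⟨X.a (Sum.inl i) + δ, by positivity, fun r hr => ⟨hr.1, by linarith [hr.2]⟩, ?_⟩
    rintro ⟨θ, r⟩ ⟨-, hr⟩
    by_cases h : r ≤ X.a (Sum.inl i)
    · exact hsrc ⟨mem_univ _, hr.1, h⟩
    · exact hball θ r (by rw [abs_lt]; constructor <;> linarith [hr.2])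
  · refine ⟨max (X.a (Sum.inr i) - δ) (X.a (Sum.inr i) / 2), lt_max_of_lt_right (by positivity),
      fun r hr => ?_, ?_⟩
    · have hr' : X.a (Sum.inr i) ≤ r := hr
      show max (X.a (Sum.inr i) - δ) (X.a (Sum.inr i) / 2) < r
      exact max_lt (by linarith) (by linarith)
    · rintro ⟨θ, r⟩ ⟨-, hr⟩
      have hr' : max (X.a (Sum.inr i) - δ) (X.a (Sum.inr i) / 2) < r := hr
      by_cases h : X.a (Sum.inr i) ≤ r
      · exact hsrc ⟨mem_univ _, h⟩
      · exact hball θ r (by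
          rw [abs_lt]; constructor <;> linarith [(le_max_left _ _).trans_lt hr'])

/-- The radius of an open end that contains the closed end. -/
def b (i : Fin s ⊕ Fin l) : ℝ := (X.exists_collar i).choose

theorem closedRange_subset (i : Fin s ⊕ Fin l) : closedRange (X.a i) i ⊆ openRange (X.b i) i :=
  (X.exists_collar i).choose_spec.2.1

theorem openRange_subset (i : Fin s ⊕ Fin l) : openRange (X.a i) i ⊆ openRange (X.b i) i :=
  (openRange_subset_closedRange _ _).trans (X.closedRange_subset i)

theorem a_mem (i : Fin s ⊕ Fin l) : X.a i ∈ openRange (X.b i) i :=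
  X.closedRange_subset i (mem_closedRange_self (X.a_pos i) i)

theorem mem_source {i : Fin s ⊕ Fin l} (θ : Λ i) {r : ℝ} (hr : r ∈ openRange (X.b i) i) :
    (θ, r) ∈ (X.φ i).source :=
  (X.exists_collar i).choose_spec.2.2 ⟨mem_univ _, hr⟩

/-- The part of the extended end that lies over the subset `U` of the link. -/
def sector (i : Fin s ⊕ Fin l) (U : Set (Λ i)) : Set L := X.φ i '' (U ×ˢ openRange (X.b i) i)

theorem isOpen_sector (i : Fin s ⊕ Fin l) {U : Set (Λ i)} (hU : IsOpen U) :
    IsOpen (X.sector i U) :=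
  (X.φ i).isOpen_image_of_subset_source (hU.prod (isOpen_openRange _ i))
    fun q hq => X.mem_source q.1 hq.2

theorem mem_sector {i : Fin s ⊕ Fin l} {U : Set (Λ i)} {θ : Λ i} (hθ : θ ∈ U) {r : ℝ}
    (hr : r ∈ openRange (X.b i) i) : X.φ i (θ, r) ∈ X.sector i U := ⟨(θ, r), ⟨hθ, hr⟩, rfl⟩

theorem symm_φ {i : Fin s ⊕ Fin l} (θ : Λ i) {r : ℝ} (hr : r ∈ openRange (X.b i) i) :
    (X.φ i).symm (X.φ i (θ, r)) = (θ, r) := (X.φ i).left_inv (X.mem_source θ hr)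

theorem mdifferentiableAt_φ {i : Fin s ⊕ Fin l} (θ : Λ i) {r : ℝ} (hr : r ∈ openRange (X.b i) i) :
    MDifferentiableAt (coneModel (m - 1)) (𝓡 m) (X.φ i) (θ, r) :=
  ((X.contMDiffOn_φ i).contMDiffAt
    ((X.φ i).open_source.mem_nhds (X.mem_source θ hr))).mdifferentiableAt (by simp)

/-- The parametrization of the extended end, in the chart of the link at `θ₀`. -/
def endChart (i : Fin s ⊕ Fin l) (θ₀ : Λ i) : OpenPartialHomeomorph (Model (m - 1) × ℝ) L :=
  ((chartAt (Model (m - 1)) θ₀).prod (OpenPartialHomeomorph.refl ℝ)).symm.trans (X.φ i)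

theorem endChart_apply (i : Fin s ⊕ Fin l) (θ₀ : Λ i) (y : Model (m - 1) × ℝ) :
    X.endChart i θ₀ y = X.φ i ((chartAt (Model (m - 1)) θ₀).symm y.1, y.2) := rfl

theorem mem_endChart_source {i : Fin s ⊕ Fin l} {θ₀ : Λ i} {y : Model (m - 1) × ℝ} :
    y ∈ (X.endChart i θ₀).source ↔ y.1 ∈ (chartAt (Model (m - 1)) θ₀).target ∧
      ((chartAt (Model (m - 1)) θ₀).symm y.1, y.2) ∈ (X.φ i).source := by
  simp [endChart]

theorem contMDiffOn_prodChart_symm (i : Fin s ⊕ Fin l) (θ₀ : Λ i) :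
    ContMDiffOn 𝓘(ℝ, Model (m - 1) × ℝ) (coneModel (m - 1)) ∞
      (fun y : Model (m - 1) × ℝ => ((chartAt (Model (m - 1)) θ₀).symm y.1, y.2))
      ((chartAt (Model (m - 1)) θ₀).target ×ˢ univ) := by
  refine ContMDiffOn.prodMk ?_ contDiff_snd.contMDiff.contMDiffOn
  exact (contMDiffOn_chart_symm (I := 𝓡 (m - 1)) (n := ∞) (x := θ₀)).comp
    (contDiff_fst.contMDiff (n := ∞)).contMDiffOn fun y hy => hy.1

theorem contMDiffOn_endChart (i : Fin s ⊕ Fin l) (θ₀ : Λ i) :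
    ContMDiffOn 𝓘(ℝ, Model (m - 1) × ℝ) (𝓡 m) ∞ (X.endChart i θ₀) (X.endChart i θ₀).source :=
  (X.contMDiffOn_φ i).comp ((contMDiffOn_prodChart_symm i θ₀).mono fun _ hy =>
    ⟨(X.mem_endChart_source.1 hy).1, mem_univ _⟩) fun _ hy => (X.mem_endChart_source.1 hy).2

theorem contMDiffOn_endChart_symm (i : Fin s ⊕ Fin l) (θ₀ : Λ i) :
    ContMDiffOn (𝓡 m) 𝓘(ℝ, Model (m - 1) × ℝ) ∞ (X.endChart i θ₀).symm
      (X.endChart i θ₀).target := by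
  have h1 : (X.endChart i θ₀).target ⊆ (X.φ i).target := by
    intro x hx
    rw [endChart, OpenPartialHomeomorph.trans_target] at hx
    exact hx.1
  have h2 : ∀ x ∈ (X.endChart i θ₀).target,
      ((X.φ i).symm x).1 ∈ (chartAt (Model (m - 1)) θ₀).source := by
    intro x hx
    rw [endChart, OpenPartialHomeomorph.trans_target] at hx
    have := hx.2
    simp at this
    exact this
  have h3 := (X.contMDiffOn_symm i).mono h1
  have h4 : ContMDiffOn (𝓡 m) 𝓘(ℝ, Model (m - 1)) ∞
      (fun x => chartAt (Model (m - 1)) θ₀ ((X.φ i).symm x).1) (X.endChart i θ₀).target :=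
    (contMDiffOn_chart (I := 𝓡 (m - 1)) (n := ∞) (x := θ₀)).comp
      (contMDiff_fst.comp_contMDiffOn h3) h2
  exact h4.prodMk_space (contMDiff_snd.comp_contMDiffOn h3)

/-- A closed 1-form has a primitive on a sector of the extended end, over a neighbourhood of any
point of the link. -/
theorem exists_isPrim_sector {α : OneField (𝓡 m) L} (hα : α ∈ closedForms (𝓡 m) L)
    (i : Fin s ⊕ Fin l) (θ₀ : Λ i) :
    ∃ U : Set (Λ i), IsOpen U ∧ θ₀ ∈ U ∧ ∃ u, IsPrim α (X.sector i U) u := by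
  set c := chartAt (Model (m - 1)) θ₀
  obtain ⟨ε, hε, hball⟩ := Metric.isOpen_iff.1 c.open_target _ (mem_chart_target _ θ₀)
  have hC : Metric.ball (c θ₀) ε ×ˢ openRange (X.b i) i ⊆ (X.endChart i θ₀).source :=
    fun y hy => X.mem_endChart_source.2 ⟨hball hy.1, X.mem_source _ hy.2⟩
  obtain ⟨u, hu⟩ := exists_isPrim_image_convex (X.endChart i θ₀) (X.contMDiffOn_endChart i θ₀)
    (X.contMDiffOn_endChart_symm i θ₀) ((convex_ball _ _).prod (convex_openRange _ i))
    (Metric.isOpen_ball.prod (isOpen_openRange _ i)) hC hα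
  refine ⟨c.source ∩ c ⁻¹' Metric.ball (c θ₀) ε, c.continuousOn.isOpen_inter_preimage c.open_source
    Metric.isOpen_ball, ⟨mem_chart_source _ θ₀, Metric.mem_ball_self hε⟩, u, hu.mono ?_⟩
  rintro _ ⟨⟨θ, r⟩, ⟨hθ, hr⟩, rfl⟩
  refine ⟨(c θ, r), ⟨hθ.2, hr⟩, ?_⟩
  rw [endChart_apply]
  simp only [c, c.left_inv hθ.1]

end Collar

/-- On a small end the metric is uniformly equivalent to the conical metric. -/
theorem metric_compare (i : Fin s ⊕ Fin l) : ∀ᶠ r in endFilter i, ∀ (θ : Λ i)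
    (v : TangentSpace (coneModel (m - 1)) (θ, r)),
      coneMetric (X.g' i).inner (θ, r) v v / 4 ≤ pullMetric (X.φ i) X.g.inner (θ, r) v v ∧
      pullMetric (X.φ i) X.g.inner (θ, r) v v ≤ 4 * coneMetric (X.g' i).inner (θ, r) v v := by
  obtain ⟨C, hC⟩ := X.asymptotic i 0
  have h1 : Tendsto (fun r : ℝ => C * r ^ X.ν i) (endFilter i) (𝓝 (C * 0)) :=
    (X.decays_ν i).tendsto.const_mul C
  rw [mul_zero] at h1
  filter_upwards [hC, h1.eventually_lt_const (show (0 : ℝ) < 1 / 2 by norm_num)] with r hr hr' θ v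
  have h2 := covDerivBound_zero_iff.1 (hr θ) (fun _ => v)
  have h3 : 0 ≤ coneMetric (X.g' i).inner (θ, r) v v := by
    have h4 : coneMetric (X.g' i).inner (θ, r) v v =
      HMul.hMul (α := ℝ) (β := ℝ) (mfderiv (coneModel (m - 1)) 𝓘(ℝ, ℝ) Prod.snd (θ, r) v)
        (mfderiv (coneModel (m - 1)) 𝓘(ℝ, ℝ) Prod.snd (θ, r) v) +
      r ^ 2 * (X.g' i).inner θ (mfderiv (coneModel (m - 1)) (𝓡 (m - 1)) Prod.fst (θ, r) v)
        (mfderiv (coneModel (m - 1)) (𝓡 (m - 1)) Prod.fst (θ, r) v) := rfl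
    rw [h4]
    refine add_nonneg (mul_self_nonneg _) (mul_nonneg (sq_nonneg _) ?_)
    by_cases h0 : mfderiv (coneModel (m - 1)) (𝓡 (m - 1)) Prod.fst (θ, r) v = 0
    · rw [h0]; simp
    · exact ((X.g' i).pos _ _ h0).le
  simp only [Fin.prod_univ_two, Real.mul_self_sqrt h3, Nat.cast_zero, sub_zero] at h2
  have h5 : |pullMetric (X.φ i) X.g.inner (θ, r) v v - coneMetric (X.g' i).inner (θ, r) v v| ≤
      C * r ^ X.ν i * coneMetric (X.g' i).inner (θ, r) v v := h2
  have h6 := abs_le.1 h5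
  constructor <;> nlinarith [h6.1, h6.2]

/-- On a small end, the form `α` is bounded by `C r^(β-1)` on vectors of conical length one. -/
def IsEndBound (β : ℝ) (i : Fin s ⊕ Fin l) (α : OneField (𝓡 m) L) (C r₀ : ℝ) : Prop :=
  ∀ r ∈ openRange r₀ i, ∀ (θ : Λ i) (v : TangentSpace (coneModel (m - 1)) (θ, r)),
    |α (X.φ i (θ, r)) (mfderiv (coneModel (m - 1)) (𝓡 m) (X.φ i) (θ, r) v)| ≤
      C * r ^ (β - 1) * √(coneMetric (X.g' i).inner (θ, r) v v)

theorem IsWeighted.exists_isEndBound {X : CSACManifold m s l L Λ} {β : Fin s ⊕ Fin l → ℝ}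
    {α : OneField (𝓡 m) L} (i : Fin s ⊕ Fin l)
    (hα : X.IsWeighted (fun i => β i - 1) (formTensor (𝓡 m) α)) :
    ∃ C r₀, 0 ≤ C ∧ 0 < r₀ ∧ openRange r₀ i ⊆ openRange (X.a i) i ∧
      X.IsEndBound (β i) i α C r₀ := by
  obtain ⟨C, hC⟩ := hα i 0
  obtain ⟨r₀, hr₀, hsub, h⟩ := exists_openRange_of_eventually (hC.and (X.metric_compare i))
    (X.a_pos i)
  refine ⟨|C| * 2, r₀, by positivity, hr₀, hsub, fun r hr θ v => ?_⟩
  have hr' : 0 < r := openRange_pos hr₀ hr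
  obtain ⟨h1, h2⟩ := h r hr
  have h3 := covDerivBound_zero_iff.1 (h1 θ)
    (fun _ => mfderiv (coneModel (m - 1)) (𝓡 m) (X.φ i) (θ, r) v)
  simp only [Fin.prod_univ_one, Nat.cast_zero, sub_zero] at h3
  refine (show _ ≤ _ from h3).trans ?_
  have h4 : √(pullMetric (X.φ i) X.g.inner (θ, r) v v) ≤
      2 * √(coneMetric (X.g' i).inner (θ, r) v v) := by
    refine (Real.sqrt_le_sqrt (h2 θ v).2).trans (le_of_eq ?_)
    rw [Real.sqrt_mul (by norm_num), show (4 : ℝ) = 2 ^ 2 by norm_num, Real.sqrt_sq (by norm_num)]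
  calc C * r ^ (β i - 1) * √(pullMetric (X.φ i) X.g.inner (θ, r) v v)
      ≤ |C| * r ^ (β i - 1) * (2 * √(coneMetric (X.g' i).inner (θ, r) v v)) := by
        gcongr
        exact le_abs_self C
    _ = _ := by ring

end CSACManifold

/-- A function whose derivative is bounded by `C r^(β-1)` varies at most as `(C/β) r^β`. -/
theorem abs_sub_le_of_abs_deriv_le_rpow {J : Set ℝ} (hJ : Convex ℝ J) (hJ' : J ⊆ Ioi 0)
    {h h' : ℝ → ℝ} {C β : ℝ} (hβ : β ≠ 0) (hd : ∀ r ∈ J, HasDerivAt h (h' r) r)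
    (hb : ∀ r ∈ J, |h' r| ≤ C * r ^ (β - 1)) {ρ r : ℝ} (hρ : ρ ∈ J) (hr : r ∈ J) :
    |h r - h ρ| ≤ |C / β * r ^ β - C / β * ρ ^ β| := by
  wlog hle : ρ ≤ r generalizing ρ r
  · have := this hr hρ (le_of_not_ge hle)
    rwa [abs_sub_comm, abs_sub_comm (C / β * r ^ β)]
  have hp : ∀ r ∈ J, HasDerivAt (fun r => C / β * r ^ β) (C * r ^ (β - 1)) r := by
    intro r hr
    have := (Real.hasDerivAt_rpow_const (p := β) (Or.inl (ne_of_gt (hJ' hr)))).const_mul (C / β)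
    rwa [show C / β * (β * r ^ (β - 1)) = C * r ^ (β - 1) by field_simp] at this
  have h1 : MonotoneOn (fun r => C / β * r ^ β + h r) J :=
    monotoneOn_of_hasDerivWithinAt_nonneg hJ
      (fun r hr => ((hp r hr).add (hd r hr)).continuousAt.continuousWithinAt)
      (fun r hr => ((hp r (interior_subset hr)).add (hd r (interior_subset hr))).hasDerivWithinAt)
      fun r hr => by linarith [(abs_le.1 (hb r (interior_subset hr))).1]
  have h2 : MonotoneOn (fun r => C / β * r ^ β - h r) J :=
    monotoneOn_of_hasDerivWithinAt_nonneg hJ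
      (fun r hr => ((hp r hr).sub (hd r hr)).continuousAt.continuousWithinAt)
      (fun r hr => ((hp r (interior_subset hr)).sub (hd r (interior_subset hr))).hasDerivWithinAt)
      fun r hr => by linarith [(abs_le.1 (hb r (interior_subset hr))).2]
  have h3 := h1 hρ hr hle
  have h4 := h2 hρ hr hle
  simp only at h3 h4
  refine (abs_le.2 ⟨?_, ?_⟩).trans (le_abs_self _) <;> linarith

namespace CSACManifold

variable {m s l : ℕ}
  {L : Type*} [TopologicalSpace L] [ChartedSpace (Model m) L] [IsManifold (𝓡 m) ∞ L]
  {Λ : Fin s ⊕ Fin l → Type*} [∀ i, TopologicalSpace (Λ i)]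
  [∀ i, ChartedSpace (Model (m - 1)) (Λ i)] [∀ i, IsManifold (𝓡 (m - 1)) ∞ (Λ i)]
  [∀ i, CompactSpace (Λ i)]
  (X : CSACManifold m s l L Λ)

variable {X} {i : Fin s ⊕ Fin l} {α : OneField (𝓡 m) L} {β C r₀ : ℝ}

/-- The derivative of a primitive along a map into the end. -/
theorem IsEndBound.hasFDerivAt {W : Type*} [NormedAddCommGroup W] [NormedSpace ℝ W]
    (hα : X.IsEndBound β i α C r₀) (hr₀ : openRange r₀ i ⊆ openRange (X.b i) i)
    {U : Set (Λ i)} {u : L → ℝ} (hu : IsPrim α (X.sector i U) u)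
    {f : W → Λ i × ℝ} {y : W} (hf : MDifferentiableAt 𝓘(ℝ, W) (coneModel (m - 1)) f y)
    (hfU : (f y).1 ∈ U) (hfr : (f y).2 ∈ openRange r₀ i) :
    ∃ D : W →L[ℝ] ℝ, HasFDerivAt (fun z => u (X.φ i (f z))) D y ∧ ∀ v, |D v| ≤
      C * (f y).2 ^ (β - 1) * √(fderiv ℝ (fun y => (f y).2) y v ^ 2 +
        (f y).2 ^ 2 * pullMet (𝓡 (m - 1)) (fun y => (f y).1) (X.g' i).inner y v v) := by
  have h1 := X.mdifferentiableAt_φ (f y).1 (hr₀ hfr)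
  have h2 : MDifferentiableAt 𝓘(ℝ, W) (𝓡 m) (fun z => X.φ i (f z)) y :=
    MDifferentiableAt.comp y h1 hf
  have h3 : mfderiv 𝓘(ℝ, W) (𝓡 m) (fun z => X.φ i (f z)) y =
    (mfderiv (coneModel (m - 1)) (𝓡 m) (X.φ i) (f y)).comp
      (mfderiv 𝓘(ℝ, W) (coneModel (m - 1)) f y) := mfderiv_comp y h1 hf
  refine ⟨_, hu.hasFDerivAt_comp (f := fun z => X.φ i (f z)) (mem_sector X hfU (hr₀ hfr)) h2,
    fun v => ?_⟩
  have h4 := hα _ hfr (f y).1 (mfderiv 𝓘(ℝ, W) (coneModel (m - 1)) f y v)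
  have h5 := coneMetric_mfderiv (X.g' i).inner hf v v
  have h6 : pullForm (𝓡 m) (fun z => X.φ i (f z)) α y v = α (X.φ i (f y))
      (mfderiv (coneModel (m - 1)) (𝓡 m) (X.φ i) (f y)
        (mfderiv 𝓘(ℝ, W) (coneModel (m - 1)) f y v)) :=
    congrArg (fun A => α (X.φ i (f y)) (A v)) h3
  rw [h6, sq (fderiv ℝ (fun y => (f y).2) y v)]
  refine h4.trans (le_of_eq ?_)
  exact congrArg (fun t => C * (f y).2 ^ (β - 1) * √t) h5

/-- The radial vector has length one for the conical metric, so that the bound on the form bounds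
the derivative of a primitive along a ray. -/
theorem IsEndBound.hasDerivAt (hα : X.IsEndBound β i α C r₀)
    (hr₀ : openRange r₀ i ⊆ openRange (X.b i) i)
    {U : Set (Λ i)} {u : L → ℝ} (hu : IsPrim α (X.sector i U) u) {θ : Λ i} (hθ : θ ∈ U)
    {r : ℝ} (hr : r ∈ openRange r₀ i) :
    ∃ D, HasDerivAt (fun r => u (X.φ i (θ, r))) D r ∧ |D| ≤ C * r ^ (β - 1) := by
  have hf : MDifferentiableAt 𝓘(ℝ, ℝ) (coneModel (m - 1)) (fun r : ℝ => (θ, r)) r :=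
    mdifferentiableAt_const.prodMk mdifferentiableAt_id
  obtain ⟨D, hD, hD'⟩ := hα.hasFDerivAt hr₀ hu hf hθ hr
  refine ⟨D 1, hD.hasDerivAt, (hD' 1).trans (le_of_eq ?_)⟩
  have h1 : pullMet (𝓡 (m - 1)) (fun _ : ℝ => θ) (X.g' i).inner r 1 1 = 0 := by
    have : mfderiv 𝓘(ℝ, ℝ) (𝓡 (m - 1)) (fun _ : ℝ => θ) r = 0 := mfderiv_const
    have h2 : pullMet (𝓡 (m - 1)) (fun _ : ℝ => θ) (X.g' i).inner r 1 1 = (X.g' i).inner θ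
      (mfderiv 𝓘(ℝ, ℝ) (𝓡 (m - 1)) (fun _ : ℝ => θ) r (1 : ℝ))
      (mfderiv 𝓘(ℝ, ℝ) (𝓡 (m - 1)) (fun _ : ℝ => θ) r (1 : ℝ)) := rfl
    rw [h2, this]
    exact congrArg (fun A : TangentSpace (𝓡 (m - 1)) θ →L[ℝ] ℝ => A 0)
      (map_zero ((X.g' i).inner θ))
  have h2 : fderiv ℝ (fun r : ℝ => r) r 1 = 1 := by simp
  simp only [h1, h2]
  simp

/-- The oscillation of a primitive along a ray. -/
theorem IsEndBound.abs_sub_le (hα : X.IsEndBound β i α C r₀) (h0 : 0 < r₀) (hβ : β ≠ 0)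
    (hr₀ : openRange r₀ i ⊆ openRange (X.b i) i)
    {U : Set (Λ i)} {u : L → ℝ} (hu : IsPrim α (X.sector i U) u) {θ : Λ i} (hθ : θ ∈ U)
    {ρ r : ℝ} (hρ : ρ ∈ openRange r₀ i) (hr : r ∈ openRange r₀ i) :
    |u (X.φ i (θ, r)) - u (X.φ i (θ, ρ))| ≤ |C / β * r ^ β - C / β * ρ ^ β| := by
  have h : ∀ r, ∃ D, r ∈ openRange r₀ i →
      HasDerivAt (fun r => u (X.φ i (θ, r))) D r ∧ |D| ≤ C * r ^ (β - 1) := by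
    intro r
    by_cases hr : r ∈ openRange r₀ i
    · obtain ⟨D, hD⟩ := hα.hasDerivAt hr₀ hu hθ hr
      exact ⟨D, fun _ => hD⟩
    · exact ⟨0, fun h => absurd h hr⟩
  choose D hD using h
  exact abs_sub_le_of_abs_deriv_le_rpow (convex_openRange r₀ i) (fun r hr => openRange_pos h0 hr)
    hβ (fun r hr => (hD r hr).1) (fun r hr => (hD r hr).2) hρ hr

theorem eventually_openRange (h0 : 0 < r₀) (i : Fin s ⊕ Fin l) :
    ∀ᶠ r in endFilter i, r ∈ openRange r₀ i := eventually_endFilter_openRange h0 i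

/-- A primitive of a decaying form has a limit along each ray. -/
theorem IsEndBound.exists_tendsto (hα : X.IsEndBound β i α C r₀) (h0 : 0 < r₀)
    (hβ : Decays i β) (hr₀ : openRange r₀ i ⊆ openRange (X.b i) i)
    {U : Set (Λ i)} {u : L → ℝ} (hu : IsPrim α (X.sector i U) u) {θ : Λ i} (hθ : θ ∈ U) :
    ∃ c, Tendsto (fun r => u (X.φ i (θ, r))) (endFilter i) (𝓝 c) ∧
      ∀ r ∈ openRange r₀ i, |u (X.φ i (θ, r)) - c| ≤ |C / β| * r ^ β := by
  have h1 : Tendsto (fun r : ℝ => C / β * r ^ β) (endFilter i) (𝓝 (C / β * 0)) :=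
    hβ.tendsto.const_mul _
  rw [mul_zero] at h1
  have h2 : Cauchy (map (fun r => u (X.φ i (θ, r))) (endFilter i)) := by
    refine Metric.cauchy_iff.2 ⟨inferInstance, fun ε hε => ?_⟩
    obtain ⟨t, ht, ht'⟩ := (Metric.cauchy_iff.1 h1.cauchy_map).2 ε hε
    refine ⟨_, image_mem_map (inter_mem ht (eventually_openRange h0 i)), ?_⟩
    rintro _ ⟨r, hr, rfl⟩ _ ⟨ρ, hρ, rfl⟩
    exact (hα.abs_sub_le h0 hβ.ne_zero hr₀ hu hθ hρ.2 hr.2).trans_lt (ht' _ hr.1 _ hρ.1)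
  obtain ⟨c, hc⟩ := cauchy_iff_exists_le_nhds.1 h2
  refine ⟨c, hc, fun r hr => ?_⟩
  have hc' : Tendsto (fun r => u (X.φ i (θ, r))) (endFilter i) (𝓝 c) := hc
  have h3 := (hc'.const_sub (u (X.φ i (θ, r)))).abs
  have h4 := (h1.const_sub (C / β * r ^ β)).abs
  have h5 := le_of_tendsto_of_tendsto h3 h4 (by
    filter_upwards [eventually_openRange h0 i] with ρ hρ
    exact hα.abs_sub_le h0 hβ.ne_zero hr₀ hu hθ hρ hr)
  rwa [sub_zero, abs_mul, abs_of_pos (Real.rpow_pos_of_pos (openRange_pos h0 hr) β)] at h5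

/-- The limits of a primitive along the rays are locally constant: vectors tangent to the link have
conical length of order `r`, so that the primitive varies by `O(r^β)` on a slice. -/
theorem IsEndBound.eventually_eq_limit (hα : X.IsEndBound β i α C r₀) (h0 : 0 < r₀)
    (hβ : Decays i β) (hr₀ : openRange r₀ i ⊆ openRange (X.b i) i)
    {U : Set (Λ i)} (hU : IsOpen U) {u : L → ℝ} (hu : IsPrim α (X.sector i U) u) {θ₀ : Λ i}
    (hθ₀ : θ₀ ∈ U) {c : Λ i → ℝ}
    (hc : ∀ θ ∈ U, Tendsto (fun r => u (X.φ i (θ, r))) (endFilter i) (𝓝 (c θ))) :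
    ∀ᶠ θ in 𝓝 θ₀, c θ = c θ₀ := by
  set e := extChartAt (𝓡 (m - 1)) θ₀
  have hes := contMDiffOn_extChartAt_symm (I := 𝓡 (m - 1)) (n := ∞) θ₀
  have hΩ : IsOpen (e.target ∩ e.symm ⁻¹' U) :=
    hes.continuousOn.isOpen_inter_preimage (isOpen_extChartAt_target θ₀) hU
  have hy0 : e θ₀ ∈ e.target ∩ e.symm ⁻¹' U := ⟨mem_extChartAt_target θ₀, by simpa [e] using hθ₀⟩
  have hG : ContinuousOn (fun y => pullMet (𝓡 (m - 1)) e.symm (X.g' i).inner y) e.target :=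
    (isMetricOn_pullMet (isOpen_extChartAt_target θ₀) hes
      (fun y hy => (mfderiv_extChartAt_symm_isInvertible θ₀ hy).injective)
      (X.g' i)).smooth.continuousOn
  have hG' := (hG.continuousAt ((isOpen_extChartAt_target θ₀).mem_nhds hy0.1)).norm
  set B := ‖pullMet (𝓡 (m - 1)) e.symm (X.g' i).inner (e θ₀)‖ + 1
  have hB : ∀ᶠ y in 𝓝 (e θ₀), ‖pullMet (𝓡 (m - 1)) e.symm (X.g' i).inner y‖ < B :=
    hG'.eventually_lt_const (by simp [B])
  obtain ⟨ε, hε, hball⟩ := Metric.mem_nhds_iff.1 (inter_mem hB (hΩ.mem_nhds hy0))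
  have key : ∀ y ∈ Metric.ball (e θ₀) ε, c (e.symm y) = c θ₀ := by
    intro y hy
    have h1 : ∀ r ∈ openRange r₀ i, |u (X.φ i (e.symm y, r)) - u (X.φ i (θ₀, r))| ≤
        |C| * √B * ‖y - e θ₀‖ * r ^ β := by
      intro r hr
      have hrpos := openRange_pos h0 hr
      have hder : ∀ z ∈ Metric.ball (e θ₀) ε, ∃ D : Model (m - 1) →L[ℝ] ℝ,
          HasFDerivAt (fun z => u (X.φ i (e.symm z, r))) D z ∧ ‖D‖ ≤ |C| * √B * r ^ β := by
        intro z hz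
        have hf : MDifferentiableAt 𝓘(ℝ, Model (m - 1)) (coneModel (m - 1))
            (fun z => (e.symm z, r)) z :=
          ((hes.contMDiffAt ((isOpen_extChartAt_target θ₀).mem_nhds
            (hball hz).2.1)).mdifferentiableAt (by simp)).prodMk mdifferentiableAt_const
        obtain ⟨D, hD, hD'⟩ := hα.hasFDerivAt hr₀ hu hf (hball hz).2.2 hr
        refine ⟨D, hD, D.opNorm_le_bound (by positivity) fun v => (hD' v).trans ?_⟩
        have h2 : fderiv ℝ (fun _ : Model (m - 1) => r) z v = 0 := by simp
        simp only [h2]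
        have h3 : pullMet (𝓡 (m - 1)) e.symm (X.g' i).inner z v v ≤ B * ‖v‖ ^ 2 := by
          refine (Real.le_norm_self _).trans
            (((pullMet (𝓡 (m - 1)) e.symm (X.g' i).inner z).le_opNorm₂ v v).trans ?_)
          have hz1 : ‖pullMet (𝓡 (m - 1)) e.symm (X.g' i).inner z‖ < B := (hball hz).1
          rw [mul_assoc, ← sq]; have := hz1.le
          gcongr
        have h4 : √(0 ^ 2 + r ^ 2 * pullMet (𝓡 (m - 1)) e.symm (X.g' i).inner z v v) ≤
            r * (√B * ‖v‖) := by
          refine Real.sqrt_le_iff.2 ⟨by positivity, ?_⟩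
          rw [mul_pow, mul_pow, Real.sq_sqrt (by positivity)]
          nlinarith [sq_nonneg r]
        calc _ ≤ |C| * r ^ (β - 1) * (r * (√B * ‖v‖)) := by
              gcongr
              exact le_abs_self C
          _ = |C| * √B * (r ^ (β - 1) * r) * ‖v‖ := by ring
          _ = _ := by rw [← Real.rpow_add_one hrpos.ne', sub_add_cancel]
      choose! D hD hD' using hder
      have := (convex_ball (e θ₀) ε).norm_image_sub_le_of_norm_hasFDerivWithin_le
        (fun z hz => (hD z hz).hasFDerivWithinAt) hD' (Metric.mem_ball_self hε) hy
      rw [show e.symm (e θ₀) = θ₀ from extChartAt_to_inv θ₀] at this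
      refine this.trans (le_of_eq (by ring))
    have h2 : Tendsto (fun r => |C| * √B * ‖y - e θ₀‖ * r ^ β) (endFilter i) (𝓝 (_ * 0)) :=
      hβ.tendsto.const_mul _
    rw [mul_zero] at h2
    have h3 := ((hc _ (hball hy).2.2).sub (hc θ₀ hθ₀)).abs
    have h4 := le_of_tendsto_of_tendsto h3 h2 (by
      filter_upwards [eventually_openRange h0 i] with r hr using h1 r hr)
    linarith [abs_nonpos_iff.1 h4]
  filter_upwards [(continuousAt_extChartAt (I := 𝓡 (m - 1)) θ₀).preimage_mem_nhds
    (Metric.ball_mem_nhds _ hε), extChartAt_source_mem_nhds (I := 𝓡 (m - 1)) θ₀] with θ h1 h2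
  have := key _ h1
  rwa [e.left_inv h2] at this

end CSACManifold

namespace CSACManifold

variable {m s l : ℕ}
  {L : Type*} [TopologicalSpace L] [ChartedSpace (Model m) L] [IsManifold (𝓡 m) ∞ L]
  {Λ : Fin s ⊕ Fin l → Type*} [∀ i, TopologicalSpace (Λ i)]
  [∀ i, ChartedSpace (Model (m - 1)) (Λ i)] [∀ i, IsManifold (𝓡 (m - 1)) ∞ (Λ i)]
  [∀ i, CompactSpace (Λ i)]
  (X : CSACManifold m s l L Λ)

/-! ### Primitives on the ends -/

section EndPrimitives

variable {X} {i : Fin s ⊕ Fin l} {α : OneField (𝓡 m) L} {β C r₀ : ℝ}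

/-- Two primitives of the same form differ by a constant along each ray. -/
theorem sub_eq_of_ray {U W : Set (Λ i)} (hU : IsOpen U) (hW : IsOpen W) {u w : L → ℝ}
    (hu : IsPrim α (X.sector i U) u) (hw : IsPrim α (X.sector i W) w) {θ : Λ i} (hθU : θ ∈ U)
    (hθW : θ ∈ W) {r ρ : ℝ} (hr : r ∈ openRange (X.b i) i) (hρ : ρ ∈ openRange (X.b i) i) :
    u (X.φ i (θ, r)) - w (X.φ i (θ, r)) = u (X.φ i (θ, ρ)) - w (X.φ i (θ, ρ)) := by
  have hray : IsPreconnected ((fun r => X.φ i (θ, r)) '' openRange (X.b i) i) := by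
    refine (convex_openRange _ i).isPreconnected.image _ fun r hr => ?_
    exact (((X.φ i).continuousAt (X.mem_source θ hr)).comp
      (by fun_prop : ContinuousAt (fun r : ℝ => (θ, r)) r)).continuousWithinAt
  refine eq_of_isPreconnected (f := fun x => u x - w x) hray ?_ (mem_image_of_mem _ hr)
    (mem_image_of_mem _ hρ)
  rintro _ ⟨r, hr, rfl⟩
  have h := (hu.mono (S' := X.sector i (U ∩ W)) (image_mono (prod_mono_left inter_subset_left))
    ).sub_eventually_eq (X.isOpen_sector i (hU.inter hW))
    (hw.mono (image_mono (prod_mono_left inter_subset_right)))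
    (mem_sector X (show θ ∈ U ∩ W from ⟨hθU, hθW⟩) hr)
  exact h.filter_mono nhdsWithin_le_nhds

/-- Local primitives over the link, each normalized along every ray by subtracting a constant,
fit together to a function on the whole extended end. -/
theorem exists_normalized (hα : α ∈ closedForms (𝓡 m) L) (n : (ℝ → ℝ) → ℝ)
    (hn : ∀ (U W : Set (Λ i)) (u w : L → ℝ) (θ : Λ i), IsOpen U → IsOpen W →
      IsPrim α (X.sector i U) u → IsPrim α (X.sector i W) w → θ ∈ U → θ ∈ W →
      n (fun r => u (X.φ i (θ, r))) - n (fun r => w (X.φ i (θ, r))) =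
        u (X.φ i (θ, X.a i)) - w (X.φ i (θ, X.a i))) :
    ∃ H : L → ℝ, ∀ θ₀, ∃ U : Set (Λ i), IsOpen U ∧ θ₀ ∈ U ∧ ∃ u, IsPrim α (X.sector i U) u ∧
      ∀ θ ∈ U, ∀ r ∈ openRange (X.b i) i,
        H (X.φ i (θ, r)) = u (X.φ i (θ, r)) - n fun r => u (X.φ i (θ, r)) := by
  choose U hU hmem u hu using X.exists_isPrim_sector hα i
  refine ⟨fun x => u ((X.φ i).symm x).1 x -
    n fun r => u ((X.φ i).symm x).1 (X.φ i (((X.φ i).symm x).1, r)),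
    fun θ₀ => ⟨U θ₀, hU θ₀, hmem θ₀, u θ₀, hu θ₀, fun θ hθ r hr => ?_⟩⟩
  simp only [X.symm_φ θ hr]
  have h1 := hn _ _ _ _ θ (hU θ) (hU θ₀) (hu θ) (hu θ₀) (hmem θ) hθ
  have h2 := sub_eq_of_ray (hU θ) (hU θ₀) (hu θ) (hu θ₀) (hmem θ) hθ hr (X.a_mem i)
  linarith

/-- On an end, a decaying closed form has a decaying primitive: local primitives are normalized by
subtracting their limits along the rays. -/
theorem IsEndBound.exists_isPrim (hα' : X.IsEndBound β i α C r₀) (hα : α ∈ closedForms (𝓡 m) L)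
    (h0 : 0 < r₀) (hβ : Decays i β) (hr₀ : openRange r₀ i ⊆ openRange (X.b i) i) :
    ∃ h : L → ℝ, IsPrim α (X.sector i univ) h ∧
      ∀ r ∈ openRange r₀ i, ∀ θ, |h (X.φ i (θ, r))| ≤ |C / β| * r ^ β := by
  obtain ⟨h, hh⟩ := exists_normalized (X := X) (i := i) hα (fun f => limUnder (endFilter i) f) (by
    intro U W u w θ hU hW hu hw hθU hθW
    obtain ⟨c, hc, -⟩ := hα'.exists_tendsto h0 hβ hr₀ hu hθU
    obtain ⟨c', hc', -⟩ := hα'.exists_tendsto h0 hβ hr₀ hw hθW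
    rw [hc.limUnder_eq, hc'.limUnder_eq]
    refine tendsto_nhds_unique_of_eventuallyEq (hc.sub hc') tendsto_const_nhds ?_
    filter_upwards [eventually_openRange h0 i] with r hr
    exact sub_eq_of_ray hU hW hu hw hθU hθW (hr₀ hr) (X.a_mem i))
  refine ⟨h, ?_, fun r hr θ => ?_⟩
  · rintro _ ⟨⟨θ₀, r⟩, ⟨-, hr⟩, rfl⟩
    obtain ⟨U, hU, hθ₀, u, hu, hhu⟩ := hh θ₀
    have hlim : ∀ θ ∈ U, Tendsto (fun r => u (X.φ i (θ, r))) (endFilter i)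
        (𝓝 (limUnder (endFilter i) fun r => u (X.φ i (θ, r)))) := fun θ hθ => by
      obtain ⟨c, hc, -⟩ := hα'.exists_tendsto h0 hβ hr₀ hu hθ
      rwa [hc.limUnder_eq]
    obtain ⟨V, hVU, hV, hθV⟩ := eventually_nhds_iff.1
      ((hα'.eventually_eq_limit h0 hβ hr₀ hU hu hθ₀ hlim).and (hU.mem_nhds hθ₀))
    have h1 : IsPrim α (X.sector i V) u :=
      hu.mono (image_mono (prod_mono_left fun θ hθ => (hVU θ hθ).2))
    refine (h1.add_const (-limUnder (endFilter i) fun r => u (X.φ i (θ₀, r)))).congr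
      (X.isOpen_sector i hV) (w := h) ?_ _ (mem_sector X hθV hr)
    rintro _ ⟨⟨θ, ρ⟩, ⟨hθ, hρ⟩, rfl⟩
    rw [hhu θ (hVU θ hθ).2 ρ hρ, (hVU θ hθ).1, sub_eq_add_neg]
  · obtain ⟨U, hU, hθ, u, hu, hhu⟩ := hh θ
    obtain ⟨c, hc, hc'⟩ := hα'.exists_tendsto h0 hβ hr₀ hu hθ
    rw [hhu θ hθ r (hr₀ hr), hc.limUnder_eq]
    exact hc' r hr

theorem isPreconnected_sector [∀ i, ConnectedSpace (Λ i)] :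
    IsPreconnected (X.sector i univ) := by
  refine (isPreconnected_univ.prod (convex_openRange _ i).isPreconnected).image _ fun q hq => ?_
  exact ((X.φ i).continuousAt (X.mem_source q.1 hq.2)).continuousWithinAt

/-- A primitive of a decaying form is asymptotic to a constant. -/
theorem IsEndBound.exists_abs_sub_const_le [∀ i, ConnectedSpace (Λ i)]
    (hα' : X.IsEndBound β i α C r₀) (hα : α ∈ closedForms (𝓡 m) L)
    (h0 : 0 < r₀) (hβ : Decays i β) (hr₀ : openRange r₀ i ⊆ openRange (X.b i) i)
    {H : L → ℝ} (hH : IsPrim α (X.sector i univ) H) :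
    ∃ c, ∀ r ∈ openRange r₀ i, ∀ θ, |H (X.φ i (θ, r)) - c| ≤ |C / β| * r ^ β := by
  obtain ⟨h, hh, hh'⟩ := hα'.exists_isPrim hα h0 hβ hr₀
  obtain ⟨θ₀⟩ := (inferInstance : Nonempty (Λ i))
  refine ⟨H (X.φ i (θ₀, X.a i)) - h (X.φ i (θ₀, X.a i)), fun r hr θ => ?_⟩
  rw [hH.sub_eq_of_isPreconnected (X.isOpen_sector i isOpen_univ) isPreconnected_sector hh
    (mem_sector X (mem_univ θ₀) (X.a_mem i)) (mem_sector X (mem_univ θ) (hr₀ hr)), sub_sub_cancel]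
  exact hh' r hr θ

/-- A primitive of a form bounded by `r^(β-1)` grows at most like `r^β` on an AC end, if
`β > 0`. -/
theorem IsEndBound.exists_abs_le {i : Fin l}
    (hα' : X.IsEndBound β (Sum.inr i) α C r₀) (h0 : 0 < r₀) (hβ : 0 < β)
    (hr₀ : openRange r₀ (Sum.inr i : Fin s ⊕ Fin l) ⊆
      openRange (X.b (Sum.inr i)) (Sum.inr i : Fin s ⊕ Fin l))
    {H : L → ℝ} (hH : IsPrim α (X.sector (Sum.inr i) univ) H) :
    ∃ K, ∀ r > r₀ + 1, ∀ θ, |H (X.φ (Sum.inr i) (θ, r))| ≤ K * r ^ β := by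
  have hmem : ∀ r ≥ r₀ + 1, r ∈ openRange r₀ (Sum.inr i : Fin s ⊕ Fin l) := fun r hr =>
    show r₀ < r by linarith
  have hcont : Continuous fun θ : Λ (Sum.inr i) => H (X.φ (Sum.inr i) (θ, r₀ + 1)) := by
    refine continuous_iff_continuousAt.2 fun θ => ?_
    refine ContinuousAt.comp (f := fun θ => X.φ (Sum.inr i) (θ, r₀ + 1))
      (hH.continuousAt (mem_sector X (mem_univ θ) (hr₀ (hmem _ le_rfl)))) ?_
    exact ((X.φ _).continuousAt (X.mem_source θ (hr₀ (hmem _ le_rfl)))).comp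
      (f := fun θ : Λ (Sum.inr i) => (θ, r₀ + 1)) (x := θ)
      (by fun_prop : ContinuousAt (fun θ : Λ (Sum.inr i) => (θ, r₀ + 1)) θ)
  obtain ⟨B, hB⟩ := isCompact_univ.exists_bound_of_continuousOn hcont.continuousOn
  have hρ : 0 < (r₀ + 1) ^ β := Real.rpow_pos_of_pos (by linarith) β
  refine ⟨|B| / (r₀ + 1) ^ β + 2 * |C / β|, fun r hr θ => ?_⟩
  have h1 := hα'.abs_sub_le h0 hβ.ne' hr₀ hH (mem_univ θ) (hmem _ le_rfl) (hmem r hr.le)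
  have h2 : (r₀ + 1) ^ β ≤ r ^ β := Real.rpow_le_rpow (by linarith) hr.le hβ.le
  have h3 : |H (X.φ (Sum.inr i) (θ, r₀ + 1))| ≤ |B| := (hB θ (mem_univ θ)).trans (le_abs_self B)
  have h4 : |C / β * r ^ β - C / β * (r₀ + 1) ^ β| ≤ |C / β| * r ^ β := by
    rw [← mul_sub, abs_mul, abs_of_nonneg (by linarith : 0 ≤ r ^ β - (r₀ + 1) ^ β)]
    gcongr
    linarith
  have h5 : |B| ≤ |B| / (r₀ + 1) ^ β * r ^ β := by
    rw [div_mul_eq_mul_div, le_div_iff₀ hρ]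
    gcongr
  have h6 := abs_add_le (H (X.φ (Sum.inr i) (θ, r)) - H (X.φ (Sum.inr i) (θ, r₀ + 1)))
    (H (X.φ (Sum.inr i) (θ, r₀ + 1)))
  rw [sub_add_cancel] at h6
  have h7 : 0 ≤ |C / β| * r ^ β :=
    mul_nonneg (abs_nonneg _) (Real.rpow_nonneg (by linarith) β)
  linarith

end EndPrimitives

/-! ### The radial integral of a closed form -/

section Radial

variable {X} {i : Fin s ⊕ Fin l} {α : OneField (𝓡 m) L}

/-- The restriction of a form on `L` to the slice `r = a` of an end, as a form on the link. -/
def slice (X : CSACManifold m s l L Λ) (i : Fin s ⊕ Fin l) (α : OneField (𝓡 m) L) :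
    OneField (𝓡 (m - 1)) (Λ i) := fun θ =>
  (α (X.φ i (θ, X.a i))).comp (mfderiv (𝓡 (m - 1)) (𝓡 m) (fun θ => X.φ i (θ, X.a i)) θ)

/-- The function `F` restricts to the radial integral `∫ₐʳ α` on the end: up to a function on the
link, it is a primitive of the closed form `α`. -/
def IsRadial (X : CSACManifold m s l L Λ) (i : Fin s ⊕ Fin l) (α : OneField (𝓡 m) L)
    (F : L → ℝ) : Prop :=
  ∀ θ₀, ∃ U : Set (Λ i), IsOpen U ∧ θ₀ ∈ U ∧ ∃ u, IsPrim α (X.sector i U) u ∧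
    ∀ θ ∈ U, ∀ r ∈ openRange (X.b i) i,
      F (X.φ i (θ, r)) = u (X.φ i (θ, r)) - u (X.φ i (θ, X.a i))

theorem exists_isRadial (hα : α ∈ closedForms (𝓡 m) L) : ∃ F, X.IsRadial i α F :=
  exists_normalized hα (fun f => f (X.a i)) fun _ _ _ _ _ _ _ _ _ _ _ => rfl

theorem contMDiffAt_slice (θ : Λ i) :
    ContMDiffAt (𝓡 (m - 1)) (𝓡 m) ∞ (fun θ => X.φ i (θ, X.a i)) θ :=
  ContMDiffAt.comp θ ((X.contMDiffOn_φ i).contMDiffAt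
    ((X.φ i).open_source.mem_nhds (X.mem_source θ (X.a_mem i))))
    (contMDiffAt_id.prodMk contMDiffAt_const)

theorem IsPrim.hasMFDerivAt_slice {U : Set (Λ i)} {u : L → ℝ} (hu : IsPrim α (X.sector i U) u)
    {θ : Λ i} (hθ : θ ∈ U) :
    HasMFDerivAt (𝓡 (m - 1)) 𝓘(ℝ, ℝ) (fun θ => u (X.φ i (θ, X.a i))) θ (X.slice i α θ) :=
  (hu _ (mem_sector X hθ (X.a_mem i))).comp θ
    ((contMDiffAt_slice θ).mdifferentiableAt (by simp)).hasMFDerivAt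

theorem IsRadial.contMDiffOn {F : L → ℝ} (hF : X.IsRadial i α F) (hα : IsSmoothForm α) :
    ContMDiffOn (𝓡 m) 𝓘(ℝ, ℝ) ∞ F (X.sector i univ) := by
  rintro _ ⟨⟨θ₀, r⟩, ⟨-, hr⟩, rfl⟩
  obtain ⟨U, hU, hθ₀, u, hu, hF'⟩ := hF θ₀
  have hS := X.isOpen_sector i hU
  have h1 := (hu.contMDiffOn hα hS).contMDiffAt (hS.mem_nhds (mem_sector X hθ₀ hr))
  have h2 : ContMDiffAt (𝓡 (m - 1)) 𝓘(ℝ, ℝ) ∞ (fun θ => u (X.φ i (θ, X.a i)))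
      ((X.φ i).symm (X.φ i (θ₀, r))).1 := by
    rw [X.symm_φ θ₀ hr]
    exact ContMDiffAt.comp (f := fun θ => X.φ i (θ, X.a i)) (g := u) θ₀
      ((hu.contMDiffOn hα hS).contMDiffAt (hS.mem_nhds (mem_sector X hθ₀ (X.a_mem i))))
      (contMDiffAt_slice θ₀)
  have h3 : ContMDiffAt (𝓡 m) (𝓡 (m - 1)) ∞ (fun x => ((X.φ i).symm x).1) (X.φ i (θ₀, r)) :=
    contMDiffAt_fst.comp _ ((X.contMDiffOn_symm i).contMDiffAt
      ((X.φ i).open_target.mem_nhds ((X.φ i).map_source (X.mem_source θ₀ hr))))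
  have h4 := h1.sub (ContMDiffAt.comp (f := fun x => ((X.φ i).symm x).1)
    (g := fun θ => u (X.φ i (θ, X.a i))) (X.φ i (θ₀, r)) h2 h3)
  refine (h4.congr_of_eventuallyEq ?_).contMDiffWithinAt
  filter_upwards [hS.mem_nhds (mem_sector X hθ₀ hr)] with x hx
  obtain ⟨⟨θ, ρ⟩, ⟨hθ, hρ⟩, rfl⟩ := hx
  rw [hF' θ hθ ρ hρ]
  simp only [Function.comp_apply, X.symm_φ θ hρ]

/-- On the end, the form `α - dF` is the pull-back of the restriction of `α` to a slice. -/
theorem IsRadial.comp_mfderiv_eq {F : L → ℝ} (hF : X.IsRadial i α F) {γ : OneField (𝓡 m) L}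
    {θ : Λ i} {r : ℝ} (hr : r ∈ openRange (X.b i) i)
    (hγ : HasMFDerivAt (𝓡 m) 𝓘(ℝ, ℝ) F (X.φ i (θ, r)) (γ (X.φ i (θ, r)))) :
    ((α - γ) (X.φ i (θ, r))).comp (mfderiv (coneModel (m - 1)) (𝓡 m) (X.φ i) (θ, r)) =
      (X.slice i α θ).comp (mfderiv (coneModel (m - 1)) (𝓡 (m - 1)) Prod.fst (θ, r)) := by
  obtain ⟨U, hU, hθ, u, hu, hF'⟩ := hF θ
  have h1 := ((hu _ (mem_sector X hθ hr)).sub hγ).comp (θ, r)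
    (X.mdifferentiableAt_φ θ hr).hasMFDerivAt
  have h2 := (IsPrim.hasMFDerivAt_slice hu hθ).comp (θ, r)
    (mdifferentiableAt_fst (I := 𝓡 (m - 1)) (I' := 𝓘(ℝ, ℝ)) (x := (θ, r))).hasMFDerivAt
  refine hasMFDerivAt_unique h1 (h2.congr_of_eventuallyEq ?_)
  filter_upwards [(hU.prod (isOpen_openRange _ i)).mem_nhds (show (θ, r) ∈ _ from ⟨hθ, hr⟩)]
    with q hq
  simp only [Function.comp_apply, Pi.sub_apply, hF' q.1 hq.1 q.2 hq.2]
  ring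

end Radial

end CSACManifold

/-! ### Finite dimensionality of the first cohomology group -/

/-- A locally constant function on an open set is determined, on a compact subset, by its values at
finitely many points. -/
theorem exists_finset_forall_eq_zero {Y : Type*} [TopologicalSpace Y] [LocallyConnectedSpace Y]
    {S B : Set Y} (hS : IsCompact S) (hB : IsOpen B) (hSB : S ⊆ B) :
    ∃ t : Finset Y, ∀ c : Y → ℝ, (∀ x ∈ B, ∀ᶠ z in 𝓝 x, c z = c x) → (∀ p ∈ t, c p = 0) →
      ∀ x ∈ S, c x = 0 := by
  obtain ⟨t, ht, hcov⟩ := hS.elim_nhds_subcover (fun x => connectedComponentIn B x) fun x hx =>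
    hB.connectedComponentIn.mem_nhds (mem_connectedComponentIn (hSB hx))
  refine ⟨t, fun c hc h0 x hx => ?_⟩
  obtain ⟨p, hp, hxp⟩ := mem_iUnion₂.1 (hcov hx)
  rw [← h0 p hp]
  exact eq_of_isPreconnected isPreconnected_connectedComponentIn (fun z hz =>
    (hc z (connectedComponentIn_subset B p hz)).filter_mono nhdsWithin_le_nhds) hxp
    (mem_connectedComponentIn (hSB (ht p hp)))

section Algebra

variable {E H : Type*} [NormedAddCommGroup E] [NormedSpace ℝ E] [TopologicalSpace H]
  {I : ModelWithCorners ℝ E H} {M : Type*} [TopologicalSpace M] [ChartedSpace H M]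

theorem IsPrim.const_smul {α : OneField I M} {S : Set M} {u : M → ℝ} (h : IsPrim α S u) (c : ℝ) :
    IsPrim (c • α) S (fun x => c * u x) := fun x hx => (h x hx).const_smul c

theorem isPrim_zero (S : Set M) : IsPrim (0 : OneField I M) S (fun _ => 0) :=
  fun x _ => hasMFDerivAt_const 0 x

variable [I.Boundaryless] [IsManifold I ∞ M]

/-- A choice of representatives: a space of closed forms whose classes span a finite-dimensional
space contains a finite-dimensional space that is mapped isomorphically onto that span. -/
theorem exists_bijOn_mkQ [FiniteDimensional ℝ (H1 I M)] (W : Submodule ℝ (closedForms I M)) :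
    ∃ V ≤ W, FiniteDimensional ℝ V ∧
      BijOn (exactForms I M).mkQ V (W.map (exactForms I M).mkQ) := by
  set f := (exactForms I M).mkQ ∘ₗ W.subtype
  obtain ⟨g, hg⟩ := f.rangeRestrict.exists_rightInverse_of_surjective f.range_rangeRestrict
  have hg' : ∀ a, (exactForms I M).mkQ (g a) = a := fun a =>
    congrArg Subtype.val (LinearMap.congr_fun hg a)
  refine ⟨(LinearMap.range g).map W.subtype, Submodule.map_subtype_le _ _, inferInstance,
    ?_, ?_, ?_⟩
  · rintro _ ⟨w, -, rfl⟩
    exact ⟨w, w.2, rfl⟩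
  · rintro _ ⟨_, ⟨a, rfl⟩, rfl⟩ _ ⟨_, ⟨b, rfl⟩, rfl⟩ hab
    have : a = b := Subtype.ext ((hg' a).symm.trans (hab.trans (hg' b)))
    rw [this]
  · rintro _ ⟨w, hw, rfl⟩
    exact ⟨_, ⟨_, ⟨⟨_, ⟨⟨w, hw⟩, rfl⟩⟩, rfl⟩, rfl⟩, hg' _⟩

/-- The image of cohomology with supports consists of the classes of forms with supports. -/
theorem range_gammaMap (F : Filter M) :
    LinearMap.range (gammaMap I M F) = (closedFormsV I M F).map (exactForms I M).mkQ := by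
  ext a
  constructor
  · rintro ⟨b, rfl⟩
    obtain ⟨w, rfl⟩ := (exactFormsV I M F).mkQ_surjective b
    exact ⟨w, w.2, rfl⟩
  · rintro ⟨w, hw, rfl⟩
    exact ⟨(exactFormsV I M F).mkQ ⟨w, hw⟩, rfl⟩

theorem isSmoothForm_d (f : SmoothFun I M) : IsSmoothForm (d I M f) := fun x => by
  refine (contMDiffAt_hom_bundle _).2 ⟨contMDiffAt_id, ?_⟩
  have h := (f.contMDiff x).mfderiv_const (m := ∞) (by simp)
  refine h.congr_of_eventuallyEq (Eventually.of_forall fun y => ?_)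
  simp only [inTangentCoordinates, ContinuousLinearMap.inCoordinates,
    TangentBundle.continuousLinearMapAt_model_space]
  ext v
  simp
  rfl

/-- Exact forms are closed. -/
theorem d_mem_closedForms (f : SmoothFun I M) : d I M f ∈ closedForms I M := by
  refine ⟨isSmoothForm_d f, fun p u v => ?_⟩
  have h1 := contDiffOn_comp_extChartAt_symm f p
  have h2 : chartForm I p (d I M f) =ᶠ[𝓝 (extChartAt I p p)]
      fderiv ℝ fun y => f ((extChartAt I p).symm y) := by
    filter_upwards [extChartAt_target_mem_nhds (I := I) p] with y hy
    exact ((isPrim_d f univ).hasFDerivAt_comp (f := (extChartAt I p).symm) (mem_univ _)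
      (((contMDiffOn_extChartAt_symm (n := ∞) p).contMDiffAt
        ((isOpen_extChartAt_target p).mem_nhds hy)).mdifferentiableAt (by simp))).fderiv.symm
  rw [h2.fderiv_eq]
  exact ((h1.contDiffAt (extChartAt_target_mem_nhds p)).isSymmSndFDerivAt
    (by simpa using! (mod_cast le_top : ((2 : ℕ∞) : WithTop ℕ∞) ≤ ∞))) u v

theorem mkQ_eq_iff {α β : closedForms I M} : (exactForms I M).mkQ α = (exactForms I M).mkQ β ↔
    ∃ f : SmoothFun I M, d I M f = (α : OneField I M) - β := by
  rw [Submodule.mkQ_apply, Submodule.mkQ_apply, Submodule.Quotient.eq]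
  rfl

end Algebra

/-- Every point has a neighbourhood on which all closed forms are exact. -/
theorem exists_isOpen_forall_isPrim {n : ℕ} {M : Type*} [TopologicalSpace M]
    [ChartedSpace (Model n) M] [IsManifold (𝓡 n) ∞ M] (x : M) :
    ∃ B : Set M, IsOpen B ∧ x ∈ B ∧ ∀ α ∈ closedForms (𝓡 n) M, ∃ u, IsPrim α B u := by
  set c := chartAt (Model n) x
  obtain ⟨ε, hε, hball⟩ := Metric.isOpen_iff.1 c.open_target _ (mem_chart_target _ x)
  refine ⟨c.symm '' Metric.ball (c x) ε,
    c.symm.isOpen_image_of_subset_source Metric.isOpen_ball hball,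
    ⟨c x, Metric.mem_ball_self hε, c.left_inv (mem_chart_source _ x)⟩, fun α hα => ?_⟩
  exact exists_isPrim_image_convex c.symm (contMDiffOn_chart_symm (I := 𝓡 n) (x := x))
    (contMDiffOn_chart (I := 𝓡 n) (x := x)) (convex_ball _ _) Metric.isOpen_ball hball hα

namespace CSACManifold

variable {m s l : ℕ}
  {L : Type*} [TopologicalSpace L] [ChartedSpace (Model m) L] [IsManifold (𝓡 m) ∞ L]
  {Λ : Fin s ⊕ Fin l → Type*} [∀ i, TopologicalSpace (Λ i)]
  [∀ i, ChartedSpace (Model (m - 1)) (Λ i)] [∀ i, IsManifold (𝓡 (m - 1)) ∞ (Λ i)]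
  [∀ i, CompactSpace (Λ i)]
  (X : CSACManifold m s l L Λ)

/-- The closed end. -/
def closedEnd (i : Fin s ⊕ Fin l) : Set L := X.φ i '' (univ ×ˢ closedRange (X.a i) i)

theorem isClosed_closedEnd (i : Fin s ⊕ Fin l) : IsClosed (X.closedEnd i) := by
  rw [closedEnd, ← X.closure_eq]
  exact isClosed_closure

theorem endSet_subset_closedEnd (i : Fin s ⊕ Fin l) : X.endSet i ⊆ X.closedEnd i :=
  image_mono (prod_mono_right (openRange_subset_closedRange _ _))

theorem closedEnd_subset_sector (i : Fin s ⊕ Fin l) : X.closedEnd i ⊆ X.sector i univ :=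
  image_mono (prod_mono_right (X.closedRange_subset i))

theorem notMem_closedEnd {i j : Fin s ⊕ Fin l} (hij : i ≠ j) {x : L} (hx : x ∈ X.closedEnd i) :
    x ∉ X.closedEnd j := disjoint_left.1 (X.disjoint hij) hx

theorem eq_of_mem_endSet {i j : Fin s ⊕ Fin l} {x : L} (hi : x ∈ X.endSet i) (hj : x ∈ X.endSet j) :
    i = j := by
  by_contra hij
  exact X.notMem_closedEnd hij (X.endSet_subset_closedEnd i hi) (X.endSet_subset_closedEnd j hj)

theorem eq_of_mem_closedRange {i : Fin s ⊕ Fin l} {a r : ℝ} (h : r ∈ closedRange a i)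
    (h' : r ∉ openRange a i) : r = a := by
  rcases i with i | i
  · have h1 : r ∈ Ioc 0 a := h
    have h2 : r ∉ Ioo 0 a := h'
    by_contra hne
    exact h2 ⟨h1.1, lt_of_le_of_ne h1.2 hne⟩
  · have h1 : a ≤ r := h
    have h2 : ¬ a < r := h'
    linarith

theorem notMem_openRange_self {i : Fin s ⊕ Fin l} (a : ℝ) : a ∉ openRange a i := by
  rcases i with i | i
  · exact fun h => lt_irrefl a (show a ∈ Ioo 0 a from h).2
  · exact fun h => lt_irrefl a (show a < a from h)

/-- The complement of the ends. -/
def core : Set L := (⋃ i, X.endSet i)ᶜ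

theorem notMem_endSet_of_mem_core {x : L} (hx : x ∈ X.core) (i : Fin s ⊕ Fin l) :
    x ∉ X.endSet i := fun h => hx (mem_iUnion.2 ⟨i, h⟩)

theorem slice_mem_core {i : Fin s ⊕ Fin l} (θ : Λ i) : X.φ i (θ, X.a i) ∈ X.core := by
  intro h
  obtain ⟨j, hj⟩ := mem_iUnion.1 h
  have h1 : X.φ i (θ, X.a i) ∈ X.closedEnd i :=
    ⟨_, ⟨mem_univ _, mem_closedRange_self (X.a_pos i) i⟩, rfl⟩
  by_cases hij : i = j
  · subst hij
    obtain ⟨⟨θ', r⟩, ⟨-, hr⟩, heq⟩ := hj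
    have := (X.φ i).injOn (X.mem_source θ' (X.openRange_subset i hr)) (X.mem_source θ (X.a_mem i))
      heq
    rw [Prod.mk.injEq] at this
    exact notMem_openRange_self (X.a i) (i := i) (this.2 ▸ hr)
  · exact X.notMem_closedEnd hij h1 (X.endSet_subset_closedEnd j hj)

variable {X} in
/-- A closed form that is exact near the complement of the ends is exact. -/
theorem exists_isPrim_univ_of_core {α : OneField (𝓡 m) L} (hα : α ∈ closedForms (𝓡 m) L)
    {V : Set L} (hV : IsOpen V) (hKV : X.core ⊆ V) {h : L → ℝ} (hh : IsPrim α V h) :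
    ∃ u, IsPrim α univ u := by
  classical
  choose F hF using fun i => exists_isRadial (X := X) (i := i) hα
  -- near the ray over `θ₀`, the sum of `h` on the slice and of the radial integral is a primitive
  have key : ∀ i (θ₀ : Λ i), ∃ U : Set (Λ i), IsOpen U ∧ θ₀ ∈ U ∧ ∃ u : L → ℝ,
      IsPrim α (X.sector i U) u ∧ (∀ᶠ z in 𝓝 (X.φ i (θ₀, X.a i)), h z = u z) ∧
      ∀ θ ∈ U, ∀ r ∈ openRange (X.b i) i,
        h (X.φ i (θ, X.a i)) + F i (X.φ i (θ, r)) = u (X.φ i (θ, r)) := by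
    intro i θ₀
    obtain ⟨U, hU, hθ₀, u, hu, hF'⟩ := hF i θ₀
    set x₀ := X.φ i (θ₀, X.a i)
    have hx₀ : x₀ ∈ X.sector i U ∩ V :=
      ⟨mem_sector X hθ₀ (X.a_mem i), hKV (X.slice_mem_core θ₀)⟩
    have h1 : ∀ᶠ z in 𝓝 x₀, h z - u z = h x₀ - u x₀ :=
      (hh.mono inter_subset_right).sub_eventually_eq ((X.isOpen_sector i hU).inter hV)
        (hu.mono inter_subset_left) hx₀
    have h2 : ContinuousAt (fun θ => X.φ i (θ, X.a i)) θ₀ := (contMDiffAt_slice θ₀).continuousAt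
    obtain ⟨W, hW, hWo, hθW⟩ := eventually_nhds_iff.1 ((h2.eventually h1).and (hU.mem_nhds hθ₀))
    refine ⟨W, hWo, hθW, fun x => u x + (h x₀ - u x₀),
      (hu.add_const _).mono (image_mono (prod_mono_left fun θ hθ => (hW θ hθ).2)), ?_, ?_⟩
    · filter_upwards [h1] with z hz
      linarith
    · intro θ hθ r hr
      have h3 := (hW θ hθ).1
      rw [hF' θ (hW θ hθ).2 r hr]
      linarith
  -- the primitive is `h` on the complement of the ends, and the sum above on the ends
  set w : L → ℝ := fun x => if hx : ∃ i, x ∈ X.endSet i then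
    h (X.φ hx.choose (((X.φ hx.choose).symm x).1, X.a hx.choose)) + F hx.choose x else h x
  have hw : ∀ i (θ : Λ i), ∀ r ∈ openRange (X.a i) i,
      w (X.φ i (θ, r)) = h (X.φ i (θ, X.a i)) + F i (X.φ i (θ, r)) := by
    intro i θ r hr
    have hx : ∃ j, X.φ i (θ, r) ∈ X.endSet j := ⟨i, X.mem_endSet hr θ⟩
    have hj : hx.choose = i := X.eq_of_mem_endSet hx.choose_spec (X.mem_endSet hr θ)
    simp only [w, dif_pos hx]
    rw [hj, X.symm_φ θ (X.openRange_subset i hr)]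
  have hw' : ∀ x ∈ X.core, w x = h x := fun x hx =>
    dif_neg fun ⟨i, hi⟩ => X.notMem_endSet_of_mem_core hx i hi
  refine ⟨w, fun x _ => ?_⟩
  by_cases hx : x ∈ X.core
  · refine (hh x (hKV hx)).congr_of_eventuallyEq ?_
    by_cases hc : ∃ i, x ∈ X.closedEnd i
    · -- at the boundary of an end both definitions of `w` agree with one local primitive
      obtain ⟨i, ⟨θ₀, r⟩, ⟨-, hr⟩, rfl⟩ := hc
      obtain rfl : r = X.a i := eq_of_mem_closedRange hr fun hr' =>
        X.notMem_endSet_of_mem_core hx i (X.mem_endSet hr' θ₀)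
      obtain ⟨U, hU, hθ₀, u, hu, huh, hu'⟩ := key i θ₀
      have h1 : ∀ᶠ z in 𝓝 (X.φ i (θ₀, X.a i)), ∀ j, j ≠ i → z ∉ X.closedEnd j := by
        refine eventually_all.2 fun j => ?_
        by_cases hji : j = i
        · simp [hji]
        · filter_upwards [(X.isClosed_closedEnd j).isOpen_compl.mem_nhds
            (X.notMem_closedEnd (Ne.symm hji) ⟨_, ⟨mem_univ θ₀, hr⟩, rfl⟩)] with z hz _ using hz
      filter_upwards [huh, h1, (X.isOpen_sector i hU).mem_nhds (mem_sector X hθ₀ (X.a_mem i))]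
        with z hz hzj hzU
      by_cases hzc : z ∈ X.core
      · exact hw' z hzc
      · obtain ⟨j, hj⟩ := mem_iUnion.1 (not_not.1 hzc)
        obtain rfl : j = i := by
          by_contra hji
          exact hzj j hji (X.endSet_subset_closedEnd j hj)
        obtain ⟨⟨θ, ρ⟩, ⟨hθ, hρ⟩, rfl⟩ := hzU
        obtain ⟨⟨θ', ρ'⟩, ⟨-, hρ'⟩, heq⟩ := hj
        obtain ⟨rfl, rfl⟩ := Prod.mk.inj ((X.φ j).injOn
          (X.mem_source θ' (X.openRange_subset j hρ')) (X.mem_source θ hρ) heq)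
        rw [hw j θ' ρ' hρ', hu' θ' hθ ρ' hρ, hz]
    · push Not at hc
      have : ∀ᶠ z in 𝓝 x, ∀ i, z ∉ X.closedEnd i := eventually_all.2 fun i =>
        (X.isClosed_closedEnd i).isOpen_compl.mem_nhds (hc i)
      filter_upwards [this] with z hz
      refine hw' z fun hz' => ?_
      obtain ⟨i, hi⟩ := mem_iUnion.1 hz'
      exact hz i (X.endSet_subset_closedEnd i hi)
  · obtain ⟨i, ⟨θ₀, r⟩, ⟨-, hr⟩, rfl⟩ := mem_iUnion.1 (not_not.1 hx)
    obtain ⟨U, hU, hθ₀, u, hu, huh, hu'⟩ := key i θ₀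
    refine (hu _ (mem_sector X hθ₀ (X.openRange_subset i hr))).congr_of_eventuallyEq ?_
    filter_upwards [((X.φ i).isOpen_image_of_subset_source (hU.prod (isOpen_openRange (X.a i) i))
      fun q hq => X.mem_source q.1 (X.openRange_subset i hq.2)).mem_nhds
        (mem_image_of_mem _ (show (θ₀, r) ∈ U ×ˢ openRange (X.a i) i from ⟨hθ₀, hr⟩))] with z hz
    obtain ⟨⟨θ, ρ⟩, ⟨hθ, hρ⟩, rfl⟩ := hz
    rw [hw i θ ρ hρ, hu' θ hθ ρ (X.openRange_subset i hρ)]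

/-- The first cohomology group is finite-dimensional: a closed form is determined, up to exact
ones, by the jumps of its local primitives on finitely many coordinate balls that cover the
complement of the ends. -/
theorem finiteDimensional_H1 [T2Space L] (X : CSACManifold m s l L Λ) :
    FiniteDimensional ℝ (H1 (𝓡 m) L) := by
  have := ChartedSpace.locallyCompactSpace (Model m) L
  have := ChartedSpace.locallyConnectedSpace (Model m) L
  choose B hBo hB hBp using exists_isOpen_forall_isPrim (n := m) (M := L)
  choose K hK hxK hKB using fun x => exists_compact_subset (hBo x) (hB x)
  obtain ⟨t, -, ht⟩ := X.isCompact_core.elim_nhds_subcover (fun x => interior (K x)) fun x _ =>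
    isOpen_interior.mem_nhds (hxK x)
  choose P hP using fun x y => exists_finset_forall_eq_zero ((hK x).inter (hK y))
    ((hBo x).inter (hBo y)) (inter_subset_inter (hKB x) (hKB y))
  -- closed forms together with primitives on the balls
  let A : Submodule ℝ (closedForms (𝓡 m) L × (L → L → ℝ)) :=
    { carrier := {q | ∀ x ∈ t, IsPrim (q.1 : OneField (𝓡 m) L) (B x) (q.2 x)}
      zero_mem' := fun x _ => isPrim_zero (B x)
      add_mem' := fun hq hq' x hx => (hq x hx).add (hq' x hx)
      smul_mem' := fun c q hq x hx => (hq x hx).const_smul c }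
  let jump : A →ₗ[ℝ] (Σ x : t, Σ y : t, P x y) → ℝ :=
    { toFun := fun q j => q.1.2 j.1 j.2.2 - q.1.2 j.2.1 j.2.2
      map_add' := fun q q' => by
        funext j
        simp only [Submodule.coe_add, Prod.snd_add, Pi.add_apply]
        ring
      map_smul' := fun c q => by
        funext j
        simp only [Submodule.coe_smul, Prod.smul_snd, Pi.smul_apply, smul_eq_mul,
          RingHom.id_apply]
        ring }
  let cls : A →ₗ[ℝ] H1 (𝓡 m) L :=
    (exactForms (𝓡 m) L).mkQ ∘ₗ LinearMap.fst ℝ _ _ ∘ₗ A.subtype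
  have hcls : Function.Surjective cls := by
    intro a
    obtain ⟨α, rfl⟩ := (exactForms (𝓡 m) L).mkQ_surjective a
    choose u hu using fun x => hBp x α α.2
    exact ⟨⟨(α, u), fun x _ => hu x⟩, rfl⟩
  -- without jumps the local primitives fit together near the complement of the ends
  have hker : LinearMap.ker jump ≤ LinearMap.ker cls := by
    rintro ⟨⟨α, h⟩, hq⟩ hj
    have hq' : ∀ x ∈ t, IsPrim (α : OneField (𝓡 m) L) (B x) (h x) := hq
    have hjump : ∀ x ∈ t, ∀ y ∈ t, ∀ p ∈ P x y, h x p - h y p = 0 := fun x hx y hy p hp =>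
      congrFun hj ⟨⟨x, hx⟩, ⟨y, hy⟩, ⟨p, hp⟩⟩
    have heq : ∀ x ∈ t, ∀ y ∈ t, ∀ z ∈ K x ∩ K y, h x z = h y z := fun x hx y hy z hz =>
      sub_eq_zero.1 (hP x y (fun z => h x z - h y z) (fun z hz =>
        ((hq' x hx).mono inter_subset_left).sub_eventually_eq ((hBo x).inter (hBo y))
          ((hq' y hy).mono inter_subset_right) hz) (hjump x hx y hy) z hz)
    have hchoice : ∀ z, ∃ x, z ∈ ⋃ x ∈ t, interior (K x) → x ∈ t ∧ z ∈ K x := by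
      intro z
      by_cases hz : z ∈ ⋃ x ∈ t, interior (K x)
      · obtain ⟨x, hx, hzx⟩ := mem_iUnion₂.1 hz
        exact ⟨x, fun _ => ⟨hx, interior_subset hzx⟩⟩
      · exact ⟨z, fun h => absurd h hz⟩
    choose x hx using hchoice
    have hprim : IsPrim (α : OneField (𝓡 m) L) (⋃ x ∈ t, interior (K x)) fun z => h (x z) z := by
      intro z hz
      obtain ⟨y, hy, hzy⟩ := mem_iUnion₂.1 hz
      refine (hq' y hy z (hKB y (interior_subset hzy))).congr_of_eventuallyEq ?_
      filter_upwards [isOpen_interior.mem_nhds hzy] with z' hz'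
      have hz'' := hx z' (mem_iUnion₂.2 ⟨y, hy, hz'⟩)
      exact heq _ hz''.1 y hy z' ⟨hz''.2, interior_subset hz'⟩
    obtain ⟨u, hu⟩ := exists_isPrim_univ_of_core (X := X) α.2
      (isOpen_biUnion fun _ _ => isOpen_interior) ht hprim
    exact (Submodule.Quotient.mk_eq_zero _).2 ⟨hu.toSmoothFun α.2.1, hu.d_toSmoothFun α.2.1⟩
  have hfac : Function.Surjective ((LinearMap.ker jump).liftQ cls hker) := by
    intro a
    obtain ⟨q, hq⟩ := hcls a
    exact ⟨(LinearMap.ker jump).mkQ q, hq⟩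
  have := LinearEquiv.finiteDimensional jump.quotKerEquivRange.symm
  exact Module.Finite.of_surjective _ hfac

/-! ### Cut-off functions and the representatives -/

variable [T2Space L] [SecondCountableTopology L]

/-- A cut-off function for an end, supported in the extended end. -/
theorem exists_cutoff (X : CSACManifold m s l L Λ) (i : Fin s ⊕ Fin l) :
    ∃ χ : SmoothFun (𝓡 m) L, X.IsEndFunction i χ ∧ ∀ x ∉ X.sector i univ, ∀ᶠ z in 𝓝 x, χ z = 0 := by
  have := ChartedSpace.locallyCompactSpace (Model m) L
  have hZ : IsClosed ((X.sector i univ)ᶜ ∪ ⋃ j ∈ {j | j ≠ i}, X.closedEnd j) :=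
    (X.isOpen_sector i isOpen_univ).isClosed_compl.union
      ((Set.toFinite _).isClosed_biUnion fun j _ => X.isClosed_closedEnd j)
  obtain ⟨χ, h0, h1, -⟩ := exists_contMDiffMap_zero_one_nhds_of_isClosed (n := ⊤) (𝓡 m) hZ
    (X.isClosed_closedEnd i) (by
      rw [disjoint_union_left]
      refine ⟨disjoint_left.2 fun x hx hx' => hx (X.closedEnd_subset_sector i hx'),
        disjoint_left.2 fun x hx hx' => ?_⟩
      obtain ⟨j, hj, hxj⟩ := mem_iUnion₂.1 hx
      exact X.notMem_closedEnd hj hxj hx')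
  refine ⟨χ, ⟨fun x hx => (eventually_nhdsSet_iff_forall.1 h1 x
    (X.endSet_subset_closedEnd i hx)).self_of_nhds, fun j hj x hx => ?_⟩, fun x hx => ?_⟩
  · exact (eventually_nhdsSet_iff_forall.1 h0 x (Or.inr (mem_iUnion₂.2
      ⟨j, hj, X.endSet_subset_closedEnd j hx⟩))).self_of_nhds
  · exact eventually_nhdsSet_iff_forall.1 h0 x (Or.inl hx)

/-- A function that is smooth on an extended end can be extended from the end to a smooth
function that vanishes on all other ends. -/
theorem exists_extension (X : CSACManifold m s l L Λ) (i : Fin s ⊕ Fin l) {F : L → ℝ}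
    (hF : ContMDiffOn (𝓡 m) 𝓘(ℝ, ℝ) ∞ F (X.sector i univ)) :
    ∃ f : SmoothFun (𝓡 m) L, (∀ x ∈ X.endSet i, f x = F x) ∧
      ∀ j ≠ i, ∀ x ∈ X.endSet j, f x = 0 := by
  obtain ⟨χ, ⟨h1, h2⟩, h3⟩ := X.exists_cutoff i
  refine ⟨⟨fun x => χ x * F x, fun x => ?_⟩, fun x hx => ?_, fun j hj x hx => ?_⟩
  · by_cases hx : x ∈ X.sector i univ
    · exact (χ.contMDiff x).mul
        (hF.contMDiffAt ((X.isOpen_sector i isOpen_univ).mem_nhds hx))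
    · refine (contMDiffAt_const (c := (0 : ℝ))).congr_of_eventuallyEq ?_
      filter_upwards [h3 x hx] with z hz
      rw [hz, zero_mul]
  · change χ x * F x = F x
    rw [h1 x hx, one_mul]
  · change χ x * F x = 0
    rw [h2 j hj x hx, zero_mul]

/-- Functions given on the extended ends can be simultaneously extended from the ends. -/
theorem exists_extension_sum (X : CSACManifold m s l L Λ) {F : Fin s ⊕ Fin l → L → ℝ}
    (hF : ∀ i, ContMDiffOn (𝓡 m) 𝓘(ℝ, ℝ) ∞ (F i) (X.sector i univ)) :
    ∃ f : SmoothFun (𝓡 m) L, ∀ i, ∀ x ∈ X.endSet i, f x = F i x := by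
  choose f hf hf' using fun i => X.exists_extension i (hF i)
  refine ⟨∑ i, f i, fun i x hx => ?_⟩
  rw [← hf i x hx, ← ContMDiffMap.coeFnAddMonoidHom_apply, map_sum, Finset.sum_apply]
  exact Finset.sum_eq_single i (fun j _ hj => hf' j i hj.symm x hx) (by simp)

theorem exists_isRepCompact (X : CSACManifold m s l L Λ) :
    ∃ V : Submodule ℝ (closedForms (𝓡 m) L), IsRepCompact V := by
  have := X.finiteDimensional_H1
  obtain ⟨V, hV, h1, h2⟩ := exists_bijOn_mkQ (closedFormsV (𝓡 m) L (cocompact L))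
  exact ⟨V, h1, hV, by rwa [range_gammaMap]⟩

/-- The closed forms that are translation-invariant on the AC ends. -/
def invariantForms (X : CSACManifold m s l L Λ) : Submodule ℝ (closedForms (𝓡 m) L) where
  carrier := {α | ∀ i, X.IsTranslationInvariant (α : OneField (𝓡 m) L) i}
  zero_mem' := fun i => ⟨0, fun θ r _ => by
    ext v; rfl⟩
  add_mem' := by
    intro α β hα hβ i
    obtain ⟨η, hη⟩ := hα i
    obtain ⟨ξ, hξ⟩ := hβ i
    refine ⟨η + ξ, fun θ r hr => ?_⟩
    ext v
    exact congrArg₂ (· + ·) (congrArg (fun A => A v) (hη θ r hr))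
      (congrArg (fun A => A v) (hξ θ r hr))
  smul_mem' := by
    intro c α hα i
    obtain ⟨η, hη⟩ := hα i
    refine ⟨c • η, fun θ r hr => ?_⟩
    ext v
    exact congrArg (c * ·) (congrArg (fun A => A v) (hη θ r hr))

end CSACManifold

section Algebra

variable {E H : Type*} [NormedAddCommGroup E] [NormedSpace ℝ E] [TopologicalSpace H]
  {I : ModelWithCorners ℝ E H} {M : Type*} [TopologicalSpace M] [ChartedSpace H M]

theorem d_apply_eq {α : OneField I M} {S : Set M} (hS : IsOpen S) {u : M → ℝ} (hu : IsPrim α S u)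
    {f : SmoothFun I M} (hf : ∀ x ∈ S, f x = u x) {x : M} (hx : x ∈ S) : d I M f x = α x :=
  hasMFDerivAt_unique (isPrim_d f S x hx) (hu.congr hS hf x hx)

theorem d_apply_eq_zero {S : Set M} (hS : IsOpen S) {c : ℝ} {f : SmoothFun I M}
    (hf : ∀ x ∈ S, f x = c) {x : M} (hx : x ∈ S) : d I M f x = 0 :=
  d_apply_eq (α := 0) hS (fun x _ => hasMFDerivAt_const c x) hf hx

end Algebra

namespace CSACManifold

variable {m s l : ℕ}
  {L : Type*} [TopologicalSpace L] [ChartedSpace (Model m) L] [IsManifold (𝓡 m) ∞ L]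
  {Λ : Fin s ⊕ Fin l → Type*} [∀ i, TopologicalSpace (Λ i)]
  [∀ i, ChartedSpace (Model (m - 1)) (Λ i)] [∀ i, IsManifold (𝓡 (m - 1)) ∞ (Λ i)]
  {X : CSACManifold m s l L Λ}

theorem eventually_singFilter {p : L → Prop} : (∀ᶠ x in X.singFilter, p x) ↔
    ∀ i : Fin s, ∀ᶠ r in endFilter (Sum.inl i : Fin s ⊕ Fin l), ∀ θ,
      p (X.φ (Sum.inl i) (θ, r)) := by
  simp only [singFilter, eventually_iSup, eventually_map, top_prod, eventually_comap]
  refine forall_congr' fun i => eventually_congr (Eventually.of_forall fun r => ?_)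
  constructor
  · exact fun h θ => h (θ, r) rfl
  · rintro h ⟨θ, r'⟩ rfl
    exact h θ

/-- A tensor field that vanishes far along an end satisfies all bounds there. -/
theorem exists_covDerivBound_of_eventually_zero {n : ℕ}
    {T : (x : L) → (Fin n → TangentSpace (𝓡 m) x) → ℝ} {i : Fin s ⊕ Fin l}
    (h : ∀ᶠ r in endFilter i, ∀ θ, T (X.φ i (θ, r)) = fun _ => 0) (β : ℝ) (k : ℕ) :
    ∃ C : ℝ, ∀ᶠ r in endFilter i, ∀ θ : Λ i,
      CovDerivBound (𝓡 m) X.g.inner T k (X.φ i (θ, r)) (C * r ^ (β - k)) := by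
  obtain ⟨r₀, hr₀, hsub, h'⟩ := exists_openRange_of_eventually h (X.a_pos i)
  have hO : IsOpen (X.φ i '' (univ ×ˢ openRange r₀ i)) :=
    (X.φ i).isOpen_image_of_subset_source (isOpen_univ.prod (isOpen_openRange _ i))
      ((prod_mono_right (hsub.trans (openRange_subset_closedRange _ i))).trans (X.range_source i))
  refine ⟨0, ?_⟩
  filter_upwards [eventually_endFilter_openRange hr₀ i] with r hr θ
  rw [zero_mul]
  refine (covDerivBound_zero_field k _ le_rfl).congr_field hO ⟨(θ, r), ⟨mem_univ _, hr⟩, rfl⟩ ?_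
  rintro _ ⟨⟨θ', r'⟩, ⟨-, hr'⟩, rfl⟩
  exact h' r' hr' θ'

/-- A function is in `C^∞_β` if it is `O(r^β)` and is, on the ends, a primitive of a form in
`C^∞_{β-1}`. -/
theorem mem_weightedFun_of_isWeighted {β : Fin s ⊕ Fin l → ℝ} {w : SmoothFun (𝓡 m) L}
    {α : OneField (𝓡 m) L} (hα : X.IsWeighted (fun i => β i - 1) (formTensor (𝓡 m) α))
    (hw : ∀ i, ∀ x ∈ X.endSet i, d (𝓡 m) L w x = α x)
    (hb : ∀ i, ∃ C : ℝ, ∀ᶠ r in endFilter i, ∀ θ, |w (X.φ i (θ, r))| ≤ C * r ^ β i) :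
    w ∈ X.weightedFun β :=
  mem_weightedFun_iff.2 ⟨hb, hα.congr fun i x hx => by
    funext v
    exact congrArg (fun A => A (v 0)) (hw i x hx)⟩

variable [∀ i, CompactSpace (Λ i)]

/-- The ends leave every compact subset. -/
theorem eventually_of_cocompact [T2Space L] {p : L → Prop} (hp : ∀ᶠ x in cocompact L, p x)
    (i : Fin s ⊕ Fin l) : ∀ᶠ r in endFilter i, ∀ θ, p (X.φ i (θ, r)) := by
  obtain ⟨K, hK, hKp⟩ := mem_cocompact.1 hp
  have h1 : IsCompact ((fun x => ((X.φ i).symm x).2) '' (K ∩ X.closedEnd i)) := by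
    refine (hK.inter_right (X.isClosed_closedEnd i)).image_of_continuousOn fun x hx => ?_
    obtain ⟨q, hq, rfl⟩ := hx.2
    exact (continuous_snd.continuousAt.comp ((X.φ i).continuousAt_symm
      ((X.φ i).map_source (X.range_source i hq)))).continuousWithinAt
  have h2 : ∀ᶠ r in endFilter i, r ∉ (fun x => ((X.φ i).symm x).2) '' (K ∩ X.closedEnd i) := by
    have hpos : ∀ r ∈ (fun x => ((X.φ i).symm x).2) '' (K ∩ X.closedEnd i), 0 < r := by
      rintro _ ⟨_, ⟨-, ⟨⟨θ, r⟩, hq, rfl⟩⟩, rfl⟩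
      simp only [(X.φ i).left_inv (X.range_source i hq)]
      exact (X.source_pos i (X.range_source i hq)).2
    rcases i with i | i
    · have h3 : ∀ᶠ r in 𝓝 (0 : ℝ), r ∉ (fun x => ((X.φ (Sum.inl i)).symm x).2) ''
          (K ∩ X.closedEnd (Sum.inl i)) :=
        h1.isClosed.isOpen_compl.mem_nhds fun h => lt_irrefl _ (hpos 0 h)
      exact h3.filter_mono nhdsWithin_le_nhds
    · obtain ⟨B, hB⟩ := h1.bddAbove
      exact (eventually_gt_atTop B).mono fun r hr h => absurd (hB h) (not_le.2 hr)
  filter_upwards [h2, eventually_endFilter_openRange (X.a_pos i) i] with r hr hr' θ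
  by_contra hc
  have h3 : X.φ i (θ, r) ∈ K := by
    by_contra hK'
    exact hc (hKp hK')
  refine hr ⟨_, ⟨h3, X.endSet_subset_closedEnd i (X.mem_endSet hr' θ)⟩, ?_⟩
  simp only [X.symm_φ θ (X.openRange_subset i hr')]

variable [T2Space L] [SecondCountableTopology L]

/-- Every class of forms that vanish near the singularities has a translation-invariant
representative, because subtracting the differential of the radial integral leaves on each AC end
the pull-back of a form on the link. -/
theorem exists_isRepSing (X : CSACManifold m s l L Λ) :
    ∃ V : Submodule ℝ (closedForms (𝓡 m) L), X.IsRepSing V := by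
  have := X.finiteDimensional_H1
  obtain ⟨V, hV, h1, h2⟩ :=
    exists_bijOn_mkQ (closedFormsV (𝓡 m) L X.singFilter ⊓ X.invariantForms)
  refine ⟨V, h1, hV.trans inf_le_left, fun α hα => (hV hα).2, ?_⟩
  rw [range_gammaMap]
  convert h2 using 2
  refine le_antisymm ?_ (Submodule.map_mono inf_le_left)
  rintro _ ⟨α, hα, rfl⟩
  -- subtract the differential of the radial integral on the AC ends
  choose F hF using fun i => exists_isRadial (X := X) (i := i) α.2
  obtain ⟨f, hf⟩ := X.exists_extension_sum
    (F := Sum.elim (fun _ _ => 0) fun i => F (Sum.inr i)) (by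
      rintro (i | i)
      · exact contMDiffOn_const
      · exact (hF (Sum.inr i)).contMDiffOn α.2.1)
  refine ⟨α - ⟨d (𝓡 m) L f, d_mem_closedForms f⟩, ⟨?_, fun i => ?_⟩, ?_⟩
  · refine eventually_singFilter.2 fun i => ?_
    filter_upwards [eventually_singFilter.1 hα i,
      eventually_endFilter_openRange (X.a_pos (Sum.inl i)) (Sum.inl i)] with r h3 h4 θ
    have h5 := d_apply_eq_zero (X.isOpen_endSet (Sum.inl i)) (hf (Sum.inl i)) (X.mem_endSet h4 θ)
    change (α : OneField (𝓡 m) L) (X.φ (Sum.inl i) (θ, r)) -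
      d (𝓡 m) L f (X.φ (Sum.inl i) (θ, r)) = 0
    rw [h3 θ, h5, sub_zero]
  · refine ⟨X.slice (Sum.inr i) α, fun θ r hr => ?_⟩
    refine (hF (Sum.inr i)).comp_mfderiv_eq (γ := d (𝓡 m) L f)
      (X.openRange_subset (Sum.inr i) hr) ?_
    refine (isPrim_d f _ _ (X.mem_endSet (i := Sum.inr i) hr θ)).congr_of_eventuallyEq ?_
    filter_upwards [(X.isOpen_endSet (Sum.inr i)).mem_nhds (X.mem_endSet (i := Sum.inr i) hr θ)]
      with z hz
    exact (hf (Sum.inr i) z hz).symm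
  · refine mkQ_eq_iff.2 ⟨-f, ?_⟩
    rw [map_neg]
    change -d (𝓡 m) L f = (α : OneField (𝓡 m) L) - d (𝓡 m) L f - α
    abel

/-- Cut-off functions of the ends, one of which is changed away from the ends so that the sum is
`1`. -/
theorem exists_endFunctions (hsl : 0 < s + l) (X : CSACManifold m s l L Λ) :
    ∃ f : Fin s ⊕ Fin l → SmoothFun (𝓡 m) L, (∀ i, X.IsEndFunction i (f i)) ∧ ∑ i, f i = 1 := by
  classical
  choose χ hχ _ using X.exists_cutoff
  obtain ⟨i₀⟩ : Nonempty (Fin s ⊕ Fin l) := by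
    rw [← Fintype.card_pos_iff]
    simpa using hsl
  have hsum : ∀ (t : Finset (Fin s ⊕ Fin l)) (x : L), (∑ i ∈ t, χ i) x = ∑ i ∈ t, χ i x := by
    intro t x
    rw [← ContMDiffMap.coeFnAddMonoidHom_apply, map_sum, Finset.sum_apply]
    rfl
  refine ⟨Function.update χ i₀ (1 - ∑ i ∈ Finset.univ.erase i₀, χ i), fun i => ?_, ?_⟩
  · by_cases hi : i = i₀
    · subst hi
      rw [Function.update_self]
      refine ⟨fun x hx => ?_, fun j hj x hx => ?_⟩
      · change 1 - (∑ i ∈ Finset.univ.erase i, χ i) x = 1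
        rw [hsum, Finset.sum_eq_zero, sub_zero]
        exact fun j hj => (hχ j).2 i (Finset.ne_of_mem_erase hj).symm x hx
      · change 1 - (∑ i ∈ Finset.univ.erase i, χ i) x = 0
        rw [hsum, Finset.sum_eq_single_of_mem j (Finset.mem_erase.2 ⟨hj, Finset.mem_univ j⟩),
          (hχ j).1 x hx, sub_self]
        exact fun k _ hk => (hχ k).2 j hk.symm x hx
    · rw [Function.update_of_ne hi]
      exact hχ i
  · rw [Finset.sum_update_of_mem (Finset.mem_univ i₀), Finset.sdiff_singleton_eq_erase,
      sub_add_cancel]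

/-- On the ends in `A`, along which `r^β` tends to zero, a closed form in `C^∞_{β-1}` is the
differential of a smooth function on the manifold. -/
theorem exists_d_eq_on_ends {β : Fin s ⊕ Fin l → ℝ} {α : OneField (𝓡 m) L}
    (hα : α ∈ closedForms (𝓡 m) L)
    (hw : X.IsWeighted (fun i => β i - 1) (formTensor (𝓡 m) α)) {A : Set (Fin s ⊕ Fin l)}
    (hA : ∀ i ∈ A, Decays i (β i)) :
    ∃ f : SmoothFun (𝓡 m) L, ∀ i ∈ A, ∀ x ∈ X.endSet i, d (𝓡 m) L f x = α x := by
  have h1 : ∀ i, ∃ h : L → ℝ, ContMDiffOn (𝓡 m) 𝓘(ℝ, ℝ) ∞ h (X.sector i univ) ∧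
      (i ∈ A → IsPrim α (X.sector i univ) h) := by
    intro i
    by_cases hi : i ∈ A
    · obtain ⟨C, r₀, -, hr₀, hsub, hC⟩ := hw.exists_isEndBound i
      obtain ⟨h, hh, -⟩ := hC.exists_isPrim hα hr₀ (hA i hi) (hsub.trans (X.openRange_subset i))
      exact ⟨h, hh.contMDiffOn hα.1 (X.isOpen_sector i isOpen_univ), fun _ => hh⟩
    · exact ⟨fun _ => 0, contMDiffOn_const, fun h => absurd h hi⟩
  choose h hs hp using h1
  obtain ⟨f, hf⟩ := X.exists_extension_sum hs
  exact ⟨f, fun i hi x hx => d_apply_eq (X.isOpen_endSet i) ((hp i hi).mono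
    ((X.endSet_subset_closedEnd i).trans (X.closedEnd_subset_sector i))) (hf i) hx⟩

end CSACManifold

/-! ### Behaviour under homotheties -/

section Scaling

variable {E : Type*} [NormedAddCommGroup E] [NormedSpace ℝ E] {Ω : Set E}
  {G G' : E → E →L[ℝ] E →L[ℝ] ℝ} {c : ℝ}

/-- Multiplying a metric by a constant does not change its Levi-Civita connection. -/
theorem christoffel_eq_of_smul (hΩ : IsOpen Ω) (hG : IsMetricOn Ω G) (hG' : IsMetricOn Ω G')
    (hc : c ≠ 0) (h : ∀ y ∈ Ω, ∀ u v, G' y u v = c * G y u v) {y : E} (hy : y ∈ Ω) (u v : E) :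
    christoffel G' y u v = christoffel G y u v := by
  have hd := (hG.smooth.contDiffAt (hΩ.mem_nhds hy)).differentiableAt (by simp)
  have hd' := (hG'.smooth.contDiffAt (hΩ.mem_nhds hy)).differentiableAt (by simp)
  have h1 : ∀ u v w, fderiv ℝ G' y u v w = c * fderiv ℝ G y u v w := by
    intro u v w
    have h2 : (fun z => G' z v w) =ᶠ[𝓝 y] fun z => c * G z v w := by
      filter_upwards [hΩ.mem_nhds hy] with z hz using h z hz v w
    rw [fderiv_bilin_apply hd, fderiv_bilin_apply hd', h2.fderiv_eq,
      fderiv_const_mul ((hd.clm_apply (differentiableAt_const v)).clm_apply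
        (differentiableAt_const w)) c]
    rfl
  obtain ⟨A, hA⟩ := hG.inv y hy
  have hinj : Function.Injective (G y) := by
    rw [← hA]
    exact A.injective
  refine hinj ?_
  ext w
  have h3 := apply_christoffel (hG'.inv y hy) u v w
  rw [h y hy, h1, h1, h1] at h3
  rw [apply_christoffel (hG.inv y hy)]
  refine mul_left_cancel₀ hc (h3.trans ?_)
  ring

/-- Iterated covariant derivatives are unchanged when the metric is multiplied by a constant, and
linear in the tensor field. -/
theorem iterCovDeriv_of_smul [FiniteDimensional ℝ E] (hΩ : IsOpen Ω) (hG : IsMetricOn Ω G)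
    (hG' : IsMetricOn Ω G')
    (hc : c ≠ 0) (h : ∀ y ∈ Ω, ∀ u v, G' y u v = c * G y u v) {n : ℕ}
    {T T' : E → (Fin n → E) → ℝ} {a : ℝ}
    (hT : IsTensorOn Ω T) (hT' : ∀ y ∈ Ω, ∀ v, T' y v = a * T y v) :
    ∀ k, ∀ y ∈ Ω, ∀ v, iterCovDeriv G' T' k y v = a * iterCovDeriv G T k y v
  | 0 => hT'
  | k + 1 => by
    intro y hy v
    have ih := iterCovDeriv_of_smul hΩ hG hG' hc h hT hT' k
    have hk := hT.iterCovDeriv hΩ hG k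
    have h1 : fderiv ℝ (fun z => iterCovDeriv G' T' k z (Fin.tail v)) y =
        a • fderiv ℝ (fun z => iterCovDeriv G T k z (Fin.tail v)) y := by
      have h2 : (fun z => iterCovDeriv G' T' k z (Fin.tail v)) =ᶠ[𝓝 y]
          fun z => a * iterCovDeriv G T k z (Fin.tail v) := by
        filter_upwards [hΩ.mem_nhds hy] with z hz using ih z hz _
      rw [h2.fderiv_eq]
      exact fderiv_const_mul (((hk.smooth _).contDiffAt
        (hΩ.mem_nhds hy)).differentiableAt (by simp)) a
    simp only [iterCovDeriv, covDeriv, h1, ih y hy, christoffel_eq_of_smul hΩ hG hG' hc h hy,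
      ← Finset.mul_sum, smul_apply, smul_eq_mul, mul_sub]

end Scaling

/-! ### The conical metric in coordinates -/

section Cone

variable {k : ℕ} {Λ : Type*} [TopologicalSpace Λ] [ChartedSpace (Model k) Λ]
  [IsManifold (𝓡 k) ∞ Λ] {W : Type*} [NormedAddCommGroup W] [NormedSpace ℝ W]
  [FiniteDimensional ℝ W]
  (g' : ContMDiffRiemannianMetric (𝓡 k) ∞ (Model k) (fun θ : Λ => TangentSpace (𝓡 k) θ))

theorem coneMetric_pos {q : Λ × ℝ} (hq : 0 < q.2) {v : Model k × ℝ} (hv : v ≠ 0) :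
    0 < coneMetric g'.inner q v v := by
  have h1 : coneMetric g'.inner q v v = v.2 * v.2 + q.2 ^ 2 * g'.inner q.1 v.1 v.1 := by
    have h2 : (mfderiv (coneModel k) 𝓘(ℝ, ℝ) Prod.snd q : Model k × ℝ →L[ℝ] ℝ) =
      ContinuousLinearMap.snd ℝ (Model k) ℝ := mfderiv_snd
    have h3 : (mfderiv (coneModel k) (𝓡 k) Prod.fst q : Model k × ℝ →L[ℝ] Model k) =
      ContinuousLinearMap.fst ℝ (Model k) ℝ := mfderiv_fst
    exact congrArg₂ (fun (A : Model k × ℝ →L[ℝ] ℝ) (B : Model k × ℝ →L[ℝ] Model k) =>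
      A v * A v + q.2 ^ 2 * g'.inner q.1 (B v) (B v)) h2 h3
  rw [h1]
  by_cases h : v.1 = 0
  · have h2 : v.2 ≠ 0 := fun h' => hv (Prod.ext h h')
    have h3 : g'.inner q.1 v.1 v.1 = 0 := by
      rw [h]
      exact congrArg (fun A : TangentSpace (𝓡 k) q.1 →L[ℝ] ℝ => A 0) (map_zero (g'.inner q.1))
    rw [h3, mul_zero, add_zero]
    exact mul_self_pos.2 h2
  · have := g'.pos q.1 v.1 h
    have h2 := mul_self_nonneg v.2
    positivity

theorem isMetricOn_pullMet_coneMetric {Ω : Set W} (hΩ : IsOpen Ω) {f : W → Λ × ℝ}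
    (hf : ContMDiffOn 𝓘(ℝ, W) (coneModel k) ∞ f Ω)
    (hinj : ∀ y ∈ Ω, Function.Injective (mfderiv 𝓘(ℝ, W) (coneModel k) f y : W → Model k × ℝ))
    (hpos : ∀ y ∈ Ω, 0 < (f y).2) :
    IsMetricOn Ω (pullMet (coneModel k) f (coneMetric g'.inner)) := by
  have hd : ∀ y ∈ Ω, MDifferentiableAt 𝓘(ℝ, W) (coneModel k) f y := fun y hy =>
    (hf.contMDiffAt (hΩ.mem_nhds hy)).mdifferentiableAt (by simp)
  have heq : ∀ y ∈ Ω, ∀ u v, pullMet (coneModel k) f (coneMetric g'.inner) y u v =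
      fderiv ℝ (fun y => (f y).2) y u * fderiv ℝ (fun y => (f y).2) y v +
        (f y).2 ^ 2 * pullMet (𝓡 k) (fun y => (f y).1) g'.inner y u v :=
    fun y hy u v => coneMetric_mfderiv g'.inner (hd y hy) u v
  refine ⟨?_, fun y hy u v => ?_, fun y hy => isInvertible_of_pos fun v hv => ?_⟩
  · refine contDiffOn_clm_apply.2 fun u => contDiffOn_clm_apply.2 fun v => ?_
    have h2 : ContDiffOn ℝ ∞ (fun y => (f y).2) Ω :=
      contMDiffOn_iff_contDiffOn.1 (contMDiff_snd.comp_contMDiffOn hf)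
    have h1 : ContMDiffOn 𝓘(ℝ, W) (𝓡 k) ∞ (fun y => (f y).1) Ω := contMDiff_fst.comp_contMDiffOn hf
    have h3 : ∀ w, ContDiffOn ℝ ∞ (fun y => fderiv ℝ (fun y => (f y).2) y w) Ω := fun w =>
      (h2.fderiv_of_isOpen hΩ (by simp)).clm_apply contDiffOn_const
    exact (((h3 u).mul (h3 v)).add ((h2.pow 2).mul (contDiffOn_pullMet_apply hΩ h1 g' u v))).congr
      fun y hy => heq y hy u v
  · rw [heq y hy, heq y hy, mul_comm (fderiv ℝ (fun y => (f y).2) y u)]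
    exact congrArg (fun t => _ + (f y).2 ^ 2 * t) (g'.symm _ _ _)
  · exact coneMetric_pos g' (hpos y hy) fun h =>
      hv (hinj y hy (h.trans (map_zero (mfderiv 𝓘(ℝ, W) (coneModel k) f y)).symm))

theorem isMetricField_coneMetric {O : Set (Λ × ℝ)} (hO : IsOpen O) (hpos : ∀ q ∈ O, 0 < q.2) :
    IsMetricField (I := coneModel k) O (coneMetric g'.inner) := fun p =>
  isMetricOn_pullMet_coneMetric g' (isOpen_chartDom (I := coneModel k) hO p)
    ((contMDiffOn_extChartAt_symm p).mono inter_subset_left)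
    (fun _ hy => (mfderiv_extChartAt_symm_isInvertible (I := coneModel k) p hy.1).injective)
    fun _ hy => hpos _ hy.2

variable {m : ℕ} {L : Type*} [TopologicalSpace L] [ChartedSpace (Model m) L]
  [IsManifold (𝓡 m) ∞ L]

/-- The difference of the metric and the conical metric, in coordinates. -/
theorem pullField_pullMetric_sub {φ : Λ × ℝ → L} {f : W → Λ × ℝ} {y : W}
    (hf : MDifferentiableAt 𝓘(ℝ, W) (coneModel k) f y)
    (hφ : MDifferentiableAt (coneModel k) (𝓡 m) φ (f y))
    (g : (x : L) → TangentSpace (𝓡 m) x →L[ℝ] TangentSpace (𝓡 m) x →L[ℝ] ℝ)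
    (G : (q : Λ × ℝ) → TangentSpace (coneModel k) q →L[ℝ] TangentSpace (coneModel k) q →L[ℝ] ℝ)
    (v : Fin 2 → W) :
    pullField (coneModel k) f (bilinTensor (coneModel k) fun q => pullMetric φ g q - G q) y v =
      pullMet (𝓡 m) (fun y => φ (f y)) g y (v 0) (v 1) -
        pullMet (coneModel k) f G y (v 0) (v 1) := by
  have h : (mfderiv 𝓘(ℝ, W) (𝓡 m) (fun y => φ (f y)) y : W →L[ℝ] Model m) = _ :=
    mfderiv_comp y hφ hf
  exact (congrArg (fun A : W →L[ℝ] Model m => g (φ (f y)) (A (v 0)) (A (v 1)) -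
    pullMet (coneModel k) f G y (v 0) (v 1)) h).symm

theorem isTensorField_pullMetric_sub {O : Set (Λ × ℝ)} (hO : IsOpen O) (hpos : ∀ q ∈ O, 0 < q.2)
    {φ : Λ × ℝ → L} (hφ : ContMDiffOn (coneModel k) (𝓡 m) ∞ φ O)
    (g : ContMDiffRiemannianMetric (𝓡 m) ∞ (Model m) (fun x : L => TangentSpace (𝓡 m) x)) :
    IsTensorField (I := coneModel k) O (bilinTensor (coneModel k) fun q =>
      pullMetric φ g.inner q - coneMetric g'.inner q) := by
  intro p
  have hΩ := isOpen_chartDom (I := coneModel k) hO p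
  have hf : ContMDiffOn 𝓘(ℝ, Model k × ℝ) (coneModel k) ∞ (extChartAt (coneModel k) p).symm
    (chartDom (coneModel k) O p) := (contMDiffOn_extChartAt_symm p).mono inter_subset_left
  have hφf : ContMDiffOn 𝓘(ℝ, Model k × ℝ) (𝓡 m) ∞
      (fun y => φ ((extChartAt (coneModel k) p).symm y)) (chartDom (coneModel k) O p) :=
    hφ.comp hf fun y hy => hy.2
  refine (isTensorOn_bilinear (B := fun y => pullMet (𝓡 m)
    (fun y => φ ((extChartAt (coneModel k) p).symm y)) g.inner y -
      pullMet (coneModel k) (extChartAt (coneModel k) p).symm (coneMetric g'.inner) y)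
      fun u v => ?_).congr fun y hy => funext fun v => ?_
  · exact (contDiffOn_pullMet_apply hΩ hφf g u v).sub
      (((isMetricField_coneMetric g' hO hpos p).smooth.clm_apply contDiffOn_const).clm_apply
        contDiffOn_const)
  · exact pullField_pullMetric_sub ((hf.contMDiffAt (hΩ.mem_nhds hy)).mdifferentiableAt (by simp))
      ((hφ.contMDiffAt (hO.mem_nhds hy.2)).mdifferentiableAt (by simp)) _ _ v

end Cone

/-! ### Decay of translation-invariant forms -/

section Aux

theorem injective_mfderiv_of_leftInverse {E H E' H' : Type*} [NormedAddCommGroup E]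
    [NormedSpace ℝ E] [TopologicalSpace H] {I : ModelWithCorners ℝ E H}
    [NormedAddCommGroup E'] [NormedSpace ℝ E'] [TopologicalSpace H'] {J : ModelWithCorners ℝ E' H'}
    {M N : Type*} [TopologicalSpace M] [ChartedSpace H M] [TopologicalSpace N] [ChartedSpace H' N]
    {f : M → N} {g : N → M} {x : M} (hf : MDifferentiableAt I J f x)
    (hg : MDifferentiableAt J I g (f x)) (h : ∀ᶠ z in 𝓝 x, g (f z) = z) :
    Function.Injective (mfderiv I J f x : E → E') := by
  have h1 := mfderiv_comp x hg hf
  have h2 : g ∘ f =ᶠ[𝓝 x] id := h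
  rw [h2.mfderiv_eq, mfderiv_id] at h1
  have h3 : ∀ v : E, mfderiv J I g (f x) (mfderiv I J f x v) = v := fun v =>
    (congrArg (fun A => A v) h1).symm
  exact fun v w hvw => (h3 v).symm.trans ((congrArg (mfderiv J I g (f x)) hvw).trans (h3 w))

theorem isInvertible_of_injective {E F : Type*} [NormedAddCommGroup E] [NormedSpace ℝ E]
    [NormedAddCommGroup F] [NormedSpace ℝ F] [FiniteDimensional ℝ E] [FiniteDimensional ℝ F]
    (hd : Module.finrank ℝ E = Module.finrank ℝ F) {A : E →L[ℝ] F} (hA : Function.Injective A) :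
    A.IsInvertible :=
  ⟨(LinearEquiv.ofInjectiveOfFinrankEq A.toLinearMap hA hd).toContinuousLinearEquiv, rfl⟩

/-- A continuous family of positive definite forms is uniformly coercive on a compact set. -/
theorem exists_pos_forall_mul_norm_sq_le {E : Type*} [NormedAddCommGroup E] [NormedSpace ℝ E]
    [FiniteDimensional ℝ E] {K : Set E} (hK : IsCompact K) {B : E → E →L[ℝ] E →L[ℝ] ℝ}
    (hB : ContinuousOn B K) (hpos : ∀ y ∈ K, ∀ v ≠ 0, 0 < B y v v) :
    ∃ c > 0, ∀ y ∈ K, ∀ v, c * ‖v‖ ^ 2 ≤ B y v v := by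
  have hS : IsCompact (K ×ˢ Metric.sphere (0 : E) 1) := hK.prod (isCompact_sphere 0 1)
  have hcont : ContinuousOn (fun q : E × E => B q.1 q.2 q.2) (K ×ˢ Metric.sphere (0 : E) 1) :=
    ((hB.comp continuousOn_fst fun q hq => hq.1).clm_apply continuousOn_snd).clm_apply
      continuousOn_snd
  have key : ∃ c > 0, ∀ q ∈ K ×ˢ Metric.sphere (0 : E) 1, c ≤ B q.1 q.2 q.2 := by
    rcases (K ×ˢ Metric.sphere (0 : E) 1).eq_empty_or_nonempty with h | h
    · exact ⟨1, one_pos, by simp [h]⟩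
    · obtain ⟨q, hq, hmin⟩ := hS.exists_isMinOn h hcont
      refine ⟨B q.1 q.2 q.2, hpos _ hq.1 _ fun h0 => ?_, fun q' hq' => hmin hq'⟩
      have := hq.2
      rw [h0] at this
      simp at this
  obtain ⟨c, hc, h⟩ := key
  refine ⟨c, hc, fun y hy v => ?_⟩
  by_cases hv : v = 0
  · simp [hv]
  have hv' : ‖v‖ ≠ 0 := norm_ne_zero_iff.2 hv
  have h1 := h (y, ‖v‖⁻¹ • v) ⟨hy, by simp [norm_smul, hv']⟩
  simp only [map_smul, smul_apply, smul_eq_mul] at h1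
  calc c * ‖v‖ ^ 2 ≤ ‖v‖⁻¹ * (‖v‖⁻¹ * B y v v) * ‖v‖ ^ 2 := by gcongr
    _ = B y v v := by field_simp

theorem exists_forall_abs_le_of_eventually {f : ℕ → ℝ} {C : ℝ}
    (h : ∀ᶠ n in atTop, |f n| ≤ C) : ∃ C', ∀ n, |f n| ≤ C' := by
  obtain ⟨C', hC'⟩ := (isBoundedUnder_of_eventually_le h).bddAbove_range
  exact ⟨C', fun n => hC' (mem_range_self n)⟩

end Aux

section ScaleChart

variable {k : ℕ} {Λ : Type*} [TopologicalSpace Λ] [ChartedSpace (Model k) Λ]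
  [IsManifold (𝓡 k) ∞ Λ] (θ₀ : Λ) (t : ℝ)

/-- The coordinates `(x, ρ) ↦ (x, tρ)` on the cone over a chart of the link. -/
def scaleChart (y : Model k × ℝ) : Λ × ℝ :=
  ((extChartAt (𝓡 k) θ₀).symm y.1, t * y.2)

/-- The domain of the coordinates on the cone. For `t > 2a` it is mapped into the end `r > a` by
`scaleChart θ₀ t`. -/
def scaleDom : Set (Model k × ℝ) := (extChartAt (𝓡 k) θ₀).target ×ˢ Ioi (1 / 2)

theorem isOpen_scaleDom : IsOpen (scaleDom (k := k) θ₀) :=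
  (isOpen_extChartAt_target θ₀).prod isOpen_Ioi

theorem contMDiffOn_scaleChart : ContMDiffOn 𝓘(ℝ, Model k × ℝ) (coneModel k) ∞
    (scaleChart (k := k) θ₀ t) (scaleDom (k := k) θ₀) := by
  refine ContMDiffOn.prodMk ?_ ?_
  · exact (contMDiffOn_extChartAt_symm (n := ∞) θ₀).comp
      (contDiff_fst.contMDiff (n := ∞)).contMDiffOn fun y hy => hy.1
  · exact (contDiff_const.mul contDiff_snd).contMDiff.contMDiffOn

variable {θ₀ t}

theorem mdifferentiableAt_scaleChart {y : Model k × ℝ} (hy : y ∈ scaleDom θ₀) :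
    MDifferentiableAt 𝓘(ℝ, Model k × ℝ) (coneModel k) (scaleChart θ₀ t) y :=
  ((contMDiffOn_scaleChart θ₀ t).contMDiffAt
    ((isOpen_scaleDom (k := k) θ₀).mem_nhds hy)).mdifferentiableAt (by simp)

theorem injective_mfderiv_scaleChart (ht : 0 < t) {y : Model k × ℝ} (hy : y ∈ scaleDom θ₀) :
    Function.Injective (mfderiv 𝓘(ℝ, Model k × ℝ) (coneModel k) (scaleChart θ₀ t) y :
      Model k × ℝ → Model k × ℝ) := by
  refine injective_mfderiv_of_leftInverse
    (g := fun q : Λ × ℝ => (extChartAt (𝓡 k) θ₀ q.1, t⁻¹ * q.2))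
    (mdifferentiableAt_scaleChart hy) ?_ ?_
  · have h1 : MDifferentiableAt (𝓡 k) 𝓘(ℝ, Model k) (extChartAt (𝓡 k) θ₀)
        (scaleChart θ₀ t y).1 := mdifferentiableAt_extChartAt (by
      rw [← extChartAt_source (𝓡 k)]
      exact (extChartAt (𝓡 k) θ₀).map_target hy.1)
    have h2 : MDifferentiableAt (coneModel k) 𝓘(ℝ, Model k)
        (fun q : Λ × ℝ => extChartAt (𝓡 k) θ₀ q.1) (scaleChart θ₀ t y) :=
      MDifferentiableAt.comp _ h1 mdifferentiableAt_fst
    have h3 : MDifferentiableAt (coneModel k) 𝓘(ℝ, ℝ)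
        (fun q : Λ × ℝ => t⁻¹ * q.2) (scaleChart θ₀ t y) :=
      mdifferentiableAt_snd.const_smul t⁻¹
    exact h2.prodMk_space h3
  · filter_upwards [(isOpen_scaleDom (k := k) θ₀).mem_nhds hy] with z hz
    simp only [scaleChart, (extChartAt (𝓡 k) θ₀).right_inv hz.1]
    rw [← mul_assoc, inv_mul_cancel₀ ht.ne', one_mul]

/-- Scaling the radius by `t` is a homothety of the cone: it multiplies the conical metric by
`t²`. -/
theorem pullMet_scaleChart (g' : ContMDiffRiemannianMetric (𝓡 k) ∞ (Model k)
    (fun θ : Λ => TangentSpace (𝓡 k) θ)) {y : Model k × ℝ} (hy : y ∈ scaleDom θ₀)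
    (u v : Model k × ℝ) :
    pullMet (coneModel k) (scaleChart θ₀ t) (coneMetric g'.inner) y u v =
      t ^ 2 * pullMet (coneModel k) (scaleChart θ₀ 1) (coneMetric g'.inner) y u v := by
  have h1 : ∀ t, ∀ w, fderiv ℝ (fun y => (scaleChart θ₀ t y).2) y w = t * w.2 := by
    intro t w
    have : HasFDerivAt (fun y : Model k × ℝ => t * y.2)
      (t • ContinuousLinearMap.snd ℝ (Model k) ℝ) y := hasFDerivAt_snd.const_mul t
    rw [show fderiv ℝ (fun y => (scaleChart θ₀ t y).2) y = _ from this.fderiv]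
    rfl
  have h2 : ∀ t, pullMet (coneModel k) (scaleChart θ₀ t) (coneMetric g'.inner) y u v =
      (t * u.2) * (t * v.2) + (t * y.2) ^ 2 * pullMet (𝓡 k)
        (fun y => (extChartAt (𝓡 k) θ₀).symm y.1) g'.inner y u v := by
    intro t
    have h3 := coneMetric_mfderiv g'.inner (mdifferentiableAt_scaleChart (t := t) hy) u v
    rw [h1, h1] at h3
    exact h3
  rw [h2, h2]
  ring

end ScaleChart

namespace CSACManifold

variable {m s l : ℕ}
  {L : Type*} [TopologicalSpace L] [ChartedSpace (Model m) L] [IsManifold (𝓡 m) ∞ L]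
  {Λ : Fin s ⊕ Fin l → Type*} [∀ i, TopologicalSpace (Λ i)]
  [∀ i, ChartedSpace (Model (m - 1)) (Λ i)] [∀ i, IsManifold (𝓡 (m - 1)) ∞ (Λ i)]
  {X : CSACManifold m s l L Λ}

section Invariant

variable {j : Fin l} {θ₀ : Λ (Sum.inr j)} {t : ℝ}

theorem scaleChart_snd_mem (ht : 2 * X.a (Sum.inr j) < t) {y : Model (m - 1) × ℝ}
    (hy : y ∈ scaleDom (k := m - 1) θ₀) :
    (scaleChart (k := m - 1) θ₀ t y).2 ∈ openRange (X.a (Sum.inr j))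
      (Sum.inr j : Fin s ⊕ Fin l) := by
  have h1 : 1 / 2 < y.2 := hy.2
  have h2 := X.a_pos (Sum.inr j)
  show X.a (Sum.inr j) < t * y.2
  nlinarith

theorem scaleChart_mem_source (ht : 2 * X.a (Sum.inr j) < t) {y : Model (m - 1) × ℝ}
    (hy : y ∈ scaleDom (k := m - 1) θ₀) :
    scaleChart (k := m - 1) θ₀ t y ∈ (X.φ (Sum.inr j)).source :=
  X.range_source _ ⟨mem_univ _, openRange_subset_closedRange _ _ (scaleChart_snd_mem ht hy)⟩

theorem mdifferentiableAt_φ_scaleChart (ht : 2 * X.a (Sum.inr j) < t) {y : Model (m - 1) × ℝ}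
    (hy : y ∈ scaleDom (k := m - 1) θ₀) :
    MDifferentiableAt (coneModel (m - 1)) (𝓡 m) (X.φ (Sum.inr j))
      (scaleChart (k := m - 1) θ₀ t y) :=
  ((X.contMDiffOn_φ _).contMDiffAt ((X.φ _).open_source.mem_nhds
    (scaleChart_mem_source ht hy))).mdifferentiableAt (by simp)

variable (X θ₀ t) in
/-- The coordinates `(x, ρ) ↦ φ(x, tρ)` on an AC end. -/
def scaleEnd (y : Model (m - 1) × ℝ) : L := X.φ (Sum.inr j) (scaleChart (k := m - 1) θ₀ t y)

theorem mfderiv_scaleEnd (ht : 2 * X.a (Sum.inr j) < t) {y : Model (m - 1) × ℝ}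
    (hy : y ∈ scaleDom (k := m - 1) θ₀) :
    mfderiv 𝓘(ℝ, Model (m - 1) × ℝ) (𝓡 m) (X.scaleEnd θ₀ t) y =
      (mfderiv (coneModel (m - 1)) (𝓡 m) (X.φ (Sum.inr j))
        (scaleChart (k := m - 1) θ₀ t y)).comp
        (mfderiv 𝓘(ℝ, Model (m - 1) × ℝ) (coneModel (m - 1)) (scaleChart (k := m - 1) θ₀ t) y) :=
  mfderiv_comp y (mdifferentiableAt_φ_scaleChart ht hy) (mdifferentiableAt_scaleChart hy)

theorem contMDiffOn_scaleEnd (ht : 2 * X.a (Sum.inr j) < t) :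
    ContMDiffOn 𝓘(ℝ, Model (m - 1) × ℝ) (𝓡 m) ∞ (X.scaleEnd θ₀ t)
      (scaleDom (k := m - 1) θ₀) :=
  (X.contMDiffOn_φ _).comp (contMDiffOn_scaleChart θ₀ t) fun _ hy => scaleChart_mem_source ht hy

theorem injective_mfderiv_scaleEnd (ht : 2 * X.a (Sum.inr j) < t) {y : Model (m - 1) × ℝ}
    (hy : y ∈ scaleDom (k := m - 1) θ₀) :
    Function.Injective (mfderiv 𝓘(ℝ, Model (m - 1) × ℝ) (𝓡 m) (X.scaleEnd θ₀ t) y :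
      Model (m - 1) × ℝ → Model m) := by
  have ht' : 0 < t := by linarith [X.a_pos (Sum.inr j)]
  have hs := scaleChart_mem_source (X := X) ht hy
  have h1 : Function.Injective (mfderiv (coneModel (m - 1)) (𝓡 m) (X.φ (Sum.inr j))
      (scaleChart (k := m - 1) θ₀ t y) : Model (m - 1) × ℝ → Model m) :=
    injective_mfderiv_of_leftInverse (g := (X.φ (Sum.inr j)).symm)
      (mdifferentiableAt_φ_scaleChart ht hy)
      (((X.contMDiffOn_symm _).contMDiffAt ((X.φ _).open_target.mem_nhds
        ((X.φ _).map_source hs))).mdifferentiableAt (by simp))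
      (by filter_upwards [(X.φ _).open_source.mem_nhds hs] with z hz using (X.φ _).left_inv hz)
  rw [mfderiv_scaleEnd ht hy]
  exact h1.comp (injective_mfderiv_scaleChart ht' hy)

theorem isMetricOn_scaleEnd (ht : 2 * X.a (Sum.inr j) < t) :
    IsMetricOn (scaleDom (k := m - 1) θ₀) (pullMet (𝓡 m) (X.scaleEnd θ₀ t) X.g.inner) :=
  isMetricOn_pullMet (isOpen_scaleDom (k := m - 1) θ₀) (contMDiffOn_scaleEnd ht)
    (fun _ hy => injective_mfderiv_scaleEnd ht hy) X.g

variable (X θ₀) in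
/-- The conical metric in the coordinates `(x, ρ)`. -/
def coneCoord : Model (m - 1) × ℝ → Model (m - 1) × ℝ →L[ℝ] Model (m - 1) × ℝ →L[ℝ] ℝ :=
  pullMet (coneModel (m - 1)) (scaleChart (k := m - 1) θ₀ 1) (coneMetric (X.g' (Sum.inr j)).inner)

theorem isMetricOn_pullMet_scaleChart (ht : 0 < t) : IsMetricOn (scaleDom (k := m - 1) θ₀)
    (pullMet (coneModel (m - 1)) (scaleChart (k := m - 1) θ₀ t)
      (coneMetric (X.g' (Sum.inr j)).inner)) :=
  isMetricOn_pullMet_coneMetric _ (isOpen_scaleDom (k := m - 1) θ₀) (contMDiffOn_scaleChart θ₀ t)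
    (fun _ hy => injective_mfderiv_scaleChart ht hy) fun y hy => by
      have h1 : 1 / 2 < y.2 := hy.2
      show 0 < t * y.2
      positivity

/-- In the coordinates `(x, ρ)`, the rescaled metrics `t⁻² g` have bounded derivatives as
`t → ∞`: their difference from the conical metric is the rescaled difference of the two metrics,
whose covariant derivatives for the conical connection tend to zero. -/
theorem bddDeriv_scaleEnd {t : ℕ → ℝ} (ht : ∀ n, 2 * X.a (Sum.inr j) < t n)
    (ht' : Tendsto t atTop atTop) {K : Set (Model (m - 1))} (hK : IsCompact K)
    (hKe : K ⊆ (extChartAt (𝓡 (m - 1)) θ₀).target) {x : ℕ → Model (m - 1)} (hx : ∀ n, x n ∈ K)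
    (u v : Model (m - 1) × ℝ) (N : ℕ) :
    BddDeriv (fun n => (x n, (1 : ℝ))) N fun n z =>
      (t n ^ 2)⁻¹ * pullMet (𝓡 m) (X.scaleEnd θ₀ (t n)) X.g.inner z u v := by
  set y : ℕ → Model (m - 1) × ℝ := fun n => (x n, (1 : ℝ)) with hydef
  have hU := isOpen_scaleDom (k := m - 1) θ₀
  have hK' : IsCompact (K ×ˢ {(1 : ℝ)}) := hK.prod isCompact_singleton
  have hK'U : K ×ˢ {(1 : ℝ)} ⊆ scaleDom (k := m - 1) θ₀ := by
    rintro ⟨a, b⟩ ⟨ha, rfl⟩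
    exact ⟨hKe ha, show (1 : ℝ) / 2 < 1 by norm_num⟩
  have hyK : ∀ n, y n ∈ K ×ˢ {(1 : ℝ)} := fun n => ⟨hx n, rfl⟩
  have hyU : ∀ n, y n ∈ scaleDom (k := m - 1) θ₀ := fun n => hK'U (hyK n)
  have ht0 : ∀ n, 0 < t n := fun n => by linarith [X.a_pos (Sum.inr j), ht n]
  have hGc : IsMetricOn (scaleDom (k := m - 1) θ₀) (X.coneCoord θ₀) :=
    isMetricOn_pullMet_scaleChart one_pos
  have hGcs : ∀ u v, ContDiffOn ℝ ∞ (fun z => X.coneCoord θ₀ z u v) (scaleDom (k := m - 1) θ₀) :=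
    fun u v => (hGc.smooth.clm_apply contDiffOn_const).clm_apply contDiffOn_const
  set B := bilinTensor (coneModel (m - 1)) fun q =>
    pullMetric (X.φ (Sum.inr j)) X.g.inner q - coneMetric (X.g' (Sum.inr j)).inner q with hBdef
  let H : ℕ → Model (m - 1) × ℝ → (Fin 2 → Model (m - 1) × ℝ) → ℝ := fun n z w =>
    (t n ^ 2)⁻¹ * pullField (coneModel (m - 1)) (scaleChart (k := m - 1) θ₀ (t n)) B z w
  have hHeq : ∀ n, ∀ z ∈ scaleDom (k := m - 1) θ₀, ∀ w, H n z w =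
      (t n ^ 2)⁻¹ * pullMet (𝓡 m) (X.scaleEnd θ₀ (t n)) X.g.inner z (w 0) (w 1) -
        X.coneCoord θ₀ z (w 0) (w 1) := by
    intro n z hz w
    have h1 : pullField (coneModel (m - 1)) (scaleChart (k := m - 1) θ₀ (t n)) B z w =
      pullMet (𝓡 m) (X.scaleEnd θ₀ (t n)) X.g.inner z (w 0) (w 1) -
        pullMet (coneModel (m - 1)) (scaleChart (k := m - 1) θ₀ (t n))
          (coneMetric (X.g' (Sum.inr j)).inner) z (w 0) (w 1) :=
      pullField_pullMetric_sub (mdifferentiableAt_scaleChart hz)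
        (mdifferentiableAt_φ_scaleChart (ht n) hz) _ _ w
    simp only [H, h1]
    rw [pullMet_scaleChart (X.g' (Sum.inr j)) hz, coneCoord, mul_sub, ← mul_assoc (t n ^ 2)⁻¹,
      inv_mul_cancel₀ (pow_pos (ht0 n) 2).ne', one_mul]
  have hgs : ∀ n u v, ContDiffOn ℝ ∞
      (fun z => pullMet (𝓡 m) (X.scaleEnd θ₀ (t n)) X.g.inner z u v)
      (scaleDom (k := m - 1) θ₀) := fun n u v =>
    contDiffOn_pullMet_apply hU (contMDiffOn_scaleEnd (ht n)) X.g u v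
  have hH : ∀ n, IsTensorOn (scaleDom (k := m - 1) θ₀) (H n) := fun n =>
    (isTensorOn_bilinear (B := fun z => (t n ^ 2)⁻¹ • pullMet (𝓡 m) (X.scaleEnd θ₀ (t n))
      X.g.inner z - X.coneCoord θ₀ z) fun u v =>
        (contDiffOn_const.mul (hgs n u v)).sub (hGcs u v)).congr fun z hz => funext fun w =>
          hHeq n z hz w
  have hO : IsOpen ((univ : Set (Λ (Sum.inr j))) ×ˢ
      openRange (X.a (Sum.inr j)) (Sum.inr j : Fin s ⊕ Fin l)) :=
    isOpen_univ.prod (isOpen_openRange _ _)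
  have hOpos : ∀ q ∈ (univ : Set (Λ (Sum.inr j))) ×ˢ
      openRange (X.a (Sum.inr j)) (Sum.inr j : Fin s ⊕ Fin l), 0 < q.2 := fun q hq =>
    openRange_pos (X.a_pos (Sum.inr j)) hq.2
  have hOφ : ContMDiffOn (coneModel (m - 1)) (𝓡 m) ∞ (X.φ (Sum.inr j))
      ((univ : Set (Λ (Sum.inr j))) ×ˢ
        openRange (X.a (Sum.inr j)) (Sum.inr j : Fin s ⊕ Fin l)) :=
    (X.contMDiffOn_φ _).mono ((prod_mono_right (openRange_subset_closedRange _ _)).trans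
      (X.range_source _))
  -- the tensor of rank `2 + q` scales by `t^(2+q)`, which cancels `t⁻²` and the decay `t^(ν-q)` up
  -- to the bounded factor `t^ν`
  have hbound : ∀ q (w : Fin (2 + q) → Model (m - 1) × ℝ), ∃ C, ∀ n,
      |iterCovDeriv (X.coneCoord θ₀) (H n) q (y n) w| ≤ C := by
    intro q w
    obtain ⟨C, hC⟩ := X.asymptotic (Sum.inr j) q
    have hC' : ∀ᶠ n in atTop, ∀ θ, CovDerivBound (coneModel (m - 1))
      (coneMetric (X.g' (Sum.inr j)).inner) B q (θ, t n) (C * t n ^ (X.ν (Sum.inr j) - q)) :=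
      ht'.eventually hC
    obtain ⟨D, hD⟩ := hK'.exists_bound_of_continuousOn
      (f := fun z => ∏ i, √(X.coneCoord θ₀ z (w i) (w i)))
      (continuousOn_finsetProd _ fun i _ => ((hGcs _ _).continuousOn.mono hK'U).sqrt)
    refine exists_forall_abs_le_of_eventually (C := |C| * |D|) ?_
    filter_upwards [hC', ht'.eventually_ge_atTop 1] with n hn hn1
    have hfy : scaleChart (k := m - 1) θ₀ (t n) (y n) =
        ((extChartAt (𝓡 (m - 1)) θ₀).symm (x n), t n) := by
      simp [scaleChart, hydef]
    have h1 := hn ((extChartAt (𝓡 (m - 1)) θ₀).symm (x n))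
    rw [← hfy] at h1
    have h2 := (covDerivBound_iff_pull (I := coneModel (m - 1)) hO
      (isMetricField_coneMetric (X.g' (Sum.inr j)) hO hOpos)
      (isTensorField_pullMetric_sub (X.g' (Sum.inr j)) hO hOpos hOφ X.g) hU
      (contMDiffOn_scaleChart θ₀ (t n)) (fun z hz => ⟨mem_univ _, scaleChart_snd_mem (ht n) hz⟩)
      (fun z hz => isInvertible_of_injective (E := Model (m - 1) × ℝ) (F := Model (m - 1) × ℝ) rfl
        (injective_mfderiv_scaleChart (ht0 n) hz))
      q (hyU n) _).1 h1 w
    have hpos := pow_pos (ht0 n) 2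
    rw [iterCovDeriv_of_smul hU hGc (isMetricOn_pullMet_scaleChart (ht0 n)) hpos.ne'
      (fun z hz u v => pullMet_scaleChart (X.g' (Sum.inr j)) hz u v) (hH n) (a := t n ^ 2)
      (fun z hz w => by
        simp only [H]
        rw [← mul_assoc, mul_inv_cancel₀ hpos.ne', one_mul]) q (y n) (hyU n) w] at h2
    have h3 : ∏ i, √(pullMet (coneModel (m - 1)) (scaleChart (k := m - 1) θ₀ (t n))
        (coneMetric (X.g' (Sum.inr j)).inner) (y n) (w i) (w i)) =
        t n ^ (2 + q) * ∏ i, √(X.coneCoord θ₀ (y n) (w i) (w i)) := by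
      have h4 : ∀ i, √(pullMet (coneModel (m - 1)) (scaleChart (k := m - 1) θ₀ (t n))
          (coneMetric (X.g' (Sum.inr j)).inner) (y n) (w i) (w i)) =
          t n * √(X.coneCoord θ₀ (y n) (w i) (w i)) := by
        intro i
        rw [pullMet_scaleChart (X.g' (Sum.inr j)) (hyU n), Real.sqrt_mul hpos.le,
          Real.sqrt_sq (ht0 n).le]
        rfl
      simp only [h4, Finset.prod_mul_distrib]
      simp
    rw [h3, abs_mul, abs_of_pos hpos] at h2
    have h5 : t n ^ (X.ν (Sum.inr j) - q) * t n ^ (2 + q) = t n ^ 2 * t n ^ X.ν (Sum.inr j) := by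
      rw [Real.rpow_sub (ht0 n), Real.rpow_natCast, pow_add]
      have := (pow_pos (ht0 n) q).ne'
      field_simp
    have h6 : t n ^ X.ν (Sum.inr j) ≤ 1 := Real.rpow_le_one_of_one_le_of_nonpos hn1 (X.ν_neg j).le
    have h7 : t n ^ 2 * |iterCovDeriv (X.coneCoord θ₀) (H n) q (y n) w| ≤
        t n ^ 2 * (C * t n ^ X.ν (Sum.inr j) * ∏ i, √(X.coneCoord θ₀ (y n) (w i) (w i))) := by
      refine h2.trans (le_of_eq ?_)
      rw [show t n ^ 2 * (C * t n ^ X.ν (Sum.inr j) * ∏ i, √(X.coneCoord θ₀ (y n) (w i) (w i))) =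
        C * (t n ^ 2 * t n ^ X.ν (Sum.inr j)) * ∏ i, √(X.coneCoord θ₀ (y n) (w i) (w i)) by ring,
        ← h5]
      ring
    refine (le_of_mul_le_mul_left h7 hpos).trans ?_
    have h8 := (le_abs_self _).trans (hD (y n) (hyK n))
    have h9 : 0 ≤ ∏ i, √(X.coneCoord θ₀ (y n) (w i) (w i)) :=
      Finset.prod_nonneg fun _ _ => Real.sqrt_nonneg _
    have h10 : 0 ≤ t n ^ X.ν (Sum.inr j) := Real.rpow_nonneg (ht0 n).le _
    calc C * t n ^ X.ν (Sum.inr j) * ∏ i, √(X.coneCoord θ₀ (y n) (w i) (w i))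
        ≤ |C| * 1 * |D| := by
          gcongr
          · exact le_abs_self C
          · exact h8.trans (le_abs_self D)
      _ = |C| * |D| := by ring
  have h1 := bddDeriv_of_iterCovDeriv hU hK' hK'U hGc hyK (U := fun _ => scaleDom (k := m - 1) θ₀)
    (fun _ => hU) (fun _ => subset_rfl) hyU N hH (fun q _ => hbound q) ![u, v]
  have h2 := BddDeriv.of_isCompact hU hK' hK'U hyK N (hGcs u v)
  refine (BddDeriv.add (IsTensorOn.smoothFam (fun _ => hU) hyU hH ![u, v])
    (fun n => (hGcs u v).contDiffAt (hU.mem_nhds (hyU n))) h1 h2).congr fun n => ?_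
  filter_upwards [hU.mem_nhds (hyU n)] with z hz
  rw [hHeq n z hz]
  simp

end Invariant

end CSACManifold

theorem IsMetricOn.const_smul {E : Type*} [NormedAddCommGroup E] [NormedSpace ℝ E]
    [FiniteDimensional ℝ E] {Ω : Set E} {G : E → E →L[ℝ] E →L[ℝ] ℝ} (hG : IsMetricOn Ω G) {c : ℝ}
    (hc : c ≠ 0) : IsMetricOn Ω (fun y => c • G y) where
  smooth := contDiffOn_clm_apply.2 fun u => contDiffOn_clm_apply.2 fun v =>
    contDiffOn_const.mul ((hG.smooth.clm_apply contDiffOn_const).clm_apply contDiffOn_const)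
  symm y hy u v := congrArg (c * ·) (hG.symm y hy u v)
  inv y hy := by
    obtain ⟨e, he⟩ := hG.inv y hy
    refine ⟨e.trans (ContinuousLinearEquiv.smulLeft (Units.mk0 c hc)), ?_⟩
    rw [← he]
    rfl

namespace CSACManifold

variable {m s l : ℕ}
  {L : Type*} [TopologicalSpace L] [ChartedSpace (Model m) L] [IsManifold (𝓡 m) ∞ L]
  {Λ : Fin s ⊕ Fin l → Type*} [∀ i, TopologicalSpace (Λ i)]
  [∀ i, ChartedSpace (Model (m - 1)) (Λ i)] [∀ i, IsManifold (𝓡 (m - 1)) ∞ (Λ i)]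
  {X : CSACManifold m s l L Λ} {j : Fin l} {θ₀ : Λ (Sum.inr j)}

/-- In the coordinates `(x, ρ) ↦ φ(x, tρ)`, a translation-invariant form does not depend on the
scale `t`. -/
theorem IsTranslationInvariant.pullForm_scaleEnd_eq {α : OneField (𝓡 m) L}
    (hα : X.IsTranslationInvariant α j) {t t' : ℝ} (ht : 2 * X.a (Sum.inr j) < t)
    (ht' : 2 * X.a (Sum.inr j) < t') {y : Model (m - 1) × ℝ}
    (hy : y ∈ scaleDom (k := m - 1) θ₀) (v : Model (m - 1) × ℝ) :
    pullForm (𝓡 m) (X.scaleEnd θ₀ t) α y v = pullForm (𝓡 m) (X.scaleEnd θ₀ t') α y v := by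
  obtain ⟨η, hη⟩ := hα
  have key : ∀ t, 2 * X.a (Sum.inr j) < t → pullForm (𝓡 m) (X.scaleEnd θ₀ t) α y v =
      pullForm (𝓡 (m - 1)) (fun z : Model (m - 1) × ℝ => (extChartAt (𝓡 (m - 1)) θ₀).symm z.1)
        η y v := by
    intro t ht
    have h1 := mfderiv_scaleEnd (X := X) ht hy
    have h2 := hη (scaleChart (k := m - 1) θ₀ t y).1 (scaleChart (k := m - 1) θ₀ t y).2
      (scaleChart_snd_mem ht hy)
    have h3 : mfderiv 𝓘(ℝ, Model (m - 1) × ℝ) (𝓡 (m - 1))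
        (Prod.fst ∘ scaleChart (k := m - 1) θ₀ t) y = _ :=
      mfderiv_comp (I' := coneModel (m - 1)) y mdifferentiableAt_fst
        (mdifferentiableAt_scaleChart (t := t) hy)
    have h4 := congrArg (fun A : Model (m - 1) × ℝ →L[ℝ] ℝ => A
      (mfderiv 𝓘(ℝ, Model (m - 1) × ℝ) (coneModel (m - 1)) (scaleChart (k := m - 1) θ₀ t) y v)) h2
    have h5 := congrArg (fun A : Model (m - 1) × ℝ →L[ℝ] Model m => A v) h1
    have h6 := congrArg (fun A : Model (m - 1) × ℝ →L[ℝ] Model (m - 1) => A v) h3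
    exact (congrArg (α (X.scaleEnd θ₀ t y)) h5).trans (h4.trans
      (congrArg (η ((extChartAt (𝓡 (m - 1)) θ₀).symm y.1)) h6.symm))
  rw [key t ht, key t' ht']

/-- The decay of a translation-invariant form, locally on the link: in the coordinates
`(x, ρ) ↦ φ(x, tρ)` the form does not depend on `t`, and the rescaled metric `t⁻² g`, which has
the same Levi-Civita connection as `g`, has bounded geometry as `t → ∞`. -/
theorem IsTranslationInvariant.exists_nhds_covDerivBound (hm : 0 < m) {α : OneField (𝓡 m) L}
    (hα : X.IsTranslationInvariant α j) (hα' : IsSmoothForm α) (θ₀ : Λ (Sum.inr j)) (k : ℕ) :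
    ∃ N ∈ 𝓝 θ₀, ∃ C : ℝ, ∀ᶠ r in atTop, ∀ θ ∈ N, CovDerivBound (𝓡 m) X.g.inner
      (formTensor (𝓡 m) α) k (X.φ (Sum.inr j) (θ, r)) (C * r ^ (-1 - k : ℝ)) := by
  set e := extChartAt (𝓡 (m - 1)) θ₀ with he
  obtain ⟨ε, hε, hεt⟩ := Metric.nhds_basis_closedBall.mem_iff.1
    (extChartAt_target_mem_nhds (I := 𝓡 (m - 1)) θ₀)
  set K := Metric.closedBall (e θ₀) ε with hKdef
  have hK : IsCompact K := isCompact_closedBall _ _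
  obtain ⟨R, hR⟩ := eventually_atTop.1
    (show ∀ᶠ r in atTop, _ from X.metric_compare (Sum.inr j))
  set T₀ := max (max R (2 * X.a (Sum.inr j) + 1)) 1 with hT₀
  -- otherwise the bounds fail at points with radii `t n → ∞`, over a compact part of a chart
  by_contra hcon
  push Not at hcon
  have hN : e.source ∩ e ⁻¹' K ∈ 𝓝 θ₀ := inter_mem (extChartAt_source_mem_nhds θ₀)
    ((continuousAt_extChartAt θ₀).preimage_mem_nhds (Metric.closedBall_mem_nhds _ hε))
  have hex : ∀ n : ℕ, ∃ t, T₀ + n ≤ t ∧ ∃ θ ∈ e.source ∩ e ⁻¹' K, ¬ CovDerivBound (𝓡 m) X.g.inner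
      (formTensor (𝓡 m) α) k (X.φ (Sum.inr j) (θ, t)) (n * t ^ (-1 - k : ℝ)) := fun n => by
    obtain ⟨t, h1, θ, h2, h3⟩ := frequently_atTop.1 (hcon _ hN n) (T₀ + n)
    exact ⟨t, h1, θ, h2, h3⟩
  choose t ht θ hθ hnot using hex
  have htT : ∀ n, T₀ ≤ t n := fun n => le_trans (by simp) (ht n)
  have ht1 : ∀ n, 1 ≤ t n := fun n => (le_max_right _ _).trans (htT n)
  have ht0 : ∀ n, 0 < t n := fun n => one_pos.trans_le (ht1 n)
  have hta : ∀ n, 2 * X.a (Sum.inr j) < t n := fun n => (lt_add_one _).trans_le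
    (((le_max_right _ _).trans (le_max_left _ _)).trans (htT n))
  have htR : ∀ n, R ≤ t n := fun n =>
    ((le_max_left _ _).trans (le_max_left _ _)).trans (htT n)
  have httop : Tendsto t atTop atTop := tendsto_atTop_mono (fun n => (le_add_of_nonneg_left
    (one_pos.le.trans (le_max_right _ _))).trans (ht n)) tendsto_natCast_atTop_atTop
  set x : ℕ → Model (m - 1) := fun n => e (θ n) with hx
  have hxK : ∀ n, x n ∈ K := fun n => (hθ n).2
  set y : ℕ → Model (m - 1) × ℝ := fun n => (x n, (1 : ℝ)) with hydef
  have hU := isOpen_scaleDom (k := m - 1) θ₀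
  have hK' : IsCompact (K ×ˢ {(1 : ℝ)}) := hK.prod isCompact_singleton
  have hK'U : K ×ˢ {(1 : ℝ)} ⊆ scaleDom (k := m - 1) θ₀ := by
    rintro ⟨a, b⟩ ⟨ha, rfl⟩
    exact ⟨hεt ha, show (1 : ℝ) / 2 < 1 by norm_num⟩
  have hyK : ∀ n, y n ∈ K ×ˢ {(1 : ℝ)} := fun n => ⟨hxK n, rfl⟩
  have hyU : ∀ n, y n ∈ scaleDom (k := m - 1) θ₀ := fun n => hK'U (hyK n)
  have hchart : ∀ n, scaleChart (k := m - 1) θ₀ (t n) (y n) = (θ n, t n) := fun n =>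
    Prod.ext (e.left_inv (hθ n).1) (mul_one (t n))
  have hend : ∀ n, X.scaleEnd θ₀ (t n) (y n) = X.φ (Sum.inr j) (θ n, t n) := fun n =>
    congrArg (X.φ (Sum.inr j)) (hchart n)
  let G : ℕ → Model (m - 1) × ℝ → Model (m - 1) × ℝ →L[ℝ] Model (m - 1) × ℝ →L[ℝ] ℝ :=
    fun n z => (t n ^ 2)⁻¹ • pullMet (𝓡 m) (X.scaleEnd θ₀ (t n)) X.g.inner z
  let T : ℕ → Model (m - 1) × ℝ → (Fin 1 → Model (m - 1) × ℝ) → ℝ :=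
    fun n => pullField (𝓡 m) (X.scaleEnd θ₀ (t n)) (formTensor (𝓡 m) α)
  have hpos : ∀ n, 0 < t n ^ 2 := fun n => pow_pos (ht0 n) 2
  have hgM : ∀ n, IsMetricOn (scaleDom (k := m - 1) θ₀)
      (pullMet (𝓡 m) (X.scaleEnd θ₀ (t n)) X.g.inner) := fun n => isMetricOn_scaleEnd (hta n)
  have hGM : ∀ n, IsMetricOn (scaleDom (k := m - 1) θ₀) (G n) := fun n =>
    (hgM n).const_smul (inv_ne_zero (hpos n).ne')
  -- the metrics `G n = t⁻² g` and the form have bounded derivatives at the points `y n`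
  have hGB : ∀ u v N, BddDeriv y N fun n z => G n z u v :=
    fun u v N => bddDeriv_scaleEnd hta httop hK hεt hxK u v N
  have hTT : ∀ n, IsTensorOn (scaleDom (k := m - 1) θ₀) (T n) := fun n =>
    isTensorOn_linear (A := pullForm (𝓡 m) (X.scaleEnd θ₀ (t n)) α) fun v =>
      contDiffOn_pullForm_apply hU (contMDiffOn_scaleEnd (hta n)) hα' v
  have hTB : ∀ v N, BddDeriv y N fun n z => T n z v := fun v N => by
    refine (BddDeriv.of_isCompact hU hK' hK'U hyK N ((hTT 0).smooth v)).congr fun n => ?_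
    filter_upwards [hU.mem_nhds (hyU n)] with z hz
    exact hα.pullForm_scaleEnd_eq (hta 0) (hta n) hz (v 0)
  have hGc : IsMetricOn (scaleDom (k := m - 1) θ₀) (X.coneCoord θ₀) :=
    isMetricOn_pullMet_scaleChart one_pos
  obtain ⟨c, hc, hcc⟩ := exists_pos_forall_mul_norm_sq_le hK' (hGc.smooth.continuousOn.mono hK'U)
    (B := X.coneCoord θ₀) fun z hz v hv => by
      have hz' := hK'U hz
      have hz2 : 0 < (scaleChart (k := m - 1) θ₀ 1 z).2 := by
        have : 1 / 2 < z.2 := hz'.2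
        show 0 < 1 * z.2
        linarith
      exact coneMetric_pos (X.g' (Sum.inr j)) hz2 fun h => hv
        (injective_mfderiv_scaleChart one_pos hz' (h.trans (map_zero (mfderiv
          𝓘(ℝ, Model (m - 1) × ℝ) (coneModel (m - 1)) (scaleChart (k := m - 1) θ₀ 1) z)).symm))
  -- the metrics `G n` are uniformly coercive, since `g` is comparable with the conical metric
  have hcoer : ∀ n v, c / 4 * ‖v‖ ^ 2 ≤ G n (y n) v v := by
    intro n v
    have h1 : ∀ w : Model (m - 1) × ℝ, coneMetric (X.g' (Sum.inr j)).inner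
        (scaleChart (k := m - 1) θ₀ (t n) (y n)) w w / 4 ≤
        pullMetric (X.φ (Sum.inr j)) X.g.inner (scaleChart (k := m - 1) θ₀ (t n) (y n)) w w := by
      rw [hchart n]
      exact fun w => (hR (t n) (htR n) (θ n) w).1
    have h2 := h1 (mfderiv 𝓘(ℝ, Model (m - 1) × ℝ) (coneModel (m - 1))
      (scaleChart (k := m - 1) θ₀ (t n)) (y n) v)
    have h3 := congrArg (fun A : Model (m - 1) × ℝ →L[ℝ] Model m =>
      X.g.inner (X.scaleEnd θ₀ (t n) (y n)) (A v) (A v)) (mfderiv_scaleEnd (X := X) (hta n) (hyU n))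
    have h4 : pullMet (coneModel (m - 1)) (scaleChart (k := m - 1) θ₀ (t n))
        (coneMetric (X.g' (Sum.inr j)).inner) (y n) v v / 4 ≤
        pullMet (𝓡 m) (X.scaleEnd θ₀ (t n)) X.g.inner (y n) v v := h2.trans (le_of_eq h3.symm)
    rw [pullMet_scaleChart (X.g' (Sum.inr j)) (hyU n)] at h4
    have h5 : c * ‖v‖ ^ 2 ≤ pullMet (coneModel (m - 1)) (scaleChart (k := m - 1) θ₀ 1)
      (coneMetric (X.g' (Sum.inr j)).inner) (y n) v v := hcc (y n) (hyK n) v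
    show _ ≤ (t n ^ 2)⁻¹ * pullMet (𝓡 m) (X.scaleEnd θ₀ (t n)) X.g.inner (y n) v v
    rw [← div_eq_inv_mul, le_div_iff₀ (hpos n)]
    refine le_trans ?_ h4
    have := mul_le_mul_of_nonneg_left h5 (hpos n).le
    linarith
  obtain ⟨C, hC0, hC⟩ := exists_bound_of_bounded_apply
    (fun n => (hTT n).iterCovDeriv hU (hGM n) k) hyU fun v =>
      (bddDeriv_iterCovDeriv (fun _ => hU) hyU hGM hGB (div_pos hc four_pos) hcoer hTT hTB k v 0)
  -- a vector of `g`-length one has norm at most `A / t` in the coordinates `(x, ρ)`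
  set A := √(c / 4)⁻¹ with hA
  obtain ⟨n, hn⟩ := exists_nat_ge (C * A ^ (1 + k))
  refine hnot n (CovDerivBound.mono (c := C * A ^ (1 + k) * t n ^ (-1 - k : ℝ)) ?_
    (mul_le_mul_of_nonneg_right hn (Real.rpow_nonneg (ht0 n).le _)))
  rw [← hend n]
  refine (covDerivBound_iff_pull (I := 𝓡 m) isOpen_univ (isMetricField_inner X.g)
    (isTensorField_formTensor hα') hU (contMDiffOn_scaleEnd (hta n)) (fun _ _ => mem_univ _)
    (fun z hz => isInvertible_of_injective (E := Model (m - 1) × ℝ) (F := Model m) ?_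
      (injective_mfderiv_scaleEnd (hta n) hz)) k (hyU n) _).2 fun v => ?_
  · simp
    omega
  have h1 := iterCovDeriv_of_smul hU (hGM n) (hgM n) (hpos n).ne' (a := 1) (fun z hz u v => by
    show _ = t n ^ 2 * ((t n ^ 2)⁻¹ * _)
    rw [← mul_assoc, mul_inv_cancel₀ (hpos n).ne', one_mul]
    rfl) (hTT n) (T' := T n)
    (fun z hz v => (one_mul _).symm) k (y n) (hyU n) v
  have h2 : |iterCovDeriv (pullMet (𝓡 m) (X.scaleEnd θ₀ (t n)) X.g.inner) (T n) k (y n) v| ≤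
      C * ∏ i, ‖v i‖ := by
    rw [h1, one_mul]
    exact hC n v
  refine h2.trans ?_
  have h3 : ∀ w, ‖w‖ ≤ A * (t n)⁻¹ *
      √(pullMet (𝓡 m) (X.scaleEnd θ₀ (t n)) X.g.inner (y n) w w) := by
    intro w
    have h4 : c / 4 * ‖w‖ ^ 2 ≤ (t n ^ 2)⁻¹ *
      pullMet (𝓡 m) (X.scaleEnd θ₀ (t n)) X.g.inner (y n) w w := hcoer n w
    have hc4 := div_pos hc four_pos
    rw [← Real.sqrt_sq (norm_nonneg w), ← Real.sqrt_sq (inv_pos.2 (ht0 n)).le, hA,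
      ← Real.sqrt_mul (by positivity), ← Real.sqrt_mul (by positivity)]
    refine Real.sqrt_le_sqrt ?_
    rw [inv_pow, mul_assoc, ← div_eq_inv_mul, le_div_iff₀ hc4, mul_comm]
    exact h4
  calc C * ∏ i, ‖v i‖
      ≤ C * ∏ i, (A * (t n)⁻¹ *
        √(pullMet (𝓡 m) (X.scaleEnd θ₀ (t n)) X.g.inner (y n) (v i) (v i))) := by
        gcongr with i
        exact h3 _
    _ = _ := by
        rw [Finset.prod_mul_distrib, Finset.prod_const, Finset.card_univ, Fintype.card_fin,
          mul_pow, mul_assoc, mul_assoc, mul_assoc]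
        congr 2
        rw [show (-1 - k : ℝ) = -((1 + k : ℕ) : ℝ) by push_cast; ring, Real.rpow_neg (ht0 n).le,
          Real.rpow_natCast, inv_pow]

/-- A translation-invariant form decays like `r⁻¹`, with all covariant derivatives. -/
theorem IsTranslationInvariant.exists_covDerivBound (hm : 0 < m) [CompactSpace (Λ (Sum.inr j))]
    {α : OneField (𝓡 m) L} (hα : X.IsTranslationInvariant α j) (hα' : IsSmoothForm α) {β : ℝ}
    (hβ : -1 ≤ β) (k : ℕ) :
    ∃ C : ℝ, ∀ᶠ r in endFilter (Sum.inr j : Fin s ⊕ Fin l), ∀ θ, CovDerivBound (𝓡 m) X.g.inner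
      (formTensor (𝓡 m) α) k (X.φ (Sum.inr j) (θ, r)) (C * r ^ (β - k)) := by
  have h : ∃ C : ℝ, ∀ᶠ r in atTop, ∀ θ ∈ (univ : Set (Λ (Sum.inr j))), CovDerivBound (𝓡 m)
      X.g.inner (formTensor (𝓡 m) α) k (X.φ (Sum.inr j) (θ, r)) (C * r ^ (-1 - k : ℝ)) := by
    refine isCompact_univ.induction_on ⟨0, by simp⟩ ?_ ?_ ?_
    · rintro N N' hN ⟨C, hC⟩
      exact ⟨C, hC.mono fun r hr θ hθ => hr θ (hN hθ)⟩
    · rintro N N' ⟨C, hC⟩ ⟨C', hC'⟩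
      refine ⟨max C C', ?_⟩
      filter_upwards [hC, hC', eventually_ge_atTop 0] with r h1 h2 hr θ hθ
      rcases hθ with hθ | hθ
      · exact (h1 θ hθ).mono (by gcongr; exact le_max_left _ _)
      · exact (h2 θ hθ).mono (by gcongr; exact le_max_right _ _)
    · intro θ₀ _
      obtain ⟨N, hN, C, hC⟩ := hα.exists_nhds_covDerivBound hm hα' θ₀ k
      exact ⟨N, mem_nhdsWithin_of_mem_nhds hN, C, hC⟩
  obtain ⟨C, hC⟩ := h
  refine ⟨|C|, ?_⟩
  show ∀ᶠ r in atTop, _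
  filter_upwards [hC, eventually_ge_atTop 1] with r hr h1 θ
  refine (hr θ (mem_univ _)).mono ?_
  gcongr
  · exact le_abs_self C

end CSACManifold

namespace CSACManifold

/-! ### The decomposition -/

variable {m s l : ℕ}
  {L : Type*} [TopologicalSpace L] [ChartedSpace (Model m) L] [IsManifold (𝓡 m) ∞ L]
  {Λ : Fin s ⊕ Fin l → Type*} [∀ i, TopologicalSpace (Λ i)]
  [∀ i, ChartedSpace (Model (m - 1)) (Λ i)] [∀ i, IsManifold (𝓡 (m - 1)) ∞ (Λ i)]
  {X : CSACManifold m s l L Λ} {β : Fin s ⊕ Fin l → ℝ}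

section EndFunctions

variable {ι : Type*} [Fintype ι] {e : ι → Fin s ⊕ Fin l} {f : ι → SmoothFun (𝓡 m) L}

theorem sum_smul_apply (c : ι → ℝ) (f : ι → SmoothFun (𝓡 m) L) (x : L) :
    (∑ i, c i • f i) x = ∑ i, c i * f i x := by
  rw [← ContMDiffMap.coeFnAddMonoidHom_apply, map_sum, Finset.sum_apply]
  rfl

theorem sum_smul_endFunction_apply (he : Function.Injective e)
    (hf : ∀ i, X.IsEndFunction (e i) (f i)) (c : ι → ℝ) (i : ι) {x : L}
    (hx : x ∈ X.endSet (e i)) : (∑ i, c i • f i) x = c i := by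
  rw [sum_smul_apply, Finset.sum_eq_single_of_mem i (Finset.mem_univ i), (hf i).1 x hx, mul_one]
  intro j _ hj
  rw [(hf j).2 (e i) (fun h => hj (he h).symm) x hx, mul_zero]

theorem sum_smul_endFunction_apply_of_notMem
    (hf : ∀ i, X.IsEndFunction (e i) (f i)) (c : ι → ℝ) {j : Fin s ⊕ Fin l} (hj : j ∉ range e)
    {x : L} (hx : x ∈ X.endSet j) : (∑ i, c i • f i) x = 0 := by
  rw [sum_smul_apply, Finset.sum_eq_zero]
  intro i _
  rw [(hf i).2 j (fun h => hj ⟨i, h.symm⟩) x hx, mul_zero]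

theorem d_sum_smul_endFunction_eq_zero (he : Function.Injective e)
    (hf : ∀ i, X.IsEndFunction (e i) (f i)) (c : ι → ℝ) (j : Fin s ⊕ Fin l) {x : L}
    (hx : x ∈ X.endSet j) : d (𝓡 m) L (∑ i, c i • f i) x = 0 := by
  by_cases hj : j ∈ range e
  · obtain ⟨i, rfl⟩ := hj
    exact d_apply_eq_zero (X.isOpen_endSet _)
      (fun x hx => sum_smul_endFunction_apply he hf c i hx) hx
  · exact d_apply_eq_zero (X.isOpen_endSet _)
      (fun x hx => sum_smul_endFunction_apply_of_notMem hf c hj hx) hx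

theorem nonempty_endSet [∀ i, Nonempty (Λ i)] (i : Fin s ⊕ Fin l) : (X.endSet i).Nonempty := by
  obtain ⟨r, hr⟩ := (eventually_endFilter_openRange (X.a_pos i) i).exists
  exact ⟨_, X.mem_endSet hr (Classical.arbitrary (Λ i))⟩

theorem finrank_span_endFunctions [∀ i, Nonempty (Λ i)] (he : Function.Injective e)
    (hf : ∀ i, X.IsEndFunction (e i) (f i)) :
    Module.finrank ℝ (Submodule.span ℝ (range f)) = Fintype.card ι := by
  refine finrank_span_eq_card (Fintype.linearIndependent_iff.2 fun c hc i => ?_)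
  obtain ⟨x, hx⟩ := X.nonempty_endSet (e i)
  rw [← sum_smul_endFunction_apply he hf c i hx, hc]
  rfl

theorem tendsto_of_mem_weightedFun {w : SmoothFun (𝓡 m) L} (hw : w ∈ X.weightedFun β)
    {i : Fin s ⊕ Fin l} (hi : Decays i (β i)) (θ : Λ i) :
    Tendsto (fun r => w (X.φ i (θ, r))) (endFilter i) (𝓝 0) := by
  obtain ⟨C, hC⟩ := (mem_weightedFun_iff.1 hw).1 i
  have h := hi.tendsto.const_mul C
  rw [mul_zero] at h
  exact squeeze_zero_norm' (hC.mono fun r hr => hr θ) h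

/-- If `∑ cᵢ fᵢ` and a constant differ by elements of `C^∞_β`, with `β` decaying on the ends that
carry the `fᵢ`, then all `cᵢ` are equal to that constant. -/
theorem eq_const_of_sum_smul_add [∀ i, Nonempty (Λ i)] (he : Function.Injective e)
    (hf : ∀ i, X.IsEndFunction (e i) (f i)) (hβ : ∀ i, Decays (e i) (β (e i))) {c : ι → ℝ} {k : ℝ}
    {w w' : SmoothFun (𝓡 m) L} (hw : w ∈ X.weightedFun β) (hw' : w' ∈ X.weightedFun β)
    (h : ∀ x, (∑ i, c i • f i) x = k + (w x - w' x)) (i : ι) : c i = k := by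
  let θ := Classical.arbitrary (Λ (e i))
  have h1 := ((tendsto_of_mem_weightedFun hw (hβ i) θ).sub
    (tendsto_of_mem_weightedFun hw' (hβ i) θ)).const_add k
  rw [sub_zero, add_zero] at h1
  refine tendsto_nhds_unique (tendsto_const_nhds.congr' ?_) h1
  filter_upwards [eventually_endFilter_openRange (X.a_pos (e i)) (e i)] with r hr
  rw [← h, sum_smul_endFunction_apply he hf c i (X.mem_endSet hr θ)]

/-- A function whose differential is in `C^∞_{β-1}` is, up to a combination of the functions `fᵢ`
belonging to the ends where `β` decays, in `C^∞_β`. -/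
theorem exists_eq_sum_smul_add [∀ i, CompactSpace (Λ i)] [∀ i, ConnectedSpace (Λ i)]
    (he : Function.Injective e)
    (hf : ∀ i, X.IsEndFunction (e i) (f i)) (hβ : ∀ i, Decays (e i) (β (e i)))
    (hβ' : ∀ i ∉ range e, ∃ j, i = Sum.inr j ∧ 0 < β i) {G : SmoothFun (𝓡 m) L}
    (hG : X.IsWeighted (fun i => β i - 1) (formTensor (𝓡 m) (d (𝓡 m) L G))) :
    ∃ c : ι → ℝ, G - ∑ i, c i • f i ∈ X.weightedFun β := by
  have hlim : ∀ i, ∃ c, ∃ C : ℝ, ∀ᶠ r in endFilter (e i), ∀ θ,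
      |G (X.φ (e i) (θ, r)) - c| ≤ C * r ^ β (e i) := by
    intro i
    obtain ⟨C, r₀, -, hr₀, hsub, hC⟩ := hG.exists_isEndBound (e i)
    obtain ⟨c, hc⟩ := hC.exists_abs_sub_const_le (d_mem_closedForms G) hr₀ (hβ i)
      (hsub.trans (X.openRange_subset (e i))) (isPrim_d G _)
    exact ⟨c, _, (eventually_openRange hr₀ (e i)).mono hc⟩
  choose c hc using hlim
  refine ⟨c, mem_weightedFun_of_isWeighted hG (fun i x hx => ?_) fun j => ?_⟩
  · rw [map_sub]
    change d (𝓡 m) L G x - d (𝓡 m) L (∑ i, c i • f i) x = d (𝓡 m) L G x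
    rw [d_sum_smul_endFunction_eq_zero he hf c i hx, sub_zero]
  · by_cases hj : j ∈ range e
    · obtain ⟨i, rfl⟩ := hj
      obtain ⟨C, hC⟩ := hc i
      refine ⟨C, ?_⟩
      filter_upwards [hC, eventually_endFilter_openRange (X.a_pos (e i)) (e i)] with r h1 h2 θ
      refine le_trans (le_of_eq (congrArg _ ?_)) (h1 θ)
      rw [← sum_smul_endFunction_apply he hf c i (X.mem_endSet h2 θ)]
      rfl
    · obtain ⟨j, rfl, hpos⟩ := hβ' j hj
      obtain ⟨C, r₀, -, hr₀, hsub, hC⟩ := hG.exists_isEndBound (Sum.inr j)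
      obtain ⟨K, hK⟩ := hC.exists_abs_le hr₀ hpos (hsub.trans (X.openRange_subset _))
        (isPrim_d G _)
      refine ⟨K, ?_⟩
      filter_upwards [show ∀ᶠ r in endFilter (Sum.inr j : Fin s ⊕ Fin l), r > r₀ + 1 from
        eventually_gt_atTop _, eventually_endFilter_openRange (X.a_pos (Sum.inr j)) (Sum.inr j)]
        with r h1 h2 θ
      refine le_trans (le_of_eq (congrArg _ ?_)) (hK r h1 θ)
      change G _ - (∑ i, c i • f i) _ = G _
      rw [sum_smul_endFunction_apply_of_notMem hf c hj (X.mem_endSet h2 θ), sub_zero]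

end EndFunctions

theorem exists_forall_eq_const_of_d_eq_zero [PreconnectedSpace L] [Nonempty L]
    {f : SmoothFun (𝓡 m) L} (hf : d (𝓡 m) L f = 0) : ∃ k, ∀ x, f x = k := by
  have h : IsPrim (0 : OneField (𝓡 m) L) univ f := hf ▸ isPrim_d f univ
  refine ⟨f (Classical.arbitrary L), fun x => ?_⟩
  have := h.sub_eq_of_isPreconnected isOpen_univ isPreconnected_univ
    (isPrim_zero (I := 𝓡 m) univ) (mem_univ x) (mem_univ (Classical.arbitrary L))
  simpa using this

theorem IsWeighted.formTensor_add {α α' : OneField (𝓡 m) L}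
    (h : X.IsWeighted β (formTensor (𝓡 m) α)) (h' : X.IsWeighted β (formTensor (𝓡 m) α'))
    (hα : IsSmoothForm α) (hα' : IsSmoothForm α') :
    X.IsWeighted β (formTensor (𝓡 m) (α + α')) :=
  h.add h' (isTensorField_formTensor hα) (isTensorField_formTensor hα')

/-- A form that vanishes on the ends is in all weighted spaces. -/
theorem isWeighted_of_eq_zero_on_ends {α : OneField (𝓡 m) L}
    (h : ∀ i, ∀ x ∈ X.endSet i, α x = 0) : X.IsWeighted β (formTensor (𝓡 m) α) := fun i k =>
  exists_covDerivBound_of_eventually_zero ((eventually_endFilter_openRange (X.a_pos i) i).mono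
    fun _ hr θ => funext fun v => congrArg (fun A => A (v 0)) (h i _ (X.mem_endSet hr θ))) (β i) k

/-- The class of a closed form that becomes, after subtraction of an exact form, eventually zero
along `F` has a representative in a space `V` of representatives of the cohomology with supports
given by `F`. -/
theorem exists_mem_d_eq_sub {F : Filter L} {V : Submodule ℝ (closedForms (𝓡 m) L)}
    (hV : BijOn (exactForms (𝓡 m) L).mkQ V (LinearMap.range (gammaMap (𝓡 m) L F)))
    {α : OneField (𝓡 m) L} (hα : α ∈ closedForms (𝓡 m) L) {u : SmoothFun (𝓡 m) L}
    (hu : ∀ᶠ x in F, α x = d (𝓡 m) L u x) :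
    ∃ α' ∈ V, ∃ G : SmoothFun (𝓡 m) L, d (𝓡 m) L G = α - α' := by
  let γ : closedForms (𝓡 m) L := ⟨α, hα⟩ - ⟨d (𝓡 m) L u, d_mem_closedForms u⟩
  have h1 : γ ∈ closedFormsV (𝓡 m) L F := hu.mono fun x hx => by
    change α x - d (𝓡 m) L u x = 0
    rw [hx, sub_self]
  obtain ⟨α', hα', h2⟩ := hV.surjOn (show (exactForms (𝓡 m) L).mkQ γ ∈ _ by
    rw [range_gammaMap]
    exact ⟨γ, h1, rfl⟩)
  obtain ⟨G, hG⟩ := mkQ_eq_iff.1 h2.symm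
  refine ⟨α', hα', G + u, ?_⟩
  rw [map_add, hG]
  change α - d (𝓡 m) L u - α' + d (𝓡 m) L u = _
  abel

/-- The component in a space of representatives is determined by the cohomology class. -/
theorem eq_of_add_d_eq {S : Set (H1 (𝓡 m) L)} {V : Submodule ℝ (closedForms (𝓡 m) L)}
    (hV : BijOn (exactForms (𝓡 m) L).mkQ V S) {α α' : closedForms (𝓡 m) L} (hα : α ∈ V)
    (hα' : α' ∈ V) {u u' : SmoothFun (𝓡 m) L}
    (h : (α : OneField (𝓡 m) L) + d (𝓡 m) L u = α' + d (𝓡 m) L u') : α = α' := by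
  refine hV.injOn hα hα' (mkQ_eq_iff.2 ⟨u' - u, ?_⟩)
  rw [map_sub, sub_eq_sub_iff_add_eq_add, add_comm, ← h, add_comm]

end CSACManifold

namespace CSACManifold

variable {m s l : ℕ}
  {L : Type*} [TopologicalSpace L] [ChartedSpace (Model m) L] [IsManifold (𝓡 m) ∞ L]
  {Λ : Fin s ⊕ Fin l → Type*} [∀ i, TopologicalSpace (Λ i)] [∀ i, CompactSpace (Λ i)]
  [∀ i, ChartedSpace (Model (m - 1)) (Λ i)] [∀ i, IsManifold (𝓡 (m - 1)) ∞ (Λ i)]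
  {X : CSACManifold m s l L Λ} {β : Fin s ⊕ Fin l → ℝ}
  {V : Submodule ℝ (closedForms (𝓡 m) L)}

theorem IsRepCompact.isWeighted [T2Space L] (hV : IsRepCompact V) {α : closedForms (𝓡 m) L}
    (hα : α ∈ V) : X.IsWeighted β (formTensor (𝓡 m) (α : OneField (𝓡 m) L)) := fun i k =>
  exists_covDerivBound_of_eventually_zero ((eventually_of_cocompact (hV.support hα) i).mono
    fun _ hr θ => funext fun v => congrArg (fun A => A (v 0)) (hr θ)) (β i) k

/-- A translation-invariant form is `O(r⁻¹)` on the AC ends, and therefore in `C^∞_β` for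
`β ≥ -1`. -/
theorem IsRepSing.isWeighted (hm : 0 < m) (hV : X.IsRepSing V) {α : closedForms (𝓡 m) L}
    (hα : α ∈ V) (hβ : ∀ i, -1 ≤ β (Sum.inr i)) :
    X.IsWeighted β (formTensor (𝓡 m) (α : OneField (𝓡 m) L))
  | Sum.inl i, k => exists_covDerivBound_of_eventually_zero
      ((eventually_singFilter.1 (hV.support hα) i).mono fun _ hr θ => funext fun v =>
        congrArg (fun A => A (v 0)) (hr θ)) _ k
  | Sum.inr i, k => (hV.invariant α hα i).exists_covDerivBound hm α.2.1 (hβ i) k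

/-! ### The direct sums -/

variable [T2Space L] [SecondCountableTopology L] [ConnectedSpace L] [∀ i, ConnectedSpace (Λ i)]

/-- If `r^β` tends to zero on all ends, a closed form in `C^∞_{β-1}` is exact outside a compact set,
and the remaining function is asymptotic to constants. -/
theorem isDirectSum_of_decays (hV : IsRepCompact V) {f : Fin s ⊕ Fin l → SmoothFun (𝓡 m) L}
    (hf : ∀ i, X.IsEndFunction i (f i)) (hf1 : ∑ i, f i = 1) (hβ : ∀ i, Decays i (β i)) :
    IsDirectSum₃ (X.weightedClosedForms fun i => β i - 1)
      (V.map (closedForms (𝓡 m) L).subtype)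
      ((Submodule.span ℝ (range f)).map (d (𝓡 m) L)) (d (𝓡 m) L '' X.weightedFun β) := by
  have he : Function.Injective (id : Fin s ⊕ Fin l → _) := Function.injective_id
  refine ⟨?_, fun α hα => ?_⟩
  · rintro _ ⟨α, hα, rfl⟩ _ ⟨u, hu, rfl⟩ _ ⟨w, hw, rfl⟩
    obtain ⟨c, rfl⟩ := (Submodule.mem_span_range_iff_exists_fun ℝ).1 hu
    refine ⟨add_mem (add_mem α.2 (d_mem_closedForms _)) (d_mem_closedForms _),
      ((hV.isWeighted hα).formTensor_add (isWeighted_of_eq_zero_on_ends fun j x hx =>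
        d_sum_smul_endFunction_eq_zero he hf c j hx) α.2.1 (isSmoothForm_d _)).formTensor_add
        (mem_weightedFun_iff.1 hw).2 (α.2.1.add (isSmoothForm_d _)) (isSmoothForm_d _)⟩
  · obtain ⟨u, hu⟩ := exists_d_eq_on_ends hα.1 hα.2 (A := univ) fun i _ => hβ i
    have hc : ∀ᶠ x in cocompact L, α x = d (𝓡 m) L u x := by
      filter_upwards [X.isCompact_core.compl_mem_cocompact] with x hx
      rw [compl_compl] at hx
      obtain ⟨i, hi⟩ := mem_iUnion.1 hx
      exact (hu i (mem_univ i) x hi).symm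
    obtain ⟨α', hα', G, hG⟩ := exists_mem_d_eq_sub hV.bijOn hα.1 hc
    have hGw : X.IsWeighted (fun i => β i - 1) (formTensor (𝓡 m) (d (𝓡 m) L G)) := by
      rw [hG, sub_eq_add_neg]
      exact hα.2.formTensor_add (hV.isWeighted (neg_mem hα')) hα.1.1 (-α').2.1
    obtain ⟨c, hc⟩ := exists_eq_sum_smul_add he hf hβ (fun i hi => absurd ⟨i, rfl⟩ hi) hGw
    refine ⟨(α', d (𝓡 m) L (∑ i, c i • f i), d (𝓡 m) L (G - ∑ i, c i • f i)),
      ⟨⟨α', hα', rfl⟩, ⟨_, (Submodule.mem_span_range_iff_exists_fun ℝ).2 ⟨c, rfl⟩, rfl⟩,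
        ⟨_, hc, rfl⟩, ?_⟩, ?_⟩
    · change (α' : OneField (𝓡 m) L) + d (𝓡 m) L (∑ i, c i • f i) +
        d (𝓡 m) L (G - ∑ i, c i • f i) = α
      rw [add_assoc, ← map_add, add_sub_cancel, hG, add_sub_cancel]
    · rintro ⟨_, _, _⟩ ⟨⟨α'', hα'', rfl⟩, ⟨u', hu', rfl⟩, ⟨w, hw, rfl⟩, hsum⟩
      obtain ⟨c', rfl⟩ := (Submodule.mem_span_range_iff_exists_fun ℝ).1 hu'
      change (α'' : OneField (𝓡 m) L) + d (𝓡 m) L (∑ i, c' i • f i) + d (𝓡 m) L w = α at hsum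
      have h0 : (α'' : OneField (𝓡 m) L) + d (𝓡 m) L (∑ i, c' i • f i + w) =
          α' + d (𝓡 m) L G := by
        rw [map_add, ← add_assoc, hsum, hG, add_sub_cancel]
      obtain rfl := eq_of_add_d_eq hV.bijOn hα'' hα' h0
      -- the functions differ by a constant, because the manifold is connected
      have h1 : d (𝓡 m) L (∑ i, (c' i - c i) • f i + w - (G - ∑ i, c i • f i)) = 0 := by
        simp only [sub_smul, Finset.sum_sub_distrib]
        rw [show ∑ i, c' i • f i - ∑ i, c i • f i + w - (G - ∑ i, c i • f i) =
          (∑ i, c' i • f i + w) - G by abel, map_sub, sub_eq_zero]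
        exact add_left_cancel h0
      obtain ⟨k, hk⟩ := exists_forall_eq_const_of_d_eq_zero h1
      have h2 := eq_const_of_sum_smul_add he hf hβ hc hw (c := fun i => c' i - c i) (k := k)
        fun x => by
          have : (∑ i, (c' i - c i) • f i) x + w x - (G - ∑ i, c i • f i) x = k := hk x
          linarith
      -- the two combinations of the `fᵢ` differ by a constant, because `∑ fᵢ = 1`
      have h3 : d (𝓡 m) L (∑ i, (c' i - c i) • f i) = 0 := by
        simp only [h2, ← Finset.smul_sum, hf1]
        rw [map_smul]
        funext x
        rw [OneField.smul_apply, d_apply_eq_zero (c := 1) isOpen_univ (fun _ _ => rfl)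
          (mem_univ x), smul_zero]
        rfl
      have h4 : d (𝓡 m) L (∑ i, c' i • f i) = d (𝓡 m) L (∑ i, c i • f i) := by
        rw [← sub_eq_zero, ← map_sub, ← Finset.sum_sub_distrib]
        simpa only [sub_smul] using h3
      rw [map_add, h4] at h0
      have h5 : d (𝓡 m) L w = d (𝓡 m) L (G - ∑ i, c i • f i) := by
        rw [map_sub, eq_sub_iff_add_eq, add_comm]
        exact add_left_cancel h0
      exact Prod.ext rfl (Prod.ext h4 h5)

theorem isDirectSum_span_weightedFun {f : Fin s → SmoothFun (𝓡 m) L}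
    (hf : ∀ i, X.IsEndFunction (Sum.inl i) (f i)) (hβ : ∀ i, 0 < β (Sum.inl i)) :
    IsDirectSum₂ ((Submodule.span ℝ (range f) : Set (SmoothFun (𝓡 m) L)) + X.weightedFun β)
      (Submodule.span ℝ (range f)) (X.weightedFun β) := by
  refine ⟨fun a ha b hb => add_mem_add ha hb, ?_⟩
  rintro _ ⟨u, hu, w, hw, rfl⟩
  refine ⟨(u, w), ⟨hu, hw, rfl⟩, ?_⟩
  rintro ⟨u', w'⟩ ⟨hu', hw', h⟩
  change u' + w' = u + w at h
  obtain ⟨c, rfl⟩ := (Submodule.mem_span_range_iff_exists_fun ℝ).1 hu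
  obtain ⟨c', rfl⟩ := (Submodule.mem_span_range_iff_exists_fun ℝ).1 hu'
  have h1 : ∑ i, (c' i - c i) • f i = w - w' := by
    simp only [sub_smul, Finset.sum_sub_distrib]
    rw [sub_eq_sub_iff_add_eq_add, h, add_comm]
  have h2 := eq_const_of_sum_smul_add Sum.inl_injective hf (β := β) hβ hw hw' (k := 0)
    (c := fun i => c' i - c i) fun x => by
      rw [h1, zero_add]
      rfl
  have h3 : c' = c := funext fun i => sub_eq_zero.1 (h2 i)
  subst h3
  exact Prod.ext rfl (add_left_cancel h)

/-- If `β > 0` on all ends, then `r^β` tends to zero on the CS ends only, and on the AC ends every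
primitive of a form in `C^∞_{β-1}` is `O(r^β)`. -/
theorem isDirectSum_of_pos (hm : 0 < m) (hV : X.IsRepSing V) {f : Fin s → SmoothFun (𝓡 m) L}
    (hf : ∀ i, X.IsEndFunction (Sum.inl i) (f i)) (hβ : ∀ i, 0 < β i) :
    IsDirectSum₂ (X.weightedClosedForms fun i => β i - 1)
      (V.map (closedForms (𝓡 m) L).subtype)
      (d (𝓡 m) L '' (Submodule.span ℝ (range f) + X.weightedFun β)) := by
  have he : Function.Injective (Sum.inl : Fin s → Fin s ⊕ Fin l) := Sum.inl_injective
  have hVw : ∀ {α}, α ∈ V →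
      X.IsWeighted (fun i => β i - 1) (formTensor (𝓡 m) (α : OneField (𝓡 m) L)) := fun hα =>
    hV.isWeighted hm hα fun i => by linarith [hβ (Sum.inr i)]
  refine ⟨?_, fun α hα => ?_⟩
  · rintro _ ⟨α, hα, rfl⟩ _ ⟨_, ⟨u, hu, w, hw, rfl⟩, rfl⟩
    obtain ⟨c, rfl⟩ := (Submodule.mem_span_range_iff_exists_fun ℝ).1 hu
    refine ⟨add_mem α.2 (d_mem_closedForms _), (hVw hα).formTensor_add ?_ α.2.1
      (isSmoothForm_d _)⟩
    simp only [map_add]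
    exact (isWeighted_of_eq_zero_on_ends fun j x hx => d_sum_smul_endFunction_eq_zero he hf c j
      hx).formTensor_add (mem_weightedFun_iff.1 hw).2 (isSmoothForm_d _) (isSmoothForm_d _)
  · obtain ⟨u, hu⟩ := exists_d_eq_on_ends hα.1 hα.2 (A := range Sum.inl) (by
      rintro _ ⟨i, rfl⟩
      exact hβ (Sum.inl i))
    have hc : ∀ᶠ x in X.singFilter, α x = d (𝓡 m) L u x := eventually_singFilter.2 fun i =>
      (eventually_endFilter_openRange (X.a_pos (Sum.inl i)) (Sum.inl i)).mono fun r hr θ =>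
        (hu _ ⟨i, rfl⟩ _ (X.mem_endSet hr θ)).symm
    obtain ⟨α', hα', G, hG⟩ := exists_mem_d_eq_sub hV.bijOn hα.1 hc
    have hGw : X.IsWeighted (fun i => β i - 1) (formTensor (𝓡 m) (d (𝓡 m) L G)) := by
      rw [hG, sub_eq_add_neg]
      exact hα.2.formTensor_add (hVw (neg_mem hα')) hα.1.1 (-α').2.1
    obtain ⟨c, hc⟩ := exists_eq_sum_smul_add he hf (fun i => hβ (Sum.inl i)) (by
      rintro (i | i) hi
      · exact absurd ⟨i, rfl⟩ hi
      · exact ⟨i, rfl, hβ _⟩) hGw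
    refine ⟨(α', d (𝓡 m) L G), ⟨⟨α', hα', rfl⟩, ⟨G, ⟨∑ i, c i • f i,
      (Submodule.mem_span_range_iff_exists_fun ℝ).2 ⟨c, rfl⟩, _, hc, add_sub_cancel _ _⟩, rfl⟩,
      ?_⟩, ?_⟩
    · change (α' : OneField (𝓡 m) L) + d (𝓡 m) L G = α
      rw [hG, add_sub_cancel]
    · rintro ⟨_, _⟩ ⟨⟨α'', hα'', rfl⟩, ⟨u', -, rfl⟩, hsum⟩
      change (α'' : OneField (𝓡 m) L) + d (𝓡 m) L u' = α at hsum
      have h0 : (α'' : OneField (𝓡 m) L) + d (𝓡 m) L u' = α' + d (𝓡 m) L G := by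
        rw [hsum, hG, add_sub_cancel]
      obtain rfl := eq_of_add_d_eq hV.bijOn hα'' hα' h0
      exact Prod.ext rfl (add_left_cancel h0)

end CSACManifold

end CSAC

end

theorem mainTheorem7 {m s l : ℕ} (hm : 3 ≤ m) (hsl : 0 < s + l)
    {L : Type*} [TopologicalSpace L] [T2Space L] [SecondCountableTopology L] [ConnectedSpace L]
    [ChartedSpace (CSAC.Model m) L] [IsManifold (𝓡 m) ∞ L]
    {Λ : Fin s ⊕ Fin l → Type*} [∀ i, TopologicalSpace (Λ i)] [∀ i, T2Space (Λ i)]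
    [∀ i, CompactSpace (Λ i)] [∀ i, ConnectedSpace (Λ i)]
    [∀ i, ChartedSpace (CSAC.Model (m - 1)) (Λ i)] [∀ i, IsManifold (𝓡 (m - 1)) ∞ (Λ i)]
    (X : CSAC.CSACManifold m s l L Λ) :
    -- the choices made below are possible
    ((∃ V : Submodule ℝ (CSAC.closedForms (𝓡 m) L), CSAC.CSACManifold.IsRepCompact V) ∧
      (∃ V : Submodule ℝ (CSAC.closedForms (𝓡 m) L), X.IsRepSing V) ∧
      ∃ f : Fin s ⊕ Fin l → CSAC.SmoothFun (𝓡 m) L,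
        (∀ i, X.IsEndFunction i (f i)) ∧ ∑ i, f i = 1) ∧
    -- the case `μ > 0`, `lam < 0`
    (∀ (V : Submodule ℝ (CSAC.closedForms (𝓡 m) L))
        (f : Fin s ⊕ Fin l → CSAC.SmoothFun (𝓡 m) L)
        (E : Submodule ℝ (CSAC.SmoothFun (𝓡 m) L)),
      CSAC.CSACManifold.IsRepCompact V → (∀ i, X.IsEndFunction i (f i)) → ∑ i, f i = 1 →
      E = Submodule.span ℝ (range f) →
      Module.finrank ℝ E = s + l ∧
      ∀ (μ : Fin s → ℝ) (lam : Fin l → ℝ), (∀ i, 0 < μ i) → (∀ i, lam i < 0) →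
        CSAC.IsDirectSum₃ (X.weightedClosedForms (Sum.elim (μ · - 1) (lam · - 1)))
          (V.map (CSAC.closedForms (𝓡 m) L).subtype) (E.map (CSAC.d (𝓡 m) L))
          (CSAC.d (𝓡 m) L '' X.weightedFun (Sum.elim μ lam))) ∧
    -- the case `μ > 0`, `lam > 0`
    (∀ (V : Submodule ℝ (CSAC.closedForms (𝓡 m) L))
        (f : Fin s → CSAC.SmoothFun (𝓡 m) L)
        (E : Submodule ℝ (CSAC.SmoothFun (𝓡 m) L)),
      X.IsRepSing V → (∀ i, X.IsEndFunction (Sum.inl i) (f i)) →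
      E = Submodule.span ℝ (range f) →
      Module.finrank ℝ E = s ∧
      ∀ (μ : Fin s → ℝ) (lam : Fin l → ℝ), (∀ i, 0 < μ i) → (∀ i, 0 < lam i) →
        CSAC.IsDirectSum₂ ((E : Set (CSAC.SmoothFun (𝓡 m) L)) + X.weightedFun (Sum.elim μ lam))
          E (X.weightedFun (Sum.elim μ lam)) ∧
        CSAC.IsDirectSum₂ (X.weightedClosedForms (Sum.elim (μ · - 1) (lam · - 1)))
          (V.map (CSAC.closedForms (𝓡 m) L).subtype)
          (CSAC.d (𝓡 m) L '' (E + X.weightedFun (Sum.elim μ lam)))) := by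
  classical
  refine ⟨⟨X.exists_isRepCompact, X.exists_isRepSing, X.exists_endFunctions hsl⟩, ?_, ?_⟩
  · rintro V f E hV hf hf1 rfl
    refine ⟨?_, fun μ lam hμ hlam => ?_⟩
    · rw [CSAC.CSACManifold.finrank_span_endFunctions Function.injective_id hf]
      simp
    · have hβ : (Sum.elim (μ · - 1) (lam · - 1) : Fin s ⊕ Fin l → ℝ) =
          fun i => Sum.elim μ lam i - 1 := by
        funext i
        cases i <;> rfl
      rw [hβ]
      exact CSAC.CSACManifold.isDirectSum_of_decays hV hf hf1 fun i => by
        cases i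
        · exact hμ _
        · exact hlam _
  · rintro V f E hV hf rfl
    refine ⟨?_, fun μ lam hμ hlam => ⟨CSAC.CSACManifold.isDirectSum_span_weightedFun hf hμ, ?_⟩⟩
    · rw [CSAC.CSACManifold.finrank_span_endFunctions Sum.inl_injective hf]
      simp
    · have hβ : (Sum.elim (μ · - 1) (lam · - 1) : Fin s ⊕ Fin l → ℝ) =
          fun i => Sum.elim μ lam i - 1 := by
        funext i
        cases i <;> rfl
      rw [hβ]
      exact CSAC.CSACManifold.isDirectSum_of_pos (by omega) hV hf fun i => by
        cases i
        · exact hμ _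
        · exact hlam _
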